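/- Let $d\ge 1$, let $\Omega\subset\mathbb{R}^d$ be a bounded open set with Lipschitz boundary (near each boundary point, after a rigid motion, $\Omega$ is the strict epigraph of a Lipschitz function of $d-1$ variables), let $\Gamma=\partial\Omega$ be equipped with the $(d-1)$-dimensional Hausdorff measure $\sigma$, and let $\beta\in L^\infty(\Gamma)$ be complex-valued. All function spaces are complex. For $u\in H^1(\Omega)$, a function $\varphi\in L^2(\Gamma)$ is called a trace of $u$ if there are $u_n\in C(\overline\Omega)\cap H^1(\Omega)$ with $u_n\to u$ in $H^1(\Omega)$ and $u_n|_\Gamma\to\varphi$ in $L^2(\Gamma)$. For $u\in H^1(\Omega)$ whose distributional Laplacian $\Delta u$ lies in $L^2(\Omega)$ and $h\in L^2(\Gamma)$, we write $\partial_\nu u=h$ if \[ \int_\Omega (\Delta u)\,\overline{v} + \int_\Omega \nabla u\cdot\overline{\nabla v} = \int_\Gamma h\,\overline{v}\,d\sigma\qquad\text{for all } v\in C(\overline\Omega)\cap H^1(\Omega). \] Then every $u\in H^1(\Omega)$ has exactly one trace $u_\Gamma\in L^2(\Gamma)$, and the operator $\Delta^{\mathrm W}_{H^1}$ in $H^1(\Omega)$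 given by \[ D(\Delta^{\mathrm W}_{H^1})=\{u\in H^1(\Omega):\ \Delta u\in H^1(\Omega),\ \partial_\nu u+\beta u_\Gamma+(\Delta u)_\Gamma=0\},\qquad \Delta^{\mathrm W}_{H^1}u=\Delta u, \] where the boundary condition means that $\partial_\nu u = -\beta u_\Gamma-(\Delta u)_\Gamma$ in $L^2(\Gamma)$, generates a holomorphic $C_0$-semigroup on $H^1(\Omega)$; that is, it is the generator of a $C_0$-semigroup $(T(t))_{t\ge0}$ on $H^1(\Omega)$ which, for some $\theta\in(0,\pi/2]$, has a holomorphic extension to the sector $\{z\ne0:|\arg z|<\theta\}$ that is bounded on $\{z\neq 0:|\arg z|<\theta',\ |z|\le1\}$ for every $\theta'\in(0,\theta)$. -/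

import Mathlib

open MeasureTheory Filter Topology Set
open scoped ContDiff ENNReal

noncomputable section

namespace Wentzell

/-- The Euclidean space `ℝ^d`. -/
abbrev E (d : ℕ) : Type := EuclideanSpace ℝ (Fin d)

variable {d : ℕ}

/-- `Ω` has Lipschitz boundary: near each boundary point, `Ω` is the strict epigraph of a
Lipschitz function defined on a hyperplane `e^⊥` (in the direction of the unit vector `e`). -/
def HasLipschitzBoundary (Ω : Set (E d)) : Prop :=
  ∀ x ∈ frontier Ω, ∃ (U : Set (E d)) (e : E d) (K : NNReal) (g : (Submodule.span ℝ {e})ᗮ → ℝ),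
    IsOpen U ∧ x ∈ U ∧ ‖e‖ = 1 ∧ LipschitzWith K g ∧
      Ω ∩ U = {y ∈ U | g ((Submodule.span ℝ {e})ᗮ.orthogonalProjectionOnto y) < inner ℝ e y}

/-- The surface measure `σ` on `Γ = ∂Ω`: the `(d-1)`-dimensional Hausdorff measure,
in the normalization that agrees with Lebesgue measure on hyperplanes. -/
def surfaceMeasure (Ω : Set (E d)) : Measure (E d) :=
  (Measure.euclideanHausdorffMeasure (d - 1)).restrict (frontier Ω)

/-- `L²(Ω)`, complex-valued. -/
abbrev L2 (Ω : Set (E d)) : Type := Lp ℂ 2 (volume.restrict Ω)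

/-- `L²(Γ)`, complex-valued. -/
abbrev L2Bdry (Ω : Set (E d)) : Type := Lp ℂ 2 (surfaceMeasure Ω)

/-- `L^∞(Γ)`, complex-valued. -/
abbrev LInfBdry (Ω : Set (E d)) : Type := Lp ℂ ∞ (surfaceMeasure Ω)

/-- `φ ∈ C_c^∞(Ω)`. Real-valued test functions suffice also for complex distributions. -/
structure IsTestFunction (Ω : Set (E d)) (φ : E d → ℝ) : Prop where
  contDiff : ContDiff ℝ ∞ φ
  hasCompactSupport : HasCompactSupport φ
  tsupport_subset : tsupport φ ⊆ Ω

/-- The classical partial derivative `∂ᵢφ(x)`. -/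
def partialDeriv (i : Fin d) (φ : E d → ℝ) (x : E d) : ℝ :=
  fderiv ℝ φ x (EuclideanSpace.single i 1)

/-- `g` is the weak partial derivative `∂ᵢu` in `Ω`. -/
def IsWeakPartialDeriv (Ω : Set (E d)) (i : Fin d) (u g : L2 Ω) : Prop :=
  ∀ φ : E d → ℝ, IsTestFunction Ω φ →
    ∫ x in Ω, partialDeriv i φ x • u x = - ∫ x in Ω, φ x • g x

theorem integrable_smul_L2 {Ω : Set (E d)} {η : E d → ℝ} (hη : Continuous η)
    (hc : HasCompactSupport η) (u : L2 Ω) :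
    Integrable (fun x => η x • u x) (volume.restrict Ω) := by
  have h1 : MemLp η 2 (volume.restrict Ω) := (hη.memLp_of_hasCompactSupport hc).restrict Ω
  exact memLp_one_iff_integrable.mp ((Lp.memLp u).smul h1)

theorem IsTestFunction.integrable_smul {Ω : Set (E d)} {φ : E d → ℝ} (hφ : IsTestFunction Ω φ)
    (u : L2 Ω) : Integrable (fun x => φ x • u x) (volume.restrict Ω) :=
  integrable_smul_L2 hφ.contDiff.continuous hφ.hasCompactSupport u

theorem IsTestFunction.integrable_partialDeriv_smul {Ω : Set (E d)} {φ : E d → ℝ}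
    (hφ : IsTestFunction Ω φ) (i : Fin d) (u : L2 Ω) :
    Integrable (fun x => partialDeriv i φ x • u x) (volume.restrict Ω) := by
  refine integrable_smul_L2 ?_ ?_ u
  · exact (hφ.contDiff.continuous_fderiv (by simp)).clm_apply continuous_const
  · exact hφ.hasCompactSupport.fderiv_apply (𝕜 := ℝ) _

theorem isWeakPartialDeriv_zero (Ω : Set (E d)) (i : Fin d) :
    IsWeakPartialDeriv Ω i 0 0 := by
  intro φ _
  have h : ∀ η : E d → ℝ, ∫ x in Ω, η x • (0 : L2 Ω) x = 0 := fun η =>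
    integral_eq_zero_of_ae <| by
      filter_upwards [Lp.coeFn_zero ℂ 2 (volume.restrict Ω)] with x hx
      rw [hx]; simp
  rw [h, h, neg_zero]

theorem IsWeakPartialDeriv.add {Ω : Set (E d)} {i : Fin d} {u g v k : L2 Ω}
    (hu : IsWeakPartialDeriv Ω i u g) (hv : IsWeakPartialDeriv Ω i v k) :
    IsWeakPartialDeriv Ω i (u + v) (g + k) := by
  intro φ hφ
  have h : ∀ (η : E d → ℝ) (a b : L2 Ω), Integrable (fun x => η x • a x) (volume.restrict Ω) →
      Integrable (fun x => η x • b x) (volume.restrict Ω) →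
      ∫ x in Ω, η x • (a + b : L2 Ω) x = (∫ x in Ω, η x • a x) + ∫ x in Ω, η x • b x := by
    intro η a b ha hb
    rw [← integral_add ha hb]
    refine integral_congr_ae ?_
    filter_upwards [Lp.coeFn_add a b] with x hx
    rw [hx, Pi.add_apply, smul_add]
  rw [h _ _ _ (hφ.integrable_partialDeriv_smul i u) (hφ.integrable_partialDeriv_smul i v),
    h _ _ _ (hφ.integrable_smul g) (hφ.integrable_smul k), hu φ hφ, hv φ hφ, neg_add]

theorem IsWeakPartialDeriv.smul {Ω : Set (E d)} {i : Fin d} {u g : L2 Ω} (c : ℂ)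
    (hu : IsWeakPartialDeriv Ω i u g) : IsWeakPartialDeriv Ω i (c • u) (c • g) := by
  intro φ hφ
  have h : ∀ (η : E d → ℝ) (a : L2 Ω),
      ∫ x in Ω, η x • (c • a : L2 Ω) x = c * ∫ x in Ω, η x • a x := by
    intro η a
    rw [← integral_const_mul]
    refine integral_congr_ae ?_
    filter_upwards [Lp.coeFn_smul c a] with x hx
    simp [hx, mul_left_comm]
  rw [h, h, hu φ hφ, mul_neg]

/-- The complex Sobolev space `H¹(Ω)`, realized as the space of pairs `(u, ∇u)` with
`u ∈ L²(Ω)` whose weak gradient `∇u` lies in `L²(Ω)^d`. The inherited (Hilbert) norm is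
`‖u‖² = ‖u‖²_{L²} + ∑ᵢ ‖∂ᵢu‖²_{L²}`. -/
def H1 (Ω : Set (E d)) :
    Submodule ℂ (WithLp 2 (L2 Ω × PiLp 2 (fun _ : Fin d => L2 Ω))) where
  carrier := {p | ∀ i, IsWeakPartialDeriv Ω i p.fst (p.snd i)}
  zero_mem' := fun i => isWeakPartialDeriv_zero Ω i
  add_mem' := fun hp hq i => (hp i).add (hq i)
  smul_mem' := fun c _ hp i => (hp i).smul c

/-- The `L²` function underlying an element of `H¹(Ω)`. -/
def toL2 {Ω : Set (E d)} (u : H1 Ω) : L2 Ω := u.1.fst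

/-- The weak partial derivative `∂ᵢu` of `u ∈ H¹(Ω)`. -/
def grad {Ω : Set (E d)} (u : H1 Ω) (i : Fin d) : L2 Ω := u.1.snd i

/-- `w` is a continuous representative on `Ω̄` of `u ∈ H¹(Ω)`. Thus `u ∈ C(Ω̄) ∩ H¹(Ω)` iff such
a `w` exists, and then `w` is unique on `Ω̄`. -/
def IsContRep {Ω : Set (E d)} (u : H1 Ω) (w : E d → ℂ) : Prop :=
  ContinuousOn w (closure Ω) ∧ toL2 u =ᵐ[volume.restrict Ω] w

/-- `φ ∈ Tr(u)`: there are `uₙ ∈ C(Ω̄) ∩ H¹(Ω)` with `uₙ → u` in `H¹(Ω)` and `uₙ|_Γ → φ`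
in `L²(Γ)`. -/
def IsTrace {Ω : Set (E d)} (u : H1 Ω) (φ : L2Bdry Ω) : Prop :=
  ∃ (v : ℕ → H1 Ω) (w : ℕ → E d → ℂ),
    (∀ n, IsContRep (v n) (w n)) ∧ Tendsto v atTop (𝓝 u) ∧
      Tendsto (fun n => eLpNorm (fun x => w n x - φ x) 2 (surfaceMeasure Ω)) atTop (𝓝 0)

/-- `Δu = f` in the sense of distributions in `Ω`, with `f ∈ L²(Ω)`. -/
def IsLaplacian {Ω : Set (E d)} (u : H1 Ω) (f : L2 Ω) : Prop :=
  ∀ φ : E d → ℝ, IsTestFunction Ω φ →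
    ∫ x in Ω, Laplacian.laplacian φ x • toL2 u x = ∫ x in Ω, φ x • f x

/-- `Δu ∈ L²(Ω)` and `∂_ν u = h` in the sense of Green's formula. -/
def IsNormalDeriv {Ω : Set (E d)} (u : H1 Ω) (h : L2Bdry Ω) : Prop :=
  ∃ f : L2 Ω, IsLaplacian u f ∧
    ∀ (v : H1 Ω) (w : E d → ℂ), IsContRep v w →
      (∫ x in Ω, f x * star (toL2 v x)) + (∫ x in Ω, ∑ i, grad u i x * star (grad v i x)) =
        ∫ x, h x * star (w x) ∂(surfaceMeasure Ω)

/-- The graph of the Laplacian in `H¹(Ω)` with Wentzell boundary conditions: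
`u ∈ H¹(Ω)`, `Δu = f ∈ H¹(Ω)` and `∂_ν u + β u_Γ + (Δu)_Γ = 0` in `L²(Γ)`. -/
def IsWentzellLaplacian {Ω : Set (E d)} (β : LInfBdry Ω) (u f : H1 Ω) : Prop :=
  IsLaplacian u (toL2 f) ∧
    ∃ h uΓ fΓ : L2Bdry Ω, IsNormalDeriv u h ∧ IsTrace u uΓ ∧ IsTrace f fΓ ∧
      ∀ᵐ x ∂(surfaceMeasure Ω), h x + β x * uΓ x + fΓ x = 0

section Semigroup

variable {X : Type*} [NormedAddCommGroup X] [NormedSpace ℂ X]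

/-- `(T(t))_{t ≥ 0}` is a `C₀`-semigroup on `X` (the values at `t < 0` are irrelevant). -/
structure IsC0Semigroup (T : ℝ → X →L[ℂ] X) : Prop where
  zero : T 0 = ContinuousLinearMap.id ℂ X
  add : ∀ s t : ℝ, 0 ≤ s → 0 ≤ t → T (s + t) = (T s).comp (T t)
  continuousOn : ∀ x : X, ContinuousOn (fun t => T t x) (Ici 0)

/-- The open sector `{z ≠ 0 : |arg z| < θ}`. -/
def sector (θ : ℝ) : Set ℂ := {z | z ≠ 0 ∧ |z.arg| < θ}

/-- A `C₀`-semigroup is holomorphic if, for some `θ ∈ (0, π/2]`, it extends to a holomorphic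
function on the open sector of half-angle `θ` that is bounded near `0` on all smaller sectors. -/
structure IsHolomorphicC0Semigroup (T : ℝ → X →L[ℂ] X) : Prop extends IsC0Semigroup T where
  holomorphic : ∃ θ : ℝ, 0 < θ ∧ θ ≤ Real.pi / 2 ∧ ∃ F : ℂ → X →L[ℂ] X,
    DifferentiableOn ℂ F (sector θ) ∧ (∀ t : ℝ, 0 < t → F t = T t) ∧
      ∀ θ' : ℝ, 0 < θ' → θ' < θ → ∃ M : ℝ, ∀ z ∈ sector θ', ‖z‖ ≤ 1 → ‖F z‖ ≤ M

/-- The operator with graph `A` is the generator of `T`: `x ∈ D(A)` and `Ax = y` iff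
`(T(t)x - x)/t → y` as `t ↓ 0`. -/
def IsGeneratorOf (A : X → X → Prop) (T : ℝ → X →L[ℂ] X) : Prop :=
  ∀ x y : X, A x y ↔ Tendsto (fun t : ℝ => ((t⁻¹ : ℝ) : ℂ) • (T t x - x)) (𝓝[>] 0) (𝓝 y)

end Semigroup

end Wentzell

end

/-! Write V = H¹(Ω), H = L²(Ω) × L²(Γ) and j u = (u, u_Γ). By Green's formula, u lies in the domain
with Δu = f exactly when a(u, v) = -⟨j f, j v⟩_H for all v in V, where a(u, v) = ∫ ∇u·∇v̄ + ∫_Γ β u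
v̄. Up to a bounded operator on H, the form a is the inner product of V: with S(f, φ) = (-f, βφ) one
has a(u, v) = ⟨u, v⟩_V + ⟨S j u, j v⟩_H. This is the abstract relation `formRel`, and generation
needs only that j is bounded and injective.

The point is that the numerical range can be computed in V itself. Testing with v = f expresses ⟨u,
f⟩_V as -‖j f‖² plus an error of size at most ‖S‖ ‖j u‖ ‖j f‖, which Young's inequality absorbs:
after a shift, the numerical range lies in a sector around the negative half-line. Coercivity gives
the range condition. Hence the operator is quasi-m-sectorial on V (`isMSectorial_formRel`) and
generates a holomorphic semigroup (`IsMSectorial.exists_semigroup`), obtained as the limit of the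
exponentials of Yosida approximations, all of which are contractions on one complex sector.

The concrete half of the proof supplies j. Density of C(Ω̄) ∩ H¹(Ω) (`exists_contRep_approx`) and
the inequality ‖w‖_{L²(Γ)} ≤ C ‖u‖_{H¹} on that subspace (`exists_trace_le`) yield existence,
uniqueness and boundedness of the trace. Both facts are local. In a Lipschitz chart, a shift in the
inward direction e before mollification produces functions that are smooth on the whole space but
see u only inside Ω. For these the trace bound follows by integrating |W|² along rays in direction e
and by comparing the surface measure with the Lipschitz image of a hyperplane.
`isWentzellLaplacian_iff_formRel` joins the two halves. -/

open scoped NNReal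

noncomputable section

namespace Wentzell

/-! ### Exponentials of bounded operators with numerical range in a sector. -/

section Exponential

variable {V : Type*} [NormedAddCommGroup V] [InnerProductSpace ℂ V]

/-- The closed sector `{|Im z| ≤ k Re z}` around the positive half-line. -/
def closedSector (k : ℝ) : Set ℂ := {z | |z.im| ≤ k * z.re}

/-- The exponential of a bounded operator. -/
abbrev opExp (C : V →L[ℂ] V) : V →L[ℂ] V := NormedSpace.exp C

theorem hasDerivAt_opExp_smul [CompleteSpace V] (C : V →L[ℂ] V) (s : ℝ) :
    HasDerivAt (fun s : ℝ => opExp (s • C)) (opExp (s • C) * C) s := by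
  have := hasDerivAt_exp_smul_const (𝕂 := ℝ) C s
  simpa [opExp] using this

theorem hasDerivAt_opExp_smul_apply [CompleteSpace V] (C : V →L[ℂ] V) (x : V) (s : ℝ) :
    HasDerivAt (fun s : ℝ => opExp (s • C) x) (opExp (s • C) (C x)) s := by
  have h := hasDerivAt_opExp_smul C s
  exact ((ContinuousLinearMap.apply ℂ V x).restrictScalars ℝ).hasFDerivAt.comp_hasDerivAt s h

theorem commute_opExp [CompleteSpace V] (C : V →L[ℂ] V) (s : ℝ) (x : V) :
    opExp (s • C) (C x) = C (opExp (s • C) x) := by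
  have h : Commute (opExp (s • C)) C := ((Commute.refl C).smul_left s).exp_left
  exact congrArg (fun L : V →L[ℂ] V => L x) h.eq

/-- Along s ↦ exp(sC)x the squared norm has derivative 2 Re⟨y, C y⟩ ≤ 0 with y = exp(sC)x. -/
theorem norm_opExp_apply_le [CompleteSpace V] {C : V →L[ℂ] V}
    (hC : ∀ x, (inner ℂ x (C x)).re ≤ 0) (x : V) :
    ‖opExp C x‖ ≤ ‖x‖ := by
  have hd : ∀ s : ℝ, HasDerivAt (fun s : ℝ => ‖opExp (s • C) x‖ ^ 2)
      (2 * (inner ℂ (opExp (s • C) x) (opExp (s • C) (C x))).re) s := by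
    intro s
    let _ : InnerProductSpace ℝ V := InnerProductSpace.rclikeToReal ℂ V
    have := (hasDerivAt_opExp_smul_apply C x s).norm_sq
    simpa [real_inner_eq_re_inner ℂ] using this
  have hanti : Antitone (fun s : ℝ => ‖opExp (s • C) x‖ ^ 2) := by
    refine antitone_of_deriv_nonpos (fun s => (hd s).differentiableAt) fun s => ?_
    rw [(hd s).deriv, commute_opExp]
    linarith [hC (opExp (s • C) x)]
  have h := hanti (zero_le_one : (0 : ℝ) ≤ 1)
  simp only [one_smul, zero_smul, opExp, NormedSpace.exp_zero, one_apply_eq_self] at h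
  exact abs_le_of_sq_le_sq' h (norm_nonneg _) |>.2

/-- The two sectors are dual: rotating a number of {k |Im| ≤ -Re} by the argument of an element of
{|Im| ≤ k Re} does not leave the left half-plane. -/
theorem re_inner_smul_nonpos {k : ℝ} {C : V →L[ℂ] V}
    (hC : ∀ x, k * |(inner ℂ x (C x)).im| ≤ -(inner ℂ x (C x)).re) {z : ℂ}
    (hz : z ∈ closedSector k) (hz' : 0 ≤ z.re) (x : V) :
    (inner ℂ x ((z • C) x)).re ≤ 0 := by
  have hz : |z.im| ≤ k * z.re := hz
  rw [smul_apply, inner_smul_right, Complex.mul_re]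
  have h1 := mul_le_mul_of_nonneg_left (hC x) hz'
  have h2 := mul_le_mul_of_nonneg_right hz (abs_nonneg (inner ℂ x (C x)).im)
  have h3 := neg_abs_le (z.im * (inner ℂ x (C x)).im)
  rw [abs_mul] at h3
  nlinarith

theorem closedSector_re_nonneg {k : ℝ} (hk : 0 < k) {z : ℂ} (hz : z ∈ closedSector k) :
    0 ≤ z.re := by
  have hz : |z.im| ≤ k * z.re := hz
  have := (abs_nonneg z.im).trans hz
  exact nonneg_of_mul_nonneg_right this hk

theorem closedSector_smul {k : ℝ} {z : ℂ} (hz : z ∈ closedSector k) {s : ℝ} (hs : 0 ≤ s) :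
    s • z ∈ closedSector k := by
  have hz : |z.im| ≤ k * z.re := hz
  change |(s • z).im| ≤ k * (s • z).re
  rw [Complex.real_smul, Complex.re_ofReal_mul, Complex.im_ofReal_mul, abs_mul, abs_of_nonneg hs]
  nlinarith

theorem closedSector_add {k : ℝ} {z w : ℂ} (hz : z ∈ closedSector k) (hw : w ∈ closedSector k) :
    z + w ∈ closedSector k := by
  have hz : |z.im| ≤ k * z.re := hz
  have hw : |w.im| ≤ k * w.re := hw
  change |(z + w).im| ≤ k * (z + w).re
  rw [Complex.add_re, Complex.add_im]
  have := abs_add_le z.im w.im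
  linarith

theorem ofReal_mem_closedSector {k : ℝ} (hk : 0 < k) {t : ℝ} (ht : 0 ≤ t) :
    (t : ℂ) ∈ closedSector k := by
  simp only [closedSector, mem_ofPred_eq, Complex.ofReal_im, abs_zero, Complex.ofReal_re]
  positivity

/-- Interpolate by s ↦ exp(szB) exp((1 - s)zC)x. Since B and C commute, the derivative is the same
product applied to z(Bx - Cx), and both factors are contractions. -/
theorem norm_opExp_sub_opExp_le [CompleteSpace V] {k : ℝ} (hk : 0 < k) {B C : V →L[ℂ] V}
    (hBC : Commute B C)
    (hB : ∀ x, k * |(inner ℂ x (B x)).im| ≤ -(inner ℂ x (B x)).re)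
    (hC : ∀ x, k * |(inner ℂ x (C x)).im| ≤ -(inner ℂ x (C x)).re) {z : ℂ}
    (hz : z ∈ closedSector k) (x : V) :
    ‖opExp (z • B) x - opExp (z • C) x‖ ≤ ‖z‖ * ‖B x - C x‖ := by
  have hre := closedSector_re_nonneg hk hz
  have hd : ∀ s : ℝ, HasDerivAt
      (fun s : ℝ => (opExp (s • (z • B)) * opExp ((1 - s) • (z • C))) x)
      ((opExp (s • (z • B)) * opExp ((1 - s) • (z • C))) (z • (B x - C x))) s := by
    intro s
    have h1 := hasDerivAt_opExp_smul (z • B) s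
    have h2 := (hasDerivAt_opExp_smul (z • C) (1 - s)).scomp s
      ((hasDerivAt_id s).const_sub 1)
    have h3 := h1.mul h2
    have h4 :=
      ((ContinuousLinearMap.apply ℂ V x).restrictScalars ℝ).hasFDerivAt.comp_hasDerivAt s h3
    refine h4.congr_deriv ?_
    have hc : Commute (z • B) (opExp ((1 - s) • (z • C))) :=
      (((hBC.smul_left z).smul_right z).smul_right (1 - s)).exp_right
    have hc2 : (z • B) * opExp ((1 - s) • (z • C)) = opExp ((1 - s) • (z • C)) * (z • B) := hc.eq
    simp only [neg_smul, one_smul, Function.comp]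
    rw [mul_assoc, hc2]
    change (opExp (s • z • B) * (opExp ((1 - s) • z • C) * (z • B)) +
      opExp (s • z • B) * -(opExp ((1 - s) • z • C) * (z • C))) x = _
    simp [sub_eq_add_neg]
  have hmv := norm_image_sub_le_of_norm_deriv_le_segment_01' (C := ‖z‖ * ‖B x - C x‖)
    (fun s _ => (hd s).hasDerivWithinAt) (fun s hs => ?_)
  · simpa [opExp, NormedSpace.exp_zero] using hmv
  · have a : ∀ (L : V →L[ℂ] V), (∀ x, k * |(inner ℂ x (L x)).im| ≤ -(inner ℂ x (L x)).re) →
        ∀ s : ℝ, 0 ≤ s → ∀ y, ‖opExp (s • (z • L)) y‖ ≤ ‖y‖ := by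
      intro L hL s hs y
      refine norm_opExp_apply_le (fun x => ?_) y
      rw [← smul_assoc]
      refine re_inner_smul_nonpos hL (closedSector_smul hz hs) ?_ x
      simp only [Complex.real_smul, Complex.re_ofReal_mul]
      positivity
    calc _ ≤ ‖z • (B x - C x)‖ := by
          refine (a B hB s hs.1 _).trans (a C hC (1 - s) (by linarith [hs.2]) _)
      _ = _ := norm_smul _ _

end Exponential

/-! ### From strong holomorphy to holomorphy in operator norm. -/

section StrongHolomorphy

variable {V : Type*} [NormedAddCommGroup V] [NormedSpace ℂ V] [CompleteSpace V]

/-- A strongly holomorphic, bounded operator-valued function is holomorphic in operator norm. -/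
theorem differentiableOn_of_forall_apply {F : ℂ → V →L[ℂ] V} {U : Set ℂ} (hU : IsOpen U)
    (hF : ∀ x, DifferentiableOn ℂ (fun z => F z x) U) {M : ℝ} (hM : ∀ z ∈ U, ‖F z‖ ≤ M) :
    DifferentiableOn ℂ F U := by
  intro z₀ hz₀
  refine DifferentiableAt.differentiableWithinAt ?_
  obtain ⟨R, hR, hRU⟩ := Metric.nhds_basis_closedBall.mem_iff.mp (hU.mem_nhds hz₀)
  -- Half the radius: discs of radius r centred in the disc of radius r stay in U, so Cauchy's
  -- estimate bounds the derivatives uniformly and F is Lipschitz in norm.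
  set r : ℝ := R / 2 with hr
  have hr0 : 0 < r := by positivity
  have hsub : ∀ w ∈ Metric.closedBall z₀ r, Metric.closedBall w r ⊆ U := by
    intro w hw y hy
    refine hRU ?_
    rw [Metric.mem_closedBall] at *
    linarith [dist_triangle y w z₀]
  have hsub' : Metric.closedBall z₀ r ⊆ U := hsub z₀ (Metric.mem_closedBall_self hr0.le)
  have hM0 : 0 ≤ M := (norm_nonneg _).trans (hM z₀ hz₀)
  have hderiv : ∀ x, ∀ w ∈ Metric.closedBall z₀ r, ‖deriv (fun z => F z x) w‖ ≤ M * ‖x‖ / r := by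
    intro x w hw
    refine Complex.norm_deriv_le_of_forall_mem_sphere_norm_le hr0 ?_ ?_
    · exact ((hF x).mono (hsub w hw)).diffContOnCl_ball (subset_refl _)
    · intro z hz
      have := hM z (hsub w hw (Metric.sphere_subset_closedBall hz))
      exact ((F z).le_opNorm x).trans (by gcongr)
  have hlip : ∀ a ∈ Metric.closedBall z₀ r, ∀ b ∈ Metric.closedBall z₀ r,
      ‖F b - F a‖ ≤ M / r * ‖b - a‖ := by
    intro a ha b hb
    refine ContinuousLinearMap.opNorm_le_bound _ (by positivity) fun x => ?_
    have := Convex.norm_image_sub_le_of_norm_deriv_le (f := fun z => F z x)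
      (fun w hw => (hF x).differentiableAt (hU.mem_nhds (hsub' hw))) (hderiv x)
      (convex_closedBall z₀ r) ha hb
    calc ‖(F b - F a) x‖ = ‖F b x - F a x‖ := rfl
      _ ≤ _ := this
      _ = _ := by ring
  have hcont : ContinuousOn F (Metric.closedBall z₀ r) := by
    have : LipschitzOnWith ⟨M / r, by positivity⟩ F (Metric.closedBall z₀ r) :=
      LipschitzOnWith.of_dist_le_mul fun a ha b hb => by
        rw [dist_eq_norm, dist_eq_norm]; exact hlip b hb a ha
    exact this.continuousOn
  have hci : CircleIntegrable F z₀ r :=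
    (hcont.mono Metric.sphere_subset_closedBall).circleIntegrable hr0.le
  -- Norm continuity makes the operator-valued Cauchy integral available, and it is analytic.
  -- Evaluation at each vector identifies it with F.
  have hps := hasFPowerSeriesOn_cauchy_integral (R := ⟨r, hr0.le⟩) hci hr0
  have hdiff := hps.analyticAt.differentiableAt
  refine hdiff.congr_of_eventuallyEq ?_
  filter_upwards [Metric.ball_mem_nhds z₀ hr0] with w hw
  ext x
  have h1 := ((hF x).mono hsub').circleIntegral_sub_inv_smul hw
  have hci' : IntervalIntegrable
      (fun θ : ℝ => deriv (circleMap z₀ r) θ • ((circleMap z₀ r θ - w)⁻¹ • F (circleMap z₀ r θ)))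
      volume 0 (2 * Real.pi) := by
    have : CircleIntegrable (fun z => (z - w)⁻¹ • F z) z₀ r := by
      refine ContinuousOn.circleIntegrable hr0.le ?_
      have hinv : ContinuousOn (fun z : ℂ => (z - w)⁻¹) (Metric.sphere z₀ r) := by
        refine ContinuousOn.inv₀ (by fun_prop) fun z hz => sub_ne_zero.mpr ?_
        rintro rfl
        rw [Metric.mem_ball] at hw
        rw [Metric.mem_sphere] at hz
        linarith
      exact hinv.smul (hcont.mono Metric.sphere_subset_closedBall)
    exact this.out
  have h2 : ((2 * Real.pi * Complex.I : ℂ)⁻¹ • ∮ z in C(z₀, r), (z - w)⁻¹ • F z) x =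
      (2 * Real.pi * Complex.I : ℂ)⁻¹ • ∮ z in C(z₀, r), (z - w)⁻¹ • F z x := by
    rw [smul_apply]
    congr 1
    rw [circleIntegral, ContinuousLinearMap.intervalIntegral_apply hci']
    rfl
  change F w x = ((2 * Real.pi * Complex.I : ℂ)⁻¹ • ∮ z in C(z₀, r), (z - w)⁻¹ • F z) x
  rw [h2, h1, smul_smul, inv_mul_cancel₀ Complex.two_pi_I_ne_zero, one_smul]

end StrongHolomorphy

/-! ### Strong limits of exponentials on the closed sector. -/

section Limit

variable {V : Type*} [NormedAddCommGroup V] [InnerProductSpace ℂ V] [CompleteSpace V]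
  {Y : ℕ → V →L[ℂ] V} {k : ℝ} {D : Set V}

theorem norm_opExp_smul_apply_le (hk : 0 < k) {C : V →L[ℂ] V}
    (hC : ∀ x, k * |(inner ℂ x (C x)).im| ≤ -(inner ℂ x (C x)).re) {z : ℂ}
    (hz : z ∈ closedSector k) (x : V) : ‖opExp (z • C) x‖ ≤ ‖x‖ :=
  norm_opExp_apply_le (re_inner_smul_nonpos hC hz (closedSector_re_nonneg hk hz)) x

/-- On D the difference of two exponentials is at most ‖z‖ ‖Yₘy - Yₙy‖. Contractivity carries the
uniform Cauchy property from D to its closure. -/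
theorem uniformCauchySeqOn_opExp (hk : 0 < k) (hcomm : ∀ m n, Commute (Y m) (Y n))
    (hsec : ∀ n x, k * |(inner ℂ x (Y n x)).im| ≤ -(inner ℂ x (Y n x)).re)
    (hD : Dense D) (hYD : ∀ x ∈ D, CauchySeq fun n => Y n x) (x : V) (R : ℝ) :
    UniformCauchySeqOn (fun n z => opExp (z • Y n) x) atTop
      (closedSector k ∩ Metric.closedBall 0 R) := by
  rw [Metric.uniformCauchySeqOn_iff]
  intro ε hε
  obtain ⟨y, hy, hxy⟩ := Metric.dense_iff.mp hD x (ε / 4) (by positivity)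
  rw [Metric.mem_ball, dist_eq_norm] at hy
  obtain ⟨N, hN⟩ := Metric.cauchySeq_iff.mp (hYD y hxy) (ε / (4 * (|R| + 1))) (by positivity)
  refine ⟨N, fun m hm n hn z hz => ?_⟩
  have hzR : ‖z‖ ≤ |R| + 1 := by
    have := mem_closedBall_zero_iff.mp hz.2
    linarith [le_abs_self R]
  have h1 := norm_opExp_sub_opExp_le hk (hcomm m n) (hsec m) (hsec n) hz.1 y
  have h2 : ‖z‖ * ‖Y m y - Y n y‖ ≤ ε / 4 := by
    have := (hN m hm n hn).le
    rw [dist_eq_norm] at this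
    calc ‖z‖ * ‖Y m y - Y n y‖ ≤ (|R| + 1) * (ε / (4 * (|R| + 1))) := by gcongr
      _ = ε / 4 := by field_simp
  have h3 := norm_opExp_smul_apply_le hk (hsec m) hz.1 (x - y)
  have h4 := norm_opExp_smul_apply_le hk (hsec n) hz.1 (y - x)
  rw [norm_sub_rev y x] at h4
  rw [norm_sub_rev] at hy
  rw [dist_eq_norm]
  have : opExp (z • Y m) x - opExp (z • Y n) x = opExp (z • Y m) (x - y)
      + (opExp (z • Y m) y - opExp (z • Y n) y) + opExp (z • Y n) (y - x) := by
    simp only [map_sub]; abel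
  rw [this]
  calc _ ≤ _ := norm_add₃_le
    _ < ε := by linarith

/-- The strong limit on the closed sector of the exponentials of commuting sectorial operators. -/
theorem exists_limit_opExp (hk : 0 < k) (hcomm : ∀ m n, Commute (Y m) (Y n))
    (hsec : ∀ n x, k * |(inner ℂ x (Y n x)).im| ≤ -(inner ℂ x (Y n x)).re)
    (hD : Dense D) (hYD : ∀ x ∈ D, CauchySeq fun n => Y n x) :
    ∃ F : ℂ → V →L[ℂ] V, (∀ z ∈ closedSector k, ∀ x, ‖F z x‖ ≤ ‖x‖) ∧
      ∀ x R, TendstoUniformlyOn (fun n z => opExp (z • Y n) x) (fun z => F z x) atTop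
        (closedSector k ∩ Metric.closedBall 0 R) := by
  have hex : ∀ z : ℂ, ∃ L : V →L[ℂ] V, z ∈ closedSector k →
      (∀ x, ‖L x‖ ≤ ‖x‖) ∧ ∀ x, Tendsto (fun n => opExp (z • Y n) x) atTop (𝓝 (L x)) := by
    intro z
    by_cases hz : z ∈ closedSector k
    swap
    · exact ⟨0, fun h => absurd h hz⟩
    have h1 : ∀ x, ∃ y, Tendsto (fun n => opExp (z • Y n) x) atTop (𝓝 y) := fun x =>
      cauchySeq_tendsto_of_complete
        ((uniformCauchySeqOn_opExp hk hcomm hsec hD hYD x ‖z‖).cauchySeq (x := z)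
          ⟨hz, by simp⟩)
    choose f hf using h1
    have hb : ∀ x, ‖f x‖ ≤ ‖x‖ := fun x =>
      le_of_tendsto (hf x).norm (Eventually.of_forall fun n =>
        norm_opExp_smul_apply_le hk (hsec n) hz x)
    let l : V →ₗ[ℂ] V := linearMapOfTendsto f (fun n => (opExp (z • Y n)).toLinearMap)
      (tendsto_pi_nhds.mpr hf)
    exact ⟨l.mkContinuous 1 fun x => by rw [one_mul]; exact hb x, fun _ => ⟨hb, hf⟩⟩
  choose F hF using hex
  refine ⟨F, fun z hz => (hF z hz).1, fun x R => ?_⟩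
  exact (uniformCauchySeqOn_opExp hk hcomm hsec hD hYD x R).tendstoUniformlyOn_of_tendsto
    fun z hz => (hF z hz.1).2 x

end Limit

/-! ### Quasi-m-sectorial relations and their resolvents. -/

section Generation

variable {V : Type*} [NormedAddCommGroup V] [InnerProductSpace ℂ V]

/-- The linear relation `A` is quasi-m-sectorial: its numerical range, shifted by `a`, lies in the
sector `{k |Im z| ≤ -Re z}` and `lam - A` is surjective for every `lam > a`. -/
structure IsMSectorial (A : V → V → Prop) (k a : ℝ) : Prop where
  add : ∀ {x y x' y'}, A x y → A x' y' → A (x + x') (y + y')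
  smul : ∀ (c : ℂ) {x y}, A x y → A (c • x) (c • y)
  -- With additivity this makes the relation single-valued; it is also what forces the domain to be
  -- dense.
  eq_zero : ∀ {y}, A 0 y → y = 0
  sector : ∀ {x y}, A x y → k * |(inner ℂ x y).im| ≤ -(inner ℂ x y).re + a * ‖x‖ ^ 2
  range : ∀ {lam : ℝ}, a < lam → ∀ g, ∃ x y, A x y ∧ (lam : ℂ) • x - y = g

namespace IsMSectorial

variable {A : V → V → Prop} {k a : ℝ}

theorem sub (hA : IsMSectorial A k a) {x y x' y' : V} (h : A x y) (h' : A x' y') :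
    A (x - x') (y - y') := by
  have := hA.add h (hA.smul (-1) h')
  simpa [sub_eq_add_neg] using this

/-- Passing to A - a reduces generation to the dissipative case. -/
theorem shift (hA : IsMSectorial A k a) :
    IsMSectorial (fun x y => A x (y + (a : ℂ) • x)) k 0 where
  add h h' := by
    convert hA.add h h' using 1
    rw [smul_add]; abel
  smul c x y h := by
    convert hA.smul c h using 1
    rw [smul_add, smul_comm]
  eq_zero h := hA.eq_zero (by simpa using h)
  sector {x y} h := by
    have := hA.sector h
    rw [inner_add_right, inner_smul_right, inner_self_eq_norm_sq_to_K] at this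
    have e : ((a : ℂ) * ((‖x‖ : ℝ) : ℂ) ^ 2) = ((a * ‖x‖ ^ 2 : ℝ) : ℂ) := by push_cast; rfl
    simp only [RCLike.ofReal_eq_complex_ofReal] at this
    rw [e] at this
    simp only [Complex.add_im, Complex.add_re, Complex.ofReal_re, Complex.ofReal_im,
      add_zero] at this
    linarith
  range {lam} hl g := by
    obtain ⟨x, y, h, e⟩ := hA.range (lam := lam + a) (by linarith) g
    refine ⟨x, y - (a : ℂ) • x, by simpa using h, ?_⟩
    rw [← e]; push_cast; rw [add_smul]; abel

theorem re_nonpos (hA : IsMSectorial A k 0) (hk : 0 < k) {x y : V} (h : A x y) :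
    (inner ℂ x y).re ≤ 0 := by
  have := hA.sector h
  have h2 : 0 ≤ k * |(inner ℂ x y).im| := by positivity
  linarith

/-- Dissipativity gives lam ‖x‖² ≤ Re⟨x, lam x - y⟩, to which Cauchy–Schwarz applies. -/
theorem norm_le (hA : IsMSectorial A k 0) (hk : 0 < k) {x y : V} (h : A x y) (lam : ℝ) :
    lam * ‖x‖ ≤ ‖(lam : ℂ) • x - y‖ := by
  have h1 := hA.re_nonpos hk h
  have h2 : (inner ℂ x ((lam : ℂ) • x - y)).re = lam * ‖x‖ ^ 2 - (inner ℂ x y).re := by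
    rw [inner_sub_right, inner_smul_right, Complex.sub_re, Complex.re_ofReal_mul]
    congr 2
    exact inner_self_eq_norm_sq (𝕜 := ℂ) x
  have h3 := re_inner_le_norm (𝕜 := ℂ) x ((lam : ℂ) • x - y)
  rw [RCLike.re_eq_complex_re, h2] at h3
  rcases eq_or_lt_of_le (norm_nonneg x) with h0 | h0
  · rw [← h0]; simp
  · refine le_of_mul_le_mul_left ?_ h0
    nlinarith

/-- By `norm_le` the solution of lam x - y = g is unique, so the chosen solution map is
automatically linear and bounded by 1/lam. -/
theorem exists_resolvent (hA : IsMSectorial A k 0) (hk : 0 < k) {lam : ℝ} (hl : 0 < lam) :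
    ∃ R : V →L[ℂ] V, (∀ g, A (R g) ((lam : ℂ) • R g - g)) ∧
      (∀ x y, A x y → R ((lam : ℂ) • x - y) = x) ∧ ∀ g, lam * ‖R g‖ ≤ ‖g‖ := by
  have hr : ∀ g, ∃ x, A x ((lam : ℂ) • x - g) := by
    intro g
    obtain ⟨x, y, h, rfl⟩ := hA.range hl g
    exact ⟨x, by simpa using h⟩
  choose r hr using hr
  have hu : ∀ {x y}, A x y → r ((lam : ℂ) • x - y) = x := by
    intro x y h
    have h1 := hA.norm_le hk (hA.sub (hr ((lam : ℂ) • x - y)) h) lam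
    have h2 : (lam : ℂ) • (r ((lam : ℂ) • x - y) - x) -
        ((lam : ℂ) • r ((lam : ℂ) • x - y) - ((lam : ℂ) • x - y) - y) = 0 := by
      rw [smul_sub]; abel
    rw [h2, norm_zero] at h1
    have h3 : ‖r ((lam : ℂ) • x - y) - x‖ ≤ 0 := by
      by_contra hc
      push Not at hc
      have := mul_pos hl hc
      linarith
    exact sub_eq_zero.mp (norm_le_zero_iff.mp h3)
  have hb : ∀ g, lam * ‖r g‖ ≤ ‖g‖ := by
    intro g
    have := hA.norm_le hk (hr g) lam
    simpa using this
  let l : V →ₗ[ℂ] V :=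
    { toFun := r
      map_add' := fun g h => by
        rw [← hu (hA.add (hr g) (hr h))]
        congr 1
        rw [smul_add]; abel
      map_smul' := fun c g => by
        rw [RingHom.id_apply, ← hu (hA.smul c (hr g))]
        congr 1
        rw [smul_sub, smul_comm]; abel }
  refine ⟨l.mkContinuous lam⁻¹ fun g => ?_, hr, fun x y h => hu h, hb⟩
  rw [inv_mul_eq_div, le_div_iff₀ hl, mul_comm]
  exact hb g

/-- Let g be orthogonal to the domain and g = x - y with A x y. Then 0 = ⟨x, g⟩ yields ‖x‖² = Re⟨x,
y⟩ ≤ 0, so x = 0 and then y = 0. -/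
theorem dense_domain [CompleteSpace V] (hA : IsMSectorial A k 0) (hk : 0 < k) :
    Dense {x | ∃ y, A x y} := by
  let W : Submodule ℂ V :=
    { carrier := {x | ∃ y, A x y}
      add_mem' := fun ⟨y, h⟩ ⟨y', h'⟩ => ⟨y + y', hA.add h h'⟩
      zero_mem' := by
        obtain ⟨x, y, h, -⟩ := hA.range one_pos (0 : V)
        exact ⟨0, by simpa using hA.smul 0 h⟩
      smul_mem' := fun c x ⟨y, h⟩ => ⟨c • y, hA.smul c h⟩ }
  have hW : Wᗮ = ⊥ := by
    rw [Submodule.eq_bot_iff]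
    intro g hg
    obtain ⟨x, y, h, rfl⟩ := hA.range one_pos g
    have h0 : inner ℂ x (((1 : ℝ) : ℂ) • x - y) = 0 := (Submodule.mem_orthogonal _ _).mp hg x ⟨y, h⟩
    have h1 := hA.re_nonpos hk h
    have h2 : (inner ℂ x x).re = ‖x‖ ^ 2 := inner_self_eq_norm_sq (𝕜 := ℂ) x
    rw [Complex.ofReal_one, one_smul, inner_sub_right] at h0
    have h3 := congrArg Complex.re h0
    rw [Complex.sub_re, h2, Complex.zero_re] at h3
    have hx : x = 0 := by
      have : ‖x‖ ^ 2 = 0 := le_antisymm (by linarith) (sq_nonneg _)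
      simpa using this
    subst hx
    rw [hA.eq_zero h, smul_zero, sub_zero]
  exact (Submodule.dense_iff_topologicalClosure_eq_top).mpr
    ((Submodule.topologicalClosure_eq_top_iff).mpr hW)

end IsMSectorial
end Generation

/-! ### Yosida approximation and the generated semigroup. -/

section Generation

variable {V : Type*} [NormedAddCommGroup V] [InnerProductSpace ℂ V] {A : V → V → Prop} {k a : ℝ}

namespace IsMSectorial

/-- The Yosida approximations of an m-sectorial relation. -/
theorem exists_yosida [CompleteSpace V] (hA : IsMSectorial A k 0) (hk : 0 < k) :
    ∃ Y : ℕ → V →L[ℂ] V, (∀ m n, Commute (Y m) (Y n)) ∧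
      (∀ n x, k * |(inner ℂ x (Y n x)).im| ≤ -(inner ℂ x (Y n x)).re) ∧
      ∀ x y, A x y → Tendsto (fun n => Y n x) atTop (𝓝 y) := by
  have hpos : ∀ n : ℕ, (0 : ℝ) < n + 1 := fun n => by positivity
  choose R hRA hRu hRb using fun n : ℕ => hA.exists_resolvent hk (hpos n)
  -- The resolvent identity, from which the resolvents commute.
  have hres : ∀ m n : ℕ, ∀ g, (((n + 1 : ℝ) : ℂ) - ((m + 1 : ℝ) : ℂ)) • R m (R n g) =
      R m g - R n g := by
    intro m n g
    have h := hRu m _ _ (hA.sub (hRA m g) (hRA n g))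
    rw [← h, ← map_smul]
    congr 1
    rw [sub_smul, smul_sub]; abel
  have hRcomm : ∀ m n, Commute (R m) (R n) := by
    intro m n
    rcases eq_or_ne m n with rfl | hmn
    · exact Commute.refl _
    ext g
    have hne : ((n + 1 : ℝ) : ℂ) - ((m + 1 : ℝ) : ℂ) ≠ 0 := by
      rw [sub_ne_zero]
      intro h
      have h2 : (n + 1 : ℝ) = m + 1 := by exact_mod_cast h
      have : (n : ℝ) = m := by linarith
      exact hmn (by exact_mod_cast this.symm)
    refine smul_right_injective V hne ?_
    change (((n + 1 : ℝ) : ℂ) - ((m + 1 : ℝ) : ℂ)) • R m (R n g) =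
      (((n + 1 : ℝ) : ℂ) - ((m + 1 : ℝ) : ℂ)) • R n (R m g)
    rw [hres, ← neg_sub (R n g), ← hres n m g, ← neg_smul, neg_sub]
  -- With λ = n + 1 this is λA(λ - A)⁻¹.
  let Y : ℕ → V →L[ℂ] V := fun n =>
    ((n + 1 : ℝ) : ℂ) • (((n + 1 : ℝ) : ℂ) • R n - 1)
  -- On the domain λRx - x = R(Ax) has norm at most ‖Ax‖/λ. The operators λR are contractions, so
  -- the convergence extends by density.
  have hapx : ∀ y, Tendsto (fun n : ℕ => ((n + 1 : ℝ) : ℂ) • R n y) atTop (𝓝 y) := by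
    intro y
    rw [Metric.tendsto_atTop]
    intro ε hε
    obtain ⟨x, hxy, w, hxw⟩ := Metric.dense_iff.mp (hA.dense_domain hk) y (ε / 3) (by positivity)
    rw [Metric.mem_ball, dist_eq_norm] at hxy
    obtain ⟨N, hN⟩ := exists_nat_gt (‖w‖ / (ε / 3))
    refine ⟨N, fun n hn => ?_⟩
    have h1 : ((n + 1 : ℝ) : ℂ) • R n x - x = R n w := by
      have := hRu n x w hxw
      rw [map_sub, map_smul] at this
      rw [← sub_eq_zero, ← sub_eq_zero.mpr this]; abel
    have hc : ∀ g, ‖((n + 1 : ℝ) : ℂ) • R n g‖ ≤ ‖g‖ := by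
      intro g
      rw [norm_smul, Complex.norm_real, Real.norm_of_nonneg (hpos n).le]
      exact hRb n g
    have h2 : ‖R n w‖ < ε / 3 := by
      have h3 := hRb n w
      have h4 : ‖w‖ < (n + 1) * (ε / 3) := by
        rw [div_lt_iff₀ (by positivity)] at hN
        have : (N : ℝ) ≤ n := by exact_mod_cast hn
        nlinarith
      exact lt_of_mul_lt_mul_left (h3.trans_lt h4) (hpos n).le
    rw [dist_eq_norm]
    have : ((n + 1 : ℝ) : ℂ) • R n y - y = ((n + 1 : ℝ) : ℂ) • R n (y - x)
        + (((n + 1 : ℝ) : ℂ) • R n x - x) + (x - y) := by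
      rw [map_sub, smul_sub]; abel
    rw [this, h1]
    have h5 := hc (y - x)
    rw [norm_sub_rev] at h5
    calc _ ≤ _ := norm_add₃_le
      _ < ε := by linarith
  refine ⟨Y, fun m n => ?_, fun n g => ?_, fun x y hxy => ?_⟩
  · refine Commute.smul_left (Commute.smul_right ?_ _) _
    refine Commute.sub_left ?_ (Commute.one_left _)
    refine Commute.sub_right ?_ (Commute.one_right _)
    exact ((hRcomm m n).smul_left _).smul_right _
  · set l : ℝ := n + 1 with hl
    have hl0 : 0 < l := hpos n
    set r := R n g with hr
    set y := (l : ℂ) • r - g with hy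
    have hry : A r y := hRA n g
    have hg : g = (l : ℂ) • r - y := by rw [hy]; abel
    have hY : Y n g = (l : ℂ) • y := rfl
    have hs := hA.sector hry
    -- Substituting g = l r - y: the first term inherits the sector condition from A, and the second
    -- is real with the favourable sign.
    have e : inner ℂ g (Y n g) = ((l ^ 2 : ℝ) : ℂ) * inner ℂ r y - ((l * ‖y‖ ^ 2 : ℝ) : ℂ) := by
      rw [hY, inner_smul_right]
      nth_rewrite 1 [hg]
      rw [inner_sub_left, inner_smul_left, inner_self_eq_norm_sq_to_K, Complex.conj_ofReal]
      push_cast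
      simp only [RCLike.ofReal_eq_complex_ofReal]
      ring
    rw [e, Complex.sub_re, Complex.sub_im, Complex.re_ofReal_mul, Complex.im_ofReal_mul,
      Complex.ofReal_re, Complex.ofReal_im, sub_zero, abs_mul, abs_of_nonneg (sq_nonneg l)]
    have h1 := mul_le_mul_of_nonneg_left hs (sq_nonneg l)
    have h2 : 0 ≤ l * ‖y‖ ^ 2 := by positivity
    nlinarith
  · have e : ∀ n : ℕ, Y n x = ((n + 1 : ℝ) : ℂ) • R n y := by
      intro n
      have h := hRu n x y hxy
      rw [map_sub, map_smul] at h
      change ((n + 1 : ℝ) : ℂ) • (((n + 1 : ℝ) : ℂ) • R n x - x) = _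
      congr 1
      rw [← sub_eq_zero, ← sub_eq_zero.mpr h]; abel
    simp only [e]
    exact hapx y

end IsMSectorial

theorem openSector_subset {k : ℝ} : {z : ℂ | |z.im| < k * z.re} ⊆ closedSector k := by
  intro z hz
  have hz : |z.im| < k * z.re := hz
  exact hz.le

/-- Monotonicity of the tangent turns |arg z| < arctan k into |Im z| / Re z < k; the half-angle is
below π/2, so Re z > 0. -/
theorem sector_subset {k : ℝ} :
    sector (Real.arctan k) ⊆ {z : ℂ | |z.im| < k * z.re} := by
  rintro z ⟨hz0, hz⟩
  have hpi : |z.arg| < Real.pi / 2 := hz.trans (Real.arctan_lt_pi_div_two k)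
  have hre : 0 < z.re := by
    rcases Complex.abs_arg_lt_pi_div_two_iff.mp hpi with h | h
    · exact h
    · exact absurd h hz0
  have hm := Real.strictMonoOn_tan
  have hmem : z.arg ∈ Ioo (-(Real.pi / 2)) (Real.pi / 2) := abs_lt.mp hpi
  have hk1 : Real.arctan k ∈ Ioo (-(Real.pi / 2)) (Real.pi / 2) := Real.arctan_mem_Ioo k
  have hk2 : -Real.arctan k ∈ Ioo (-(Real.pi / 2)) (Real.pi / 2) := ⟨by linarith [hk1.2], by
    linarith [hk1.1]⟩
  have h1 := hm hmem hk1 (abs_lt.mp hz).2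
  have h2 := hm hk2 hmem (abs_lt.mp hz).1
  rw [Real.tan_neg, Real.tan_arctan, Complex.tan_arg] at h2
  rw [Real.tan_arctan, Complex.tan_arg] at h1
  change |z.im| < k * z.re
  rw [div_lt_iff₀ hre] at h1
  rw [lt_div_iff₀ hre] at h2
  rw [abs_lt]
  constructor <;> linarith

namespace IsMSectorial

/-- An m-sectorial relation generates a holomorphic semigroup of contractions. -/
theorem exists_semigroup_zero [CompleteSpace V] (hA : IsMSectorial A k 0) (hk : 0 < k) :
    ∃ F : ℂ → V →L[ℂ] V, (∀ z ∈ closedSector k, ‖F z‖ ≤ 1) ∧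
      DifferentiableOn ℂ F {z : ℂ | |z.im| < k * z.re} ∧
      IsC0Semigroup (fun t : ℝ => F t) ∧ IsGeneratorOf A (fun t : ℝ => F t) := by
  obtain ⟨Y, hcomm, hsec, hlim⟩ := hA.exists_yosida hk
  obtain ⟨F, hF1, hFu⟩ := exists_limit_opExp hk hcomm hsec (hA.dense_domain hk)
    (fun x ⟨y, hxy⟩ => (hlim x y hxy).cauchySeq)
  have hFt : ∀ z ∈ closedSector k, ∀ x, Tendsto (fun n => opExp (z • Y n) x) atTop (𝓝 (F z x)) :=
    fun z hz x => (hFu x ‖z‖).tendsto_at ⟨hz, by simp⟩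
  have hnorm : ∀ z ∈ closedSector k, ‖F z‖ ≤ 1 := fun z hz =>
    ContinuousLinearMap.opNorm_le_bound _ zero_le_one fun x => by simpa using hF1 z hz x
  have hcontn : ∀ n x, Differentiable ℂ (fun z : ℂ => opExp (z • Y n) x) := by
    intro n x z
    have h := (hasDerivAt_exp_smul_const (𝕂 := ℂ) (Y n) z).differentiableAt
    exact ((ContinuousLinearMap.apply ℂ V x).differentiableAt).comp z h
  have hcont : ∀ x, ContinuousOn (fun z => F z x) (closedSector k) := by
    intro x z hz
    have h1 := (hFu x (‖z‖ + 1)).continuousOn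
      (Frequently.of_forall fun n => (hcontn n x).continuous.continuousOn)
    refine (h1 z ⟨hz, by simp⟩).mono_of_mem_nhdsWithin ?_
    refine inter_mem_nhdsWithin _ ?_
    exact mem_of_superset (Metric.isOpen_ball.mem_nhds (x := z) (s := Metric.ball 0 (‖z‖ + 1))
      (by simp)) Metric.ball_subset_closedBall
  have hUopen : IsOpen {z : ℂ | |z.im| < k * z.re} :=
    isOpen_lt (by fun_prop) (by fun_prop)
  have hdiff : ∀ x, DifferentiableOn ℂ (fun z => F z x) {z : ℂ | |z.im| < k * z.re} := by
    intro x
    refine TendstoLocallyUniformlyOn.differentiableOn (φ := atTop)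
      (F := fun n z => opExp (z • Y n) x) ?_
      (Eventually.of_forall fun n => (hcontn n x).differentiableOn) hUopen
    rw [tendstoLocallyUniformlyOn_iff_forall_isCompact hUopen]
    intro K hK hKc
    obtain ⟨R, hR⟩ := hKc.isBounded.subset_closedBall 0
    exact (hFu x R).mono fun z hz => ⟨openSector_subset (hK hz), hR hz⟩
  have hzero : F 0 = ContinuousLinearMap.id ℂ V := by
    ext x
    refine tendsto_nhds_unique (hFt 0 (by simp [closedSector]) x) ?_
    simp [opExp]
  have hadd : ∀ z ∈ closedSector k, ∀ w ∈ closedSector k, F (z + w) = (F z).comp (F w) := by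
    intro z hz w hw
    ext x
    refine tendsto_nhds_unique (hFt (z + w) (closedSector_add hz hw) x) ?_
    -- The uniform contraction bound on exp(zYₙ) allows the inner factor to be replaced by its
    -- limit, so the product of the strong limits is the limit of the products.
    have e : ∀ n, opExp ((z + w) • Y n) x = opExp (z • Y n) (opExp (w • Y n) x - F w x)
        + opExp (z • Y n) (F w x) := by
      intro n
      have : opExp ((z + w) • Y n) = opExp (z • Y n) * opExp (w • Y n) := by
        rw [add_smul]
        let _ : NormedAlgebra ℚ (V →L[ℂ] V) := NormedAlgebra.restrictScalars ℚ ℂ _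
        exact NormedSpace.exp_add_of_commute (((Commute.refl (Y n)).smul_left z).smul_right w)
      rw [this, ← map_add, sub_add_cancel]; rfl
    simp only [e]
    rw [← zero_add ((F z).comp (F w) x)]
    refine Tendsto.add ?_ (hFt z hz (F w x))
    refine squeeze_zero_norm (fun n => norm_opExp_smul_apply_le hk (hsec n) hz _) ?_
    have := (hFt w hw x).sub_const (F w x)
    rw [sub_self] at this
    simpa using this.norm
  have hR : ∀ t : ℝ, 0 ≤ t → (t : ℂ) ∈ closedSector k := fun t ht => ofReal_mem_closedSector hk ht
  have hcontR : ∀ x, ContinuousOn (fun t : ℝ => F t x) (Ici 0) := fun x =>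
    (hcont x).comp Complex.continuous_ofReal.continuousOn fun t ht => hR t ht
  have hgen : ∀ x y, A x y →
      Tendsto (fun t : ℝ => ((t⁻¹ : ℝ) : ℂ) • (F t x - x)) (𝓝[>] 0) (𝓝 y) := by
    intro x y hxy
    rw [Metric.tendsto_nhds]
    intro ε hε
    have hc0 : Tendsto (fun t : ℝ => F t y) (𝓝[≥] 0) (𝓝 y) := by
      have := hcontR y 0 self_mem_Ici
      simpa [ContinuousWithinAt, hzero] using this
    obtain ⟨δ, hδ, hδF⟩ := Metric.tendsto_nhdsWithin_nhds.mp hc0 (ε / 6) (by positivity)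
    have hev : ∀ᶠ n in atTop, (∀ s ∈ Icc (0 : ℝ) δ, ‖opExp ((s : ℂ) • Y n) y - F s y‖ ≤ ε / 6) ∧
        ‖Y n x - y‖ ≤ ε / 6 := by
      refine Eventually.and ?_ ?_
      · have := Metric.tendstoUniformlyOn_iff.mp (hFu y δ) (ε / 6) (by positivity)
        filter_upwards [this] with n hn s hs
        have h := hn s ⟨hR s hs.1, by simpa [abs_of_nonneg hs.1] using hs.2⟩
        rw [dist_comm, dist_eq_norm] at h
        exact h.le
      · have := Metric.tendsto_nhds.mp (hlim x y hxy) (ε / 6) (by positivity)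
        filter_upwards [this] with n hn
        rw [dist_eq_norm] at hn
        exact hn.le
    -- Mean value inequality for s ↦ exp(sYₙ)x - s y: for large n its derivative splits into three
    -- terms of size ε/6, and the resulting bound passes to the limit in n.
    have key : ∀ t ∈ Ioo (0 : ℝ) δ, ‖F t x - x - t • y‖ ≤ ε / 2 * t := by
      intro t ht
      have hlimt : Tendsto (fun n => ‖opExp ((t : ℂ) • Y n) x - x - t • y‖) atTop
          (𝓝 ‖F t x - x - t • y‖) :=
        (((hFt t (hR t ht.1.le) x).sub_const x).sub_const _).norm
      refine le_of_tendsto hlimt ?_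
      filter_upwards [hev] with n hn
      have hd : ∀ s : ℝ, HasDerivAt (fun s : ℝ => opExp (s • Y n) x - s • y)
          (opExp (s • Y n) (Y n x) - y) s := by
        intro s
        have := (hasDerivAt_opExp_smul_apply (Y n) x s).sub ((hasDerivAt_id s).smul_const y)
        rw [one_smul] at this
        exact this
      have hmv := norm_image_sub_le_of_norm_deriv_le_segment' (a := 0) (b := t) (C := ε / 2)
        (fun s _ => (hd s).hasDerivWithinAt) ?_ t ⟨ht.1.le, le_rfl⟩
      · simp only [zero_smul, sub_zero, opExp, NormedSpace.exp_zero, one_apply_eq_self] at hmv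
        refine le_trans (le_of_eq ?_) hmv
        congr 1
        rw [sub_right_comm]
        rfl
      · intro s hs
        have hs' : s ∈ Icc (0 : ℝ) δ := ⟨hs.1, (hs.2.trans ht.2).le⟩
        have a1 := hn.1 s hs'
        have a2 : ‖F s y - y‖ ≤ ε / 6 := by
          have := hδF (x := s) hs.1 (by simpa [abs_of_nonneg hs.1] using hs.2.trans ht.2)
          rw [dist_eq_norm] at this
          exact this.le
        have a3 : ‖opExp ((s : ℂ) • Y n) (Y n x - y)‖ ≤ ε / 6 :=
          (norm_opExp_smul_apply_le hk (hsec n) (hR s hs.1) _).trans hn.2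
        have e : opExp (s • Y n) (Y n x) - y = opExp ((s : ℂ) • Y n) (Y n x - y)
            + (opExp ((s : ℂ) • Y n) y - F s y) + (F s y - y) := by
          rw [map_sub, Complex.coe_smul]; abel
        rw [e]
        calc _ ≤ _ := norm_add₃_le
          _ ≤ ε / 2 := by linarith
    filter_upwards [Ioo_mem_nhdsGT hδ] with t ht
    rw [dist_eq_norm]
    have e : ((t⁻¹ : ℝ) : ℂ) • (F t x - x) - y = ((t⁻¹ : ℝ) : ℂ) • (F t x - x - t • y) := by
      rw [smul_sub _ _ (t • y), Complex.coe_smul t⁻¹ (t • y), smul_smul,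
        inv_mul_cancel₀ ht.1.ne', one_smul]
    rw [e, norm_smul, Complex.norm_real, Real.norm_of_nonneg (inv_nonneg.mpr ht.1.le),
      inv_mul_eq_div, div_lt_iff₀ ht.1]
    have := key t ht
    have h2 := mul_pos hε ht.1
    linarith
  refine ⟨F, hnorm, ?_, ⟨by simpa using hzero, ?_, hcontR⟩, fun x y => ⟨hgen x y, fun hxy => ?_⟩⟩
  · exact differentiableOn_of_forall_apply hUopen hdiff (M := 1) fun z hz =>
      hnorm z (openSector_subset hz)
  · intro s t hs ht
    simp only [Complex.ofReal_add]
    exact hadd s (hR s hs) t (hR t ht)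
  -- Maximality: compare x with the point x' of the domain solving x' - y' = x - y. The difference v
  -- satisfies (F(t)v - v)/t → v, while contractivity makes Re⟨v, F(t)v - v⟩ ≤ 0, so v = 0.
  · obtain ⟨x', y', h', e⟩ := hA.range one_pos (x - y)
    have hd := hxy.sub (hgen x' y' h')
    set v := x - x' with hv
    have hyv : y - y' = v := by
      rw [Complex.ofReal_one, one_smul] at e
      rw [hv, ← sub_eq_zero, ← sub_eq_zero.mpr e]; abel
    rw [hyv] at hd
    have hd2 : Tendsto (fun t : ℝ => ((t⁻¹ : ℝ) : ℂ) • (F t v - v)) (𝓝[>] 0) (𝓝 v) := by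
      refine hd.congr fun t => ?_
      rw [hv, ← smul_sub, map_sub]; congr 1; abel
    have hin : Tendsto (fun t : ℝ => (inner ℂ v (((t⁻¹ : ℝ) : ℂ) • (F t v - v))).re) (𝓝[>] 0)
        (𝓝 (inner ℂ v v).re) :=
      (Complex.continuous_re.tendsto _).comp (tendsto_const_nhds.inner hd2)
    have hle : (inner ℂ v v).re ≤ 0 := by
      refine le_of_tendsto hin ?_
      filter_upwards [self_mem_nhdsWithin] with t ht
      have ht : (0 : ℝ) < t := ht
      rw [inner_smul_right, Complex.re_ofReal_mul, inner_sub_right, Complex.sub_re,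
        show (inner ℂ v v).re = ‖v‖ ^ 2 from inner_self_eq_norm_sq (𝕜 := ℂ) v]
      refine mul_nonpos_of_nonneg_of_nonpos (inv_nonneg.mpr ht.le) ?_
      have h1 := re_inner_le_norm (𝕜 := ℂ) v (F t v)
      rw [RCLike.re_eq_complex_re] at h1
      have h2 := hF1 t (hR t ht.le) v
      nlinarith [norm_nonneg v]
    rw [show (inner ℂ v v).re = ‖v‖ ^ 2 from inner_self_eq_norm_sq (𝕜 := ℂ) v] at hle
    have hv0 : v = 0 := by
      have : ‖v‖ ^ 2 = 0 := le_antisymm hle (sq_nonneg _)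
      simpa using this
    rw [hv0] at hv hyv
    rw [← sub_eq_zero.mp hv.symm, ← sub_eq_zero.mp hyv] at h'
    exact h'

end IsMSectorial
end Generation

/-! ### Undoing the shift by an exponential factor. -/

section Shift

variable {V : Type*} [NormedAddCommGroup V] [InnerProductSpace ℂ V] {A : V → V → Prop} {k a : ℝ}

/-- The product rule for the right derivative at 0. Used with both signs of c, it transports the
generator in both directions. -/
theorem tendsto_exp_smul_sub {f : ℝ → V} {x y : V} (c : ℝ)
    (h : Tendsto (fun t : ℝ => ((t⁻¹ : ℝ) : ℂ) • (f t - x)) (𝓝[>] 0) (𝓝 y)) :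
    Tendsto (fun t : ℝ => ((t⁻¹ : ℝ) : ℂ) • (Complex.exp (c * t) • f t - x)) (𝓝[>] 0)
      (𝓝 (y + (c : ℂ) • x)) := by
  have hd : HasDerivAt (fun t : ℝ => Complex.exp (c * t)) (c : ℂ) 0 := by
    have h1 : HasDerivAt (fun t : ℝ => (c : ℂ) * t) c 0 := by
      simpa using (Complex.ofRealCLM.hasDerivAt (x := (0 : ℝ))).const_mul (c : ℂ)
    simpa using h1.cexp
  have h1 : Tendsto (fun t : ℝ => ((t⁻¹ : ℝ) : ℂ) * (Complex.exp (c * t) - 1)) (𝓝[>] 0)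
      (𝓝 (c : ℂ)) := by
    have := hd.tendsto_slope_zero_right
    simpa using this
  have h2 : Tendsto (fun t : ℝ => Complex.exp (c * t)) (𝓝[>] 0) (𝓝 1) := by
    have := hd.continuousAt.tendsto.mono_left (nhdsWithin_le_nhds (s := Ioi 0))
    simpa using this
  have h3 := (h2.smul h).add (h1.smul_const x)
  rw [one_smul] at h3
  refine h3.congr fun t => ?_
  rw [smul_comm, mul_smul, ← smul_add]
  congr 1
  rw [smul_sub, sub_smul, one_smul]; abel

/-- A quasi-m-sectorial relation generates a holomorphic semigroup. -/
theorem IsMSectorial.exists_semigroup [CompleteSpace V] (hA : IsMSectorial A k a) (hk : 0 < k) :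
    ∃ T : ℝ → V →L[ℂ] V, IsHolomorphicC0Semigroup T ∧ IsGeneratorOf A T := by
  obtain ⟨F, hF1, hFd, hF0, hFg⟩ := hA.shift.exists_semigroup_zero hk
  refine ⟨fun t => Complex.exp (a * t) • F t, ⟨⟨?_, ?_, ?_⟩, ?_⟩, fun x y => ?_⟩
  · simpa using hF0.zero
  · intro s t hs ht
    have := hF0.add s t hs ht
    rw [this, ContinuousLinearMap.comp_smul, ContinuousLinearMap.smul_comp, smul_smul,
      ← Complex.exp_add]
    congr 2
    push_cast; ring
  · intro x
    have h1 : Continuous fun t : ℝ => Complex.exp (a * t) := by fun_prop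
    exact h1.continuousOn.smul (hF0.continuousOn x)
  · refine ⟨Real.arctan k, Real.arctan_pos.mpr hk, (Real.arctan_lt_pi_div_two k).le,
      fun z => Complex.exp (a * z) • F z, ?_, fun t _ => rfl, fun θ' _ hθ' => ?_⟩
    · have h1 : Differentiable ℂ fun z : ℂ => Complex.exp (a * z) := by fun_prop
      exact h1.differentiableOn.smul (hFd.mono sector_subset)
    · refine ⟨Real.exp |a|, fun z hz hz1 => ?_⟩
      have hzs : z ∈ closedSector k :=
        openSector_subset (sector_subset ⟨hz.1, hz.2.trans hθ'⟩)
      rw [norm_smul, Complex.norm_exp]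
      have h1 : ((a : ℂ) * z).re ≤ |a| := by
        refine (Complex.re_le_norm _).trans ?_
        rw [norm_mul, Complex.norm_real, Real.norm_eq_abs]
        exact mul_le_of_le_one_right (abs_nonneg a) hz1
      calc _ ≤ Real.exp |a| * 1 := by gcongr; exact hF1 z hzs
        _ = _ := mul_one _
  · have h := hFg x (y - (a : ℂ) • x)
    simp only [sub_add_cancel] at h
    rw [h]
    constructor
    · intro h1
      simpa using tendsto_exp_smul_sub a h1
    · intro h1
      have := tendsto_exp_smul_sub (-a) h1
      rw [Complex.ofReal_neg, neg_smul, ← sub_eq_add_neg] at this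
      refine this.congr fun t => ?_
      rw [smul_apply, smul_smul, ← Complex.exp_add, neg_mul, neg_add_cancel, Complex.exp_zero,
        one_smul]

end Shift

/-! ### The operator of the form, acting in the form domain. -/

section Form

variable {V H : Type*} [NormedAddCommGroup V] [InnerProductSpace ℂ V] [CompleteSpace V]
  [NormedAddCommGroup H] [InnerProductSpace ℂ H] [CompleteSpace H]

/-- The relation in `V` given by the form `⟪v, u⟫ + ⟪j v, S (j u)⟫` and the embedding
`j : V → H`. -/
def formRel (j : V →L[ℂ] H) (S : H →L[ℂ] H) (u f : V) : Prop :=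
  ∀ v, inner ℂ v u + inner ℂ (j v) (S (j u)) = -inner ℂ (j v) (j f)

/-- Testing with v = f gives ⟨f, u⟩ = -‖j f‖² - c, where c = ⟨j f, S j u⟩. Then |Re c| + |Im c| ≤
2‖j f‖ ‖S‖ ‖j u‖ ≤ ‖j f‖² + ‖S‖² ‖j‖² ‖u‖², which explains the slope 1 and the first part of the
shift. The extra ‖S‖ in the shift ensures coercivity in the range condition. -/
theorem isMSectorial_formRel (j : V →L[ℂ] H) (hj : Function.Injective j) (S : H →L[ℂ] H) :
    IsMSectorial (formRel j S) 1 (‖S‖ ^ 2 * ‖j‖ ^ 2 + ‖S‖) where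
  add {x y x' y'} h h' v := by
    have h1 := h v
    have h2 := h' v
    simp only [map_add, inner_add_right]
    linear_combination h1 + h2
  smul c x y h v := by
    have h1 := h v
    simp only [map_smul, inner_smul_right]
    linear_combination c * h1
  eq_zero {y} h := by
    have := h y
    simp only [inner_zero_right, map_zero, zero_add] at this
    have h2 : inner ℂ (j y) (j y) = 0 := by simpa using this.symm
    exact hj (by rw [inner_self_eq_zero.mp h2, map_zero])
  sector {u f} h := by
    have h1 := h f
    have h2 : inner ℂ f u = -((‖j f‖ ^ 2 : ℝ) : ℂ) - inner ℂ (j f) (S (j u)) := by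
      rw [eq_sub_iff_add_eq, h1, inner_self_eq_norm_sq_to_K]
      push_cast; rfl
    have hre : (inner ℂ u f).re = (inner ℂ f u).re := by
      rw [← inner_conj_symm, Complex.conj_re]
    have him : |(inner ℂ u f).im| = |(inner ℂ f u).im| := by
      rw [← inner_conj_symm, Complex.conj_im, abs_neg]
    rw [hre, him, h2]
    simp only [Complex.sub_re, Complex.sub_im, Complex.neg_re, Complex.neg_im, Complex.ofReal_re,
      Complex.ofReal_im, neg_zero, zero_sub, abs_neg, one_mul]
    set c := inner ℂ (j f) (S (j u))
    have hc : ‖c‖ ≤ ‖j f‖ * (‖S‖ * ‖j u‖) :=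
      (norm_inner_le_norm _ _).trans (by gcongr; exact S.le_opNorm _)
    have hju : ‖S‖ * ‖j u‖ ≤ ‖S‖ * (‖j‖ * ‖u‖) := by gcongr; exact j.le_opNorm _
    have hsq : (‖S‖ * ‖j u‖) ^ 2 ≤ ‖S‖ ^ 2 * ‖j‖ ^ 2 * ‖u‖ ^ 2 := by
      calc _ ≤ (‖S‖ * (‖j‖ * ‖u‖)) ^ 2 := by gcongr
        _ = _ := by ring
    have h3 := Complex.abs_im_le_norm c
    have h4 := (abs_le.mp (Complex.abs_re_le_norm c)).1
    have h5 : 0 ≤ ‖S‖ * ‖u‖ ^ 2 := by positivity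
    nlinarith [sq_nonneg (‖j f‖ - ‖S‖ * ‖j u‖)]
  range {lam} hl g := by
    -- By adjunction, solving lam x - f = g with (x, f) in the relation means L x = j*j g. For lam ≥
    -- ‖S‖ one has Re⟨x, L x⟩ ≥ ‖x‖², so L is invertible by Lax–Milgram.
    set L : V →L[ℂ] V := 1 + j.adjoint ∘L S ∘L j + (lam : ℂ) • (j.adjoint ∘L j) with hL
    have hLi : ∀ v u, inner ℂ v (L u) = inner ℂ v u + inner ℂ (j v) (S (j u))
        + lam * inner ℂ (j v) (j u) := by
      intro v u
      simp [hL, ContinuousLinearMap.adjoint_inner_right]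
    have hunit : IsUnit L := by
      refine ContinuousLinearMap.isUnit_of_forall_le_norm_inner_map L (c := 1) one_pos fun x => ?_
      rw [NNReal.coe_one, mul_one, norm_inner_symm]
      refine le_trans ?_ (Complex.re_le_norm _)
      rw [hLi, Complex.add_re, Complex.add_re, Complex.re_ofReal_mul,
        show (inner ℂ x x).re = ‖x‖ ^ 2 from inner_self_eq_norm_sq (𝕜 := ℂ) x,
        show (inner ℂ (j x) (j x)).re = ‖j x‖ ^ 2 from inner_self_eq_norm_sq (𝕜 := ℂ) (j x)]
      have hc : ‖inner ℂ (j x) (S (j x))‖ ≤ ‖j x‖ * (‖S‖ * ‖j x‖) :=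
        (norm_inner_le_norm _ _).trans (by gcongr; exact S.le_opNorm _)
      have h4 := (abs_le.mp (Complex.abs_re_le_norm (inner ℂ (j x) (S (j x))))).1
      have h5 : 0 ≤ ‖S‖ ^ 2 * ‖j‖ ^ 2 := by positivity
      have h6 : ‖S‖ * ‖j x‖ ^ 2 ≤ lam * ‖j x‖ ^ 2 := by gcongr; linarith
      nlinarith
    obtain ⟨W, hW⟩ := hunit
    have hsurj : L ((W⁻¹ : (V →L[ℂ] V)ˣ).val (j.adjoint (j g))) = j.adjoint (j g) := by
      have : (W : V →L[ℂ] V) * (W⁻¹ : (V →L[ℂ] V)ˣ).val = 1 := W.mul_inv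
      rw [← hW]
      exact congrArg (fun T : V →L[ℂ] V => T (j.adjoint (j g))) this
    set x := (W⁻¹ : (V →L[ℂ] V)ˣ).val (j.adjoint (j g))
    refine ⟨x, (lam : ℂ) • x - g, fun v => ?_, by abel⟩
    have h1 := hLi v x
    rw [hsurj, ContinuousLinearMap.adjoint_inner_right] at h1
    simp only [map_sub, map_smul, inner_sub_right, inner_smul_right]
    linear_combination -h1

theorem exists_semigroup_formRel (j : V →L[ℂ] H) (hj : Function.Injective j) (S : H →L[ℂ] H)
    (A : V → V → Prop) (hA : ∀ u f, A u f ↔ formRel j S u f) :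
    ∃ T : ℝ → V →L[ℂ] V, IsHolomorphicC0Semigroup T ∧ IsGeneratorOf A T := by
  obtain ⟨T, hT, hgen⟩ := (isMSectorial_formRel j hj S).exists_semigroup one_pos
  exact ⟨T, hT, fun u f => (hA u f).trans (hgen u f)⟩

end Form

variable {d : ℕ} {Ω : Set (E d)}

/-! ### Translated mollification in L². -/

section Mollify

/-- The mollification of `f` by the bump function `φ`, translated by `τ`. -/
def mollify (φ : ContDiffBump (0 : E d)) (τ : E d) (f : E d → ℂ) (x : E d) : ℂ :=
  convolution (φ.normed volume) f (ContinuousLinearMap.lsmul ℝ ℝ) volume (x + τ)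

variable {φ : ContDiffBump (0 : E d)} {τ : E d} {f g : E d → ℂ}

theorem mollify_eq (x : E d) :
    mollify φ τ f x = ∫ y, φ.normed volume (x + τ - y) • f y :=
  convolution_lsmul_swap

theorem contDiff_mollify (hf : LocallyIntegrable f volume) : ContDiff ℝ ∞ (mollify φ τ f) := by
  have h : ContDiff ℝ ∞ (convolution (φ.normed volume) f (ContinuousLinearMap.lsmul ℝ ℝ) volume) :=
    φ.hasCompactSupport_normed.contDiff_convolution_left _ (φ.contDiff_normed (μ := volume)) hf
  exact h.comp (contDiff_id.add contDiff_const)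

theorem fderiv_mollify (hf : LocallyIntegrable f volume) (x v : E d) :
    fderiv ℝ (mollify φ τ f) x v = ∫ y, fderiv ℝ (φ.normed volume) (x + τ - y) v • f y := by
  have h := φ.hasCompactSupport_normed.hasFDerivAt_convolution_left (μ := volume)
    (ContinuousLinearMap.lsmul ℝ ℝ) (φ.contDiff_normed (μ := volume) (n := 1)) hf (x + τ)
  have h2 : fderiv ℝ (mollify φ τ f) x = fderiv ℝ (convolution (φ.normed volume) f
      (ContinuousLinearMap.lsmul ℝ ℝ) volume) (x + τ) := fderiv_comp_add_right τ
  rw [h2, h.fderiv, convolution_eq_swap]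
  have hex : ConvolutionExistsAt (fderiv ℝ (φ.normed volume)) f (x + τ)
      (ContinuousLinearMap.precompL (E d) (ContinuousLinearMap.lsmul ℝ ℝ)) volume :=
    (φ.hasCompactSupport_normed.fderiv ℝ).convolutionExists_left _
      ((φ.contDiff_normed (μ := volume) (n := 1)).continuous_fderiv one_ne_zero) hf _
  rw [ContinuousLinearMap.integral_apply hex.integrable_swap]
  rfl

theorem convolutionExists_bump (hf : LocallyIntegrable f volume) (x : E d) :
    ConvolutionExistsAt (φ.normed volume) f x (ContinuousLinearMap.lsmul ℝ ℝ) volume :=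
  φ.hasCompactSupport_normed.convolutionExists_left _ φ.continuous_normed hf x

theorem mollify_sub (hf : LocallyIntegrable f volume) (hg : LocallyIntegrable g volume) :
    mollify φ τ (f - g) = mollify φ τ f - mollify φ τ g := by
  ext x
  have h1 : Integrable fun y => φ.normed volume (x + τ - y) • f y :=
    (convolutionExists_bump (φ := φ) hf (x + τ)).integrable_swap
  have h2 : Integrable fun y => φ.normed volume (x + τ - y) • g y :=
    (convolutionExists_bump (φ := φ) hg (x + τ)).integrable_swap
  rw [Pi.sub_apply, mollify_eq, mollify_eq, mollify_eq, ← integral_sub h1 h2]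
  exact integral_congr_ae (Eventually.of_forall fun y => smul_sub _ _ _)

/-- The kernel sees only the ball of radius `φ.rOut` around x + τ. This locality is what permits
mollifying functions known only inside Ω. -/
theorem mollify_congr (x : E d)
    (h : ∀ᵐ y, y ∈ Metric.ball (x + τ) φ.rOut → f y = g y) :
    mollify φ τ f x = mollify φ τ g x := by
  rw [mollify_eq, mollify_eq]
  refine integral_congr_ae ?_
  filter_upwards [h] with y hy
  by_cases hb : y ∈ Metric.ball (x + τ) φ.rOut
  · simp only [hy hb]
  · have : x + τ - y ∉ Function.support (φ.normed volume) := by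
      rw [φ.support_normed_eq]
      intro hmem
      refine hb ?_
      rw [Metric.mem_ball, dist_zero_right] at hmem
      rw [Metric.mem_ball, dist_comm, dist_eq_norm]
      exact hmem
    rw [Function.notMem_support.mp this]
    simp

/-- Jensen's inequality for the probability density p, by Cauchy–Schwarz after splitting p h =
p^{1/2} · p^{1/2} h. -/
theorem sq_lintegral_mul_le {α : Type*} [MeasurableSpace α] {μ : Measure α} {p h : α → ℝ≥0∞}
    (hp : Measurable p) (hh : AEMeasurable h μ) (hp1 : ∫⁻ x, p x ∂μ = 1) :
    (∫⁻ x, p x * h x ∂μ) ^ 2 ≤ ∫⁻ x, p x * h x ^ 2 ∂μ := by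
  have hH := ENNReal.lintegral_mul_le_Lp_mul_Lq μ Real.HolderConjugate.two_two
    (f := fun x => p x ^ (1 / 2 : ℝ)) (g := fun x => p x ^ (1 / 2 : ℝ) * h x)
    (hp.pow_const _).aemeasurable ((hp.pow_const _).aemeasurable.mul hh)
  have e1 : ∀ x, ((fun x => p x ^ (1 / 2 : ℝ)) * fun x => p x ^ (1 / 2 : ℝ) * h x) x
      = p x * h x := by
    intro x
    simp only [Pi.mul_apply]
    rw [← mul_assoc, ← ENNReal.rpow_add_of_nonneg _ _ (by norm_num) (by norm_num)]
    norm_num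
  have e2 : ∀ x, (p x ^ (1 / 2 : ℝ)) ^ (2 : ℝ) = p x := by
    intro x
    rw [← ENNReal.rpow_mul]; norm_num
  have e3 : ∀ x, (p x ^ (1 / 2 : ℝ) * h x) ^ (2 : ℝ) = p x * h x ^ 2 := by
    intro x
    rw [ENNReal.mul_rpow_of_nonneg _ _ (by norm_num), e2]
    norm_cast
  simp only [e1, e2, e3, hp1, ENNReal.one_rpow, one_mul] at hH
  calc _ ≤ ((∫⁻ x, p x * h x ^ 2 ∂μ) ^ (1 / 2 : ℝ)) ^ 2 := by gcongr
    _ = _ := by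
      rw [← ENNReal.rpow_natCast, ← ENNReal.rpow_mul]; norm_num

theorem eLpNorm_two_sq {α F : Type*} [MeasurableSpace α] [NormedAddCommGroup F] (μ : Measure α)
    (f : α → F) : eLpNorm f 2 μ ^ 2 = ∫⁻ x, ‖f x‖ₑ ^ 2 ∂μ := by
  rw [eLpNorm_eq_lintegral_rpow_enorm_toReal (by norm_num) (by norm_num), ← ENNReal.rpow_natCast,
    ← ENNReal.rpow_mul]
  norm_num

theorem lintegral_enorm_bump : ∫⁻ x, ‖φ.normed volume x‖ₑ = 1 := by
  have h := φ.integral_normed (μ := volume)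
  rw [integral_eq_lintegral_of_nonneg_ae (Eventually.of_forall fun x => φ.nonneg_normed x)
    φ.continuous_normed.aestronglyMeasurable] at h
  have h2 : ∀ x, ‖φ.normed volume x‖ₑ = ENNReal.ofReal (φ.normed volume x) := fun x =>
    Real.enorm_of_nonneg (φ.nonneg_normed x)
  simp only [h2]
  exact (ENNReal.toReal_eq_one_iff _).mp h

/-- Jensen pointwise, then Tonelli and translation invariance. -/
theorem eLpNorm_mollify_le (hf : AEStronglyMeasurable f volume) :
    eLpNorm (mollify φ τ f) 2 volume ≤ eLpNorm f 2 volume := by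
  have hpt : ∀ x, ‖mollify φ τ f x‖ₑ ^ 2 ≤
      ∫⁻ y, ‖φ.normed volume y‖ₑ * ‖f (x + τ - y)‖ₑ ^ 2 := by
    intro x
    have hm : AEMeasurable (fun y => ‖f (x + τ - y)‖ₑ) volume :=
      (hf.comp_quasiMeasurePreserving
        (Measure.measurePreserving_sub_left volume (x + τ)).quasiMeasurePreserving).enorm
    refine le_trans ?_ (sq_lintegral_mul_le
      (φ.continuous_normed.measurable.enorm) hm lintegral_enorm_bump)
    gcongr
    refine (enorm_integral_le_lintegral_enorm _).trans (lintegral_mono fun y => ?_)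
    exact (enorm_smul (φ.normed volume y) (f (x + τ - y))).le
  have key : eLpNorm (mollify φ τ f) 2 volume ^ 2 ≤ eLpNorm f 2 volume ^ 2 := by
    rw [eLpNorm_two_sq, eLpNorm_two_sq]
    calc ∫⁻ x, ‖mollify φ τ f x‖ₑ ^ 2
        ≤ ∫⁻ x, ∫⁻ y, ‖φ.normed volume y‖ₑ * ‖f (x + τ - y)‖ₑ ^ 2 := lintegral_mono hpt
      _ = ∫⁻ y, ∫⁻ x, ‖φ.normed volume y‖ₑ * ‖f (x + τ - y)‖ₑ ^ 2 := by
          refine lintegral_lintegral_swap ?_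
          have hq : Measure.QuasiMeasurePreserving (fun p : E d × E d => p.1 + τ - p.2)
              (volume.prod volume) volume := by
            have h1 := (quasiMeasurePreserving_sub (volume : Measure (E d)) volume)
            have h2 : Measure.QuasiMeasurePreserving (fun p : E d × E d => (p.1 + τ, p.2))
                (volume.prod volume) (volume.prod volume) :=
              ((measurePreserving_add_right (volume : Measure (E d)) τ).prod
                (MeasurePreserving.id volume)).quasiMeasurePreserving
            exact h1.comp h2
          have h3 := (hf.comp_quasiMeasurePreserving hq).enorm.pow_const 2
          have h4 : AEMeasurable (fun p : E d × E d => ‖φ.normed volume p.2‖ₑ)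
              (volume.prod volume) :=
            (φ.continuous_normed.measurable.enorm.comp measurable_snd).aemeasurable
          exact h4.mul h3
      _ = ∫⁻ y, ‖φ.normed volume y‖ₑ * ∫⁻ x, ‖f x‖ₑ ^ 2 := by
          congr 1; ext y
          rw [lintegral_const_mul' _ _ enorm_ne_top]
          congr 1
          have := lintegral_add_right_eq_self (μ := (volume : Measure (E d)))
            (fun x => ‖f x‖ₑ ^ 2) (τ - y)
          rw [← this]
          congr 1; ext x; rw [add_sub_assoc]
      _ = ∫⁻ x, ‖f x‖ₑ ^ 2 := by
          rw [lintegral_mul_const _ φ.continuous_normed.measurable.enorm, lintegral_enorm_bump,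
            one_mul]
  exact (ENNReal.pow_le_pow_left_iff two_ne_zero).mp key

variable {φs : ℕ → ContDiffBump (0 : E d)} {τs : ℕ → E d}

theorem tendstoUniformly_mollify (hφ : Tendsto (fun n => (φs n).rOut) atTop (𝓝 0))
    (hτ : Tendsto τs atTop (𝓝 0)) (hg : Continuous g) (hgc : HasCompactSupport g) :
    TendstoUniformly (fun n => mollify (φs n) (τs n) g) g atTop := by
  rw [Metric.tendstoUniformly_iff]
  intro ε hε
  obtain ⟨δ, hδ, hgδ⟩ := Metric.uniformContinuous_iff.mp
    (hgc.uniformContinuous_of_continuous hg) (ε / 3) (by positivity)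
  have h1 : ∀ᶠ n in atTop, (φs n).rOut < δ := hφ.eventually_lt_const hδ
  have h2 : ∀ᶠ n in atTop, dist (τs n) 0 < δ := Metric.tendsto_nhds.mp hτ δ hδ
  filter_upwards [h1, h2] with n hn1 hn2 x
  have a1 : dist (mollify (φs n) (τs n) g x) (g (x + τs n)) ≤ ε / 3 :=
    ContDiffBump.dist_normed_convolution_le hg.aestronglyMeasurable fun y hy =>
      (hgδ (lt_trans hy hn1)).le
  have a2 : dist (g (x + τs n)) (g x) < ε / 3 := hgδ (by simpa using hn2)
  rw [dist_comm]
  linarith [dist_triangle (mollify (φs n) (τs n) g x) (g (x + τs n)) (g x)]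

theorem mollify_eq_zero (x : E d) (h : ∀ y ∈ Metric.ball (x + τ) φ.rOut, f y = 0) :
    mollify φ τ f x = 0 := by
  rw [mollify_congr (g := 0) x (Eventually.of_forall h)]
  simp [mollify]

/-- The uniform L² contraction bound reduces the claim to continuous compactly supported functions,
for which convergence is uniform with supports in one compact set. -/
theorem tendsto_eLpNorm_mollify_sub (hφ : Tendsto (fun n => (φs n).rOut) atTop (𝓝 0))
    (hτ : Tendsto τs atTop (𝓝 0)) (hf : MemLp f 2 volume) :
    Tendsto (fun n => eLpNorm (mollify (φs n) (τs n) f - f) 2 volume) atTop (𝓝 0) := by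
  rw [ENNReal.tendsto_nhds_zero]
  intro ε hε
  obtain ⟨g, hgc, hfg, hg, hgm⟩ := hf.exists_hasCompactSupport_eLpNorm_sub_le (by norm_num)
    (ε := ε / 3) (ENNReal.div_pos hε.ne' (by norm_num)).ne'
  obtain ⟨R, hR⟩ := hgc.isCompact.isBounded.subset_closedBall 0
  -- One unit of room for the mollification radius and one for the translation, both eventually
  -- below 1.
  set K := Metric.closedBall (0 : E d) (R + 2) with hK
  have hKfin : volume K < ⊤ := measure_closedBall_lt_top
  have hunif := tendstoUniformly_mollify hφ hτ hg hgc
  have hbd : ∀ᶠ n in atTop, eLpNorm (mollify (φs n) (τs n) g - g) 2 volume ≤ ε / 3 := by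
    obtain ⟨δ, hδ, hδε⟩ : ∃ δ : ℝ, 0 < δ ∧
        ENNReal.ofReal δ * volume K ^ (1 / 2 : ℝ) ≤ ε / 3 := by
      have hc : Tendsto (fun δ : ℝ => ENNReal.ofReal δ * volume K ^ (1 / 2 : ℝ)) (𝓝[>] 0)
          (𝓝 (ENNReal.ofReal 0 * volume K ^ (1 / 2 : ℝ))) := by
        refine ENNReal.Tendsto.mul_const ?_ (Or.inr ?_)
        · exact (ENNReal.continuous_ofReal.tendsto 0).mono_left nhdsWithin_le_nhds
        · exact (ENNReal.rpow_lt_top_of_nonneg (by norm_num) hKfin.ne).ne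
      rw [ENNReal.ofReal_zero, zero_mul] at hc
      have h3 : (0 : ℝ≥0∞) < ε / 3 := ENNReal.div_pos hε.ne' (by norm_num)
      have := (ENNReal.tendsto_nhds_zero.mp hc (ε / 3) h3).and self_mem_nhdsWithin
      obtain ⟨δ, h1, h2⟩ := this.exists
      exact ⟨δ, h2, h1⟩
    have h1 : ∀ᶠ n in atTop, (φs n).rOut < 1 := hφ.eventually_lt_const one_pos
    have h2 : ∀ᶠ n in atTop, dist (τs n) 0 < 1 := Metric.tendsto_nhds.mp hτ 1 one_pos
    filter_upwards [Metric.tendstoUniformly_iff.mp hunif δ hδ, h1, h2] with n hn hn1 hn2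
    refine le_trans ?_ hδε
    have hsupp : ∀ x ∉ K, mollify (φs n) (τs n) g x - g x = 0 := by
      intro x hx
      have hx' : R + 2 < ‖x‖ := by simpa [hK] using hx
      have hz : ∀ y, R < ‖y‖ → g y = 0 := by
        intro y hy
        by_contra hne
        have := hR (subset_tsupport g hne)
        rw [mem_closedBall_zero_iff] at this
        linarith
      rw [hz x (by linarith), mollify_eq_zero, sub_zero]
      intro y hy
      refine hz y ?_
      rw [Metric.mem_ball, dist_eq_norm] at hy
      rw [dist_zero_right] at hn2
      have e : x = (y - τs n) - (y - (x + τs n)) := by abel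
      have a1 := norm_sub_le (y - τs n) (y - (x + τs n))
      rw [← e] at a1
      have a2 := norm_sub_le y (τs n)
      linarith
    have e : mollify (φs n) (τs n) g - g = K.indicator (mollify (φs n) (τs n) g - g) := by
      ext x
      by_cases hx : x ∈ K
      · rw [indicator_of_mem hx]
      · rw [indicator_of_notMem hx]; exact hsupp x hx
    rw [e, eLpNorm_indicator_eq_eLpNorm_restrict Metric.isClosed_closedBall.measurableSet]
    have := eLpNorm_le_of_ae_bound (p := 2) (μ := volume.restrict K)
      (f := mollify (φs n) (τs n) g - g) (C := δ)
      (Eventually.of_forall fun x => by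
        have := (hn x).le
        rw [dist_comm, dist_eq_norm] at this
        exact this)
    rw [Measure.restrict_apply_univ, mul_comm] at this
    simpa using this
  filter_upwards [hbd] with n hn
  have hfl : LocallyIntegrable f volume := hf.locallyIntegrable (by norm_num)
  have hgl : LocallyIntegrable g volume := hg.locallyIntegrable
  have e : mollify (φs n) (τs n) f - f = (mollify (φs n) (τs n) (f - g)
      + (mollify (φs n) (τs n) g - g)) + (g - f) := by
    rw [mollify_sub hfl hgl]; abel
  have m1 : AEStronglyMeasurable (mollify (φs n) (τs n) (f - g)) volume :=
    (contDiff_mollify (hfl.sub hgl)).continuous.aestronglyMeasurable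
  have m2 : AEStronglyMeasurable (mollify (φs n) (τs n) g - g) volume :=
    ((contDiff_mollify hgl).continuous.sub hg).aestronglyMeasurable
  rw [e]
  calc _ ≤ eLpNorm (mollify (φs n) (τs n) (f - g) + (mollify (φs n) (τs n) g - g)) 2 volume
        + eLpNorm (g - f) 2 volume :=
        eLpNorm_add_le (m1.add m2) (hgm.1.sub hf.1) (by norm_num)
    _ ≤ eLpNorm (mollify (φs n) (τs n) (f - g)) 2 volume
        + eLpNorm (mollify (φs n) (τs n) g - g) 2 volume + eLpNorm (g - f) 2 volume := by
        gcongr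
        exact eLpNorm_add_le m1 m2 (by norm_num)
    _ ≤ ε / 3 + ε / 3 + ε / 3 := by
        gcongr
        · exact (eLpNorm_mollify_le (hf.1.sub hgm.1)).trans hfg
        · rwa [eLpNorm_sub_comm]
    _ = ε := ENNReal.add_thirds ε

end Mollify

/-! ### H¹(Ω) as a Hilbert space. -/

section Sobolev

/-- The Hilbert space `L²(Ω) × L²(Ω)^d` containing `H¹(Ω)`. -/
abbrev H1Ambient (Ω : Set (E d)) : Type :=
  WithLp 2 (L2 Ω × PiLp 2 (fun _ : Fin d => L2 Ω))

/-- The element of `L²(Ω) × L²(Ω)^d` with given components. -/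
def mkAmbient (u : L2 Ω) (g : Fin d → L2 Ω) : H1Ambient Ω :=
  WithLp.toLp 2 (u, WithLp.toLp 2 g)

theorem tendsto_ambient {ι : Type*} {l : Filter ι} {p : ι → H1Ambient Ω} {q : H1Ambient Ω}
    (h1 : Tendsto (fun n => (p n).fst) l (𝓝 q.fst))
    (h2 : ∀ i, Tendsto (fun n => (p n).snd i) l (𝓝 (q.snd i))) : Tendsto p l (𝓝 q) := by
  have h3 : Tendsto (fun n => (p n).snd) l (𝓝 q.snd) := by
    have h4 : Tendsto (fun n => WithLp.ofLp (p n).snd) l (𝓝 (WithLp.ofLp q.snd)) :=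
      tendsto_pi_nhds.mpr h2
    exact ((PiLp.continuous_toLp 2 _).tendsto _).comp h4
  exact ((WithLp.prod_continuous_toLp 2 _ _).tendsto _).comp (h1.prodMk_nhds h3)

theorem continuous_fst_ambient : Continuous fun p : H1Ambient Ω => p.fst :=
  continuous_fst.comp (WithLp.prod_continuous_ofLp 2 _ _)

theorem continuous_snd_ambient (i : Fin d) : Continuous fun p : H1Ambient Ω => p.snd i :=
  ((continuous_apply i).comp (PiLp.continuous_ofLp 2 _)).comp
    (continuous_snd.comp (WithLp.prod_continuous_ofLp 2 _ _))

theorem continuous_integral_smul {η : E d → ℝ} (hη : Continuous η) (hc : HasCompactSupport η) :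
    Continuous fun u : L2 Ω => ∫ x in Ω, η x • u x := by
  have hm : MemLp (fun x => (η x : ℂ)) 2 (volume.restrict Ω) :=
    ((hη.memLp_of_hasCompactSupport hc).restrict Ω).ofReal
  have h : ∀ u : L2 Ω, ∫ x in Ω, η x • u x = inner ℂ (hm.toLp _) u := by
    intro u
    rw [L2.inner_def]
    refine integral_congr_ae ?_
    filter_upwards [hm.coeFn_toLp] with x hx
    rw [hx]
    simp [mul_comm]
  simp only [h]
  fun_prop

theorem continuous_partialDeriv {φ : E d → ℝ} (hφ : ContDiff ℝ ∞ φ)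
    (i : Fin d) : Continuous (partialDeriv i φ) :=
  (hφ.continuous_fderiv (by simp)).clm_apply continuous_const

theorem hasCompactSupport_partialDeriv {φ : E d → ℝ} (hφ : HasCompactSupport φ) (i : Fin d) :
    HasCompactSupport (partialDeriv i φ) :=
  hφ.fderiv_apply (𝕜 := ℝ) _

/-- Each test function imposes a condition continuous in the L² components. Closedness gives the
completeness on which the abstract generation theorem relies. -/
theorem isClosed_H1 : IsClosed (H1 Ω : Set (H1Ambient Ω)) := by
  have : (H1 Ω : Set (H1Ambient Ω)) = ⋂ (i : Fin d) (φ : E d → ℝ) (_ : IsTestFunction Ω φ),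
      {p | ∫ x in Ω, partialDeriv i φ x • p.fst x = - ∫ x in Ω, φ x • p.snd i x} := by
    ext p
    simp only [mem_iInter]
    rfl
  rw [this]
  refine isClosed_iInter fun i => isClosed_iInter fun φ => isClosed_iInter fun hφ => ?_
  refine isClosed_eq ?_ ?_
  · exact (continuous_integral_smul (continuous_partialDeriv hφ.contDiff i)
      (hasCompactSupport_partialDeriv hφ.hasCompactSupport i)).comp continuous_fst_ambient
  · exact ((continuous_integral_smul hφ.contDiff.continuous hφ.hasCompactSupport).comp
      (continuous_snd_ambient i)).neg

instance : CompleteSpace (H1 Ω) := isClosed_H1.completeSpace_coe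

/-- Two elements of `L²(Ω)` with the same integrals against all test functions agree. -/
theorem L2_ext_of_test (hΩ : IsOpen Ω) {f g : L2 Ω}
    (h : ∀ φ : E d → ℝ, IsTestFunction Ω φ → ∫ x in Ω, φ x • f x = ∫ x in Ω, φ x • g x) :
    f = g := by
  rw [← sub_eq_zero]
  refine Lp.ext ?_
  have hli : LocallyIntegrableOn (f - g : L2 Ω) Ω volume := by
    have h1 : LocallyIntegrable (f - g : L2 Ω) (volume.restrict Ω) :=
      (Lp.memLp (f - g)).locallyIntegrable (by norm_num)
    exact locallyIntegrableOn_of_locallyIntegrable_restrict h1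
  have key := hΩ.ae_eq_zero_of_integral_contDiff_smul_eq_zero hli fun φ h1 h2 h3 => by
    have hφ : IsTestFunction Ω φ := ⟨h1, h2, h3⟩
    have e : ∫ x, φ x • (f - g : L2 Ω) x = ∫ x in Ω, φ x • (f - g : L2 Ω) x := by
      refine (setIntegral_eq_integral_of_forall_compl_eq_zero fun x hx => ?_).symm
      rw [image_eq_zero_of_notMem_tsupport (fun hx' => hx (h3 hx')), zero_smul]
    rw [e, ← sub_eq_zero.mpr (h φ hφ), ← integral_sub (hφ.integrable_smul f)
      (hφ.integrable_smul g)]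
    refine integral_congr_ae ?_
    filter_upwards [Lp.coeFn_sub f g] with x hx
    rw [hx, Pi.sub_apply, smul_sub]
  filter_upwards [(ae_restrict_iff' hΩ.measurableSet).mpr key,
    Lp.coeFn_zero ℂ 2 (volume.restrict Ω)] with x h1 h2
  rw [h1, h2]; rfl

/-- The weak gradient is determined by the function, so the L² component alone is injective on
H¹(Ω). -/
theorem H1_ext (hΩ : IsOpen Ω) {u v : H1 Ω} (h : toL2 u = toL2 v) : u = v := by
  have hg : ∀ i, grad u i = grad v i := by
    intro i
    refine L2_ext_of_test hΩ fun φ hφ => ?_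
    have h1 := u.2 i φ hφ
    have h2 := v.2 i φ hφ
    change ∫ x in Ω, partialDeriv i φ x • toL2 u x = -∫ x in Ω, φ x • grad u i x at h1
    change ∫ x in Ω, partialDeriv i φ x • toL2 v x = -∫ x in Ω, φ x • grad v i x at h2
    rw [h, h2] at h1
    exact (neg_injective h1).symm
  refine Subtype.ext ?_
  have h2 : u.1.snd = v.1.snd := PiLp.ext hg
  have h3 : u.1.fst = v.1.fst := h
  exact WithLp.ofLp_injective 2 (Prod.ext h3 h2)

theorem memLp_of_continuousOn {μ : Measure (E d)} {K : Set (E d)} (hK : IsCompact K)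
    {w : E d → ℂ} (hw : ContinuousOn w K) (hμ : μ K ≠ ⊤) : MemLp w 2 (μ.restrict K) := by
  have : IsFiniteMeasure (μ.restrict K) := ⟨by rwa [Measure.restrict_apply_univ, lt_top_iff_ne_top]⟩
  obtain ⟨C, hC⟩ := hK.exists_bound_of_continuousOn hw
  exact MemLp.of_bound (hw.aestronglyMeasurable hK.measurableSet) C
    (ae_restrict_of_forall_mem hK.measurableSet hC)

/-- A `C¹` function restricts to an element of `H¹` of a bounded open set. -/
theorem exists_H1_of_contDiff (hb : Bornology.IsBounded Ω) {w : E d → ℂ}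
    (hw : ContDiff ℝ 1 w) :
    ∃ v : H1 Ω, toL2 v =ᵐ[volume.restrict Ω] w ∧
      ∀ i, grad v i =ᵐ[volume.restrict Ω] fun x => fderiv ℝ w x (EuclideanSpace.single i 1) := by
  have hmem : ∀ g : E d → ℂ, Continuous g → MemLp g 2 (volume.restrict Ω) := by
    intro g hg
    exact (memLp_of_continuousOn hb.isCompact_closure hg.continuousOn
      hb.isCompact_closure.measure_lt_top.ne).mono_measure
      (Measure.restrict_mono_set _ subset_closure)
  have hd : ∀ i : Fin d, Continuous fun x => fderiv ℝ w x (EuclideanSpace.single i 1) := fun i =>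
    (hw.continuous_fderiv one_ne_zero).clm_apply continuous_const
  refine ⟨⟨mkAmbient ((hmem w hw.continuous).toLp w) (fun i => (hmem _ (hd i)).toLp _), ?_⟩, ?_, ?_⟩
  · intro i φ hφ
    have e1 : ∫ x in Ω, partialDeriv i φ x • ((hmem w hw.continuous).toLp w) x
        = ∫ x, partialDeriv i φ x • w x := by
      rw [← setIntegral_eq_integral_of_forall_compl_eq_zero (s := Ω)
        (f := fun x => partialDeriv i φ x • w x)]
      · refine integral_congr_ae ?_
        filter_upwards [(hmem w hw.continuous).coeFn_toLp] with x hx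
        rw [hx]
      · intro x hx
        have : x ∉ tsupport (partialDeriv i φ) := fun h =>
          hx (hφ.tsupport_subset (tsupport_fderiv_apply_subset ℝ _ h))
        rw [image_eq_zero_of_notMem_tsupport this, zero_smul]
    have e2 : ∫ x in Ω, φ x • ((hmem _ (hd i)).toLp _) x
        = ∫ x, φ x • fderiv ℝ w x (EuclideanSpace.single i 1) := by
      rw [← setIntegral_eq_integral_of_forall_compl_eq_zero (s := Ω)
        (f := fun x => φ x • fderiv ℝ w x (EuclideanSpace.single i 1))]
      · refine integral_congr_ae ?_
        filter_upwards [(hmem _ (hd i)).coeFn_toLp] with x hx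
        rw [hx]
      · intro x hx
        rw [image_eq_zero_of_notMem_tsupport (fun h => hx (hφ.tsupport_subset h)), zero_smul]
    have hcs : ∀ (η : E d → ℝ) (g : E d → ℂ), Continuous η → HasCompactSupport η → Continuous g →
        Integrable (fun x => η x • g x) := fun η g h1 h2 h3 =>
      (h1.smul h3).integrable_of_hasCompactSupport h2.smul_right
    have hibp := integral_smul_fderiv_eq_neg_fderiv_smul_of_integrable (μ := volume)
      (f := φ) (g := w) (v := EuclideanSpace.single i 1)
      (hcs _ _ (continuous_partialDeriv hφ.contDiff i)
        (hasCompactSupport_partialDeriv hφ.hasCompactSupport i) hw.continuous)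
      (hcs _ _ hφ.contDiff.continuous hφ.hasCompactSupport (hd i))
      (hcs _ _ hφ.contDiff.continuous hφ.hasCompactSupport hw.continuous)
      (fun x _ => (hφ.contDiff.differentiable (by simp)) x)
      (fun x _ => (hw.differentiable one_ne_zero) x)
    change ∫ x in Ω, partialDeriv i φ x • ((hmem w hw.continuous).toLp w) x =
      -∫ x in Ω, φ x • ((hmem _ (hd i)).toLp _) x
    rw [e1, e2, hibp, neg_neg]
    rfl
  · exact (hmem w hw.continuous).coeFn_toLp
  · exact fun i => (hmem _ (hd i)).coeFn_toLp

end Sobolev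

/-! ### Localization and smooth approximation. -/

section Cutoff

theorem memLp_top_of_hasCompactSupport {η : E d → ℝ} (hη : Continuous η)
    (hc : HasCompactSupport η) (μ : Measure (E d)) : MemLp (fun x => (η x : ℂ)) ⊤ μ := by
  obtain ⟨C, hC⟩ := hc.exists_bound_of_continuous hη
  exact memLp_top_of_bound (Complex.continuous_ofReal.comp hη).aestronglyMeasurable C
    (Eventually.of_forall fun x => by simpa using hC x)

/-- Multiplication by a continuous compactly supported function on `L²(Ω)`. -/
def mulL2 {η : E d → ℝ} (hη : Continuous η) (hc : HasCompactSupport η) : L2 Ω →L[ℂ] L2 Ω :=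
  (ContinuousLinearMap.mul ℂ ℂ).holderL (volume.restrict Ω) ⊤ 2 2
    ((memLp_top_of_hasCompactSupport hη hc _).toLp _)

theorem coeFn_mulL2 {η : E d → ℝ} (hη : Continuous η) (hc : HasCompactSupport η) (u : L2 Ω) :
    mulL2 hη hc u =ᵐ[volume.restrict Ω] fun x => η x • u x := by
  have h := (ContinuousLinearMap.mul ℂ ℂ).coeFn_holder (r := 2)
    ((memLp_top_of_hasCompactSupport hη hc (volume.restrict Ω)).toLp _) u
  filter_upwards [h, (memLp_top_of_hasCompactSupport hη hc (volume.restrict Ω)).coeFn_toLp]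
    with x h1 h2
  refine h1.trans ?_
  rw [h2]
  simp

/-- Multiplication of `(u, ∇u)` by a smooth cutoff function, with the product rule. -/
def cutoff {χ : E d → ℝ} (hχ : ContDiff ℝ ∞ χ) (hc : HasCompactSupport χ) :
    H1Ambient Ω →L[ℂ] H1Ambient Ω :=
  (WithLp.prodContinuousLinearEquiv 2 ℂ _ _).symm.toContinuousLinearMap ∘L
    ((mulL2 hχ.continuous hc ∘L WithLp.fstL 2 ℂ _ _).prod
      ((PiLp.continuousLinearEquiv 2 ℂ (fun _ : Fin d => L2 Ω)).symm.toContinuousLinearMap ∘L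
        ContinuousLinearMap.pi fun i =>
          mulL2 hχ.continuous hc ∘L PiLp.proj 2 (fun _ : Fin d => L2 Ω) i ∘L WithLp.sndL 2 ℂ _ _ +
          mulL2 (continuous_partialDeriv hχ i) (hasCompactSupport_partialDeriv hc i) ∘L
            WithLp.fstL 2 ℂ _ _))

variable {χ : E d → ℝ}

theorem cutoff_fst (hχ : ContDiff ℝ ∞ χ) (hc : HasCompactSupport χ) (p : H1Ambient Ω) :
    (cutoff hχ hc p).fst = mulL2 hχ.continuous hc p.fst := rfl

theorem cutoff_snd (hχ : ContDiff ℝ ∞ χ) (hc : HasCompactSupport χ) (p : H1Ambient Ω) (i : Fin d) :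
    (cutoff hχ hc p).snd i = mulL2 hχ.continuous hc (p.snd i) +
      mulL2 (continuous_partialDeriv hχ i) (hasCompactSupport_partialDeriv hc i) p.fst := rfl

theorem memLp_indicator (hΩ : IsOpen Ω) (f : L2 Ω) : MemLp (Ω.indicator f) 2 volume :=
  (memLp_indicator_iff_restrict hΩ.measurableSet).mpr (Lp.memLp f)

theorem locallyIntegrable_indicator (hΩ : IsOpen Ω) (f : L2 Ω) :
    LocallyIntegrable (Ω.indicator f) volume :=
  (memLp_indicator hΩ f).locallyIntegrable (by norm_num)

theorem mollify_indicator (hΩ : IsOpen Ω) (φ : ContDiffBump (0 : E d)) (τ : E d) (f : E d → ℂ)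
    (x : E d) :
    mollify φ τ (Ω.indicator f) x = ∫ y in Ω, φ.normed volume (x + τ - y) • f y := by
  rw [mollify_eq, ← integral_indicator hΩ.measurableSet]
  congr 1; ext y
  by_cases hy : y ∈ Ω <;> simp [hy]

/-- Inside `Ω`, the gradient of the translated mollification of `χ u` is the translated
mollification of the weak gradient, provided the translation moves `supp χ` into `Ω`. -/
theorem fderiv_mollify_cutoff (hΩ : IsOpen Ω) (hχ : ContDiff ℝ ∞ χ) (hc : HasCompactSupport χ)
    (φ : ContDiffBump (0 : E d)) (τ : E d) (u : H1 Ω) {x : E d}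
    (hgeo : ∀ y ∈ tsupport χ, y ∈ Metric.closedBall (x + τ) φ.rOut → y ∈ Ω) (i : Fin d) :
    fderiv ℝ (mollify φ τ (Ω.indicator (cutoff hχ hc u.1).fst)) x (EuclideanSpace.single i 1) =
      mollify φ τ (Ω.indicator ((cutoff hχ hc u.1).snd i)) x := by
  rw [fderiv_mollify (locallyIntegrable_indicator hΩ _), mollify_indicator hΩ]
  set ρ := φ.normed volume with hρ
  have hρs : ContDiff ℝ ∞ ρ := φ.contDiff_normed
  have hsm : ContDiff ℝ ∞ fun y => ρ (x + τ - y) := hρs.comp (contDiff_const.sub contDiff_id)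
  -- The weak derivative of u is tested with kernel times cutoff. By `hgeo` the support of this
  -- product lies in Ω, even when x is close to the boundary.
  set ψ : E d → ℝ := fun y => ρ (x + τ - y) * χ y with hψ
  have hψt : IsTestFunction Ω ψ := by
    refine ⟨hsm.mul hχ, hc.mul_left, fun y hy => ?_⟩
    refine hgeo y (tsupport_mul_subset_right hy) ?_
    have h1 : y ∈ tsupport fun y => ρ (x + τ - y) := tsupport_mul_subset_left hy
    have h2 : (Function.support fun y => ρ (x + τ - y)) ⊆ Metric.closedBall (x + τ) φ.rOut := by
      intro z hz
      have : x + τ - z ∈ Function.support ρ := hz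
      rw [hρ, φ.support_normed_eq, Metric.mem_ball, dist_zero_right] at this
      rw [Metric.mem_closedBall, dist_comm, dist_eq_norm]
      exact this.le
    exact closure_minimal h2 Metric.isClosed_closedBall h1
  have hpd : ∀ y, partialDeriv i ψ y =
      -(fderiv ℝ ρ (x + τ - y) (EuclideanSpace.single i 1)) * χ y
        + ρ (x + τ - y) * partialDeriv i χ y := by
    intro y
    have d1 : HasFDerivAt (fun y => ρ (x + τ - y))
        (-(fderiv ℝ ρ (x + τ - y))) y := by
      have a := (hρs.differentiable (by simp) (x + τ - y)).hasFDerivAt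
      have b : HasFDerivAt (fun y : E d => x + τ - y) (-(ContinuousLinearMap.id ℝ (E d))) y :=
        (hasFDerivAt_id y).const_sub (x + τ)
      have := a.comp y b
      rw [ContinuousLinearMap.comp_neg, ContinuousLinearMap.comp_id] at this
      exact this
    have d2 := (hχ.differentiable (by simp) y).hasFDerivAt
    have := (d1.mul d2).fderiv
    unfold partialDeriv
    rw [hψ]
    rw [show (fun y => ρ (x + τ - y) * χ y) = (fun y => ρ (x + τ - y)) * χ from rfl, this]
    simp [mul_comm]
    ring
  have hw := u.2 i ψ hψt
  change ∫ y in Ω, partialDeriv i ψ y • toL2 u y = -∫ y in Ω, ψ y • grad u i y at hw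
  have cont1 : Continuous fun y => ρ (x + τ - y) * partialDeriv i χ y :=
    hsm.continuous.mul (continuous_partialDeriv hχ i)
  have cont2 : Continuous fun y => fderiv ℝ ρ (x + τ - y) (EuclideanSpace.single i 1) * χ y := by
    have : Continuous fun y => fderiv ℝ ρ (x + τ - y) :=
      (hρs.continuous_fderiv (by simp)).comp (by fun_prop)
    exact (this.clm_apply continuous_const).mul hχ.continuous
  have int1 := integrable_smul_L2 cont1 (hasCompactSupport_partialDeriv hc i).mul_left (toL2 u)
  have int2 := integrable_smul_L2 cont2 hc.mul_left (toL2 u)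
  have int3 := hψt.integrable_smul (grad u i)
  have hw2 : ∫ y in Ω, partialDeriv i ψ y • toL2 u y =
      (∫ y in Ω, (ρ (x + τ - y) * partialDeriv i χ y) • toL2 u y) -
        ∫ y in Ω, (fderiv ℝ ρ (x + τ - y) (EuclideanSpace.single i 1) * χ y) • toL2 u y := by
    rw [← integral_sub int1 int2]
    congr 1; ext y
    rw [hpd, ← sub_smul]
    congr 1; ring
  have lhs : ∫ y, fderiv ℝ ρ (x + τ - y) (EuclideanSpace.single i 1) •
      Ω.indicator (cutoff hχ hc u.1).fst y =
      ∫ y in Ω, (fderiv ℝ ρ (x + τ - y) (EuclideanSpace.single i 1) * χ y) • toL2 u y := by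
    rw [← setIntegral_eq_integral_of_forall_compl_eq_zero (s := Ω)
      (f := fun y => fderiv ℝ ρ (x + τ - y) (EuclideanSpace.single i 1) •
        Ω.indicator (cutoff hχ hc u.1).fst y) (fun y hy => by simp [hy])]
    refine integral_congr_ae ?_
    filter_upwards [coeFn_mulL2 hχ.continuous hc (toL2 u),
      ae_restrict_mem hΩ.measurableSet] with y hy hyΩ
    rw [indicator_of_mem hyΩ, cutoff_fst, mul_smul]
    congr 1
  have rhs : ∫ y in Ω, ρ (x + τ - y) • ((cutoff hχ hc u.1).snd i) y =
      (∫ y in Ω, ψ y • grad u i y) +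
        ∫ y in Ω, (ρ (x + τ - y) * partialDeriv i χ y) • toL2 u y := by
    rw [← integral_add int3 int1]
    refine integral_congr_ae ?_
    rw [cutoff_snd]
    filter_upwards [Lp.coeFn_add (mulL2 hχ.continuous hc (u.1.snd i))
      (mulL2 (continuous_partialDeriv hχ i) (hasCompactSupport_partialDeriv hc i) u.1.fst),
      coeFn_mulL2 hχ.continuous hc (u.1.snd i),
      coeFn_mulL2 (continuous_partialDeriv hχ i) (hasCompactSupport_partialDeriv hc i) u.1.fst]
      with y h1 h2 h3
    rw [h1, Pi.add_apply, h2, h3, smul_add, smul_smul, smul_smul]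
    rfl
  rw [lhs, rhs]
  rw [hw2] at hw
  linear_combination (-1 : ℂ) * hw

variable {φs : ℕ → ContDiffBump (0 : E d)} {τs : ℕ → E d}

theorem tendsto_L2_of_mollify (hΩ : IsOpen Ω) (hφ : Tendsto (fun n => (φs n).rOut) atTop (𝓝 0))
    (hτ : Tendsto τs atTop (𝓝 0)) {f : L2 Ω} {v : ℕ → L2 Ω}
    (hv : ∀ n, v n =ᵐ[volume.restrict Ω] mollify (φs n) (τs n) (Ω.indicator f)) :
    Tendsto v atTop (𝓝 f) := by
  rw [Lp.tendsto_Lp_iff_tendsto_eLpNorm']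
  refine tendsto_of_tendsto_of_tendsto_of_le_of_le tendsto_const_nhds
    (tendsto_eLpNorm_mollify_sub hφ hτ (memLp_indicator hΩ f)) (fun _ => zero_le) fun n => ?_
  calc eLpNorm (⇑(v n) - ⇑f) 2 (volume.restrict Ω)
      = eLpNorm (mollify (φs n) (τs n) (Ω.indicator f) - Ω.indicator f) 2 (volume.restrict Ω) := by
        refine eLpNorm_congr_ae ?_
        filter_upwards [hv n, ae_restrict_mem hΩ.measurableSet] with x h1 h2
        simp [h1, h2]
    _ ≤ _ := eLpNorm_mono_measure _ Measure.restrict_le_self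

/-- Smooth approximation of the localization `χ u` of `u ∈ H¹(Ω)`. -/
theorem exists_local_approx (hΩ : IsOpen Ω) (hb : Bornology.IsBounded Ω)
    (hχ : ContDiff ℝ ∞ χ) (hc : HasCompactSupport χ)
    (hφ : Tendsto (fun n => (φs n).rOut) atTop (𝓝 0)) (hτ : Tendsto τs atTop (𝓝 0))
    (hgeo : ∀ n, ∀ x ∈ closure Ω, ∀ y ∈ tsupport χ,
      y ∈ Metric.closedBall (x + τs n) (φs n).rOut → y ∈ Ω) (u : H1 Ω) :
    ∃ v : ℕ → H1 Ω,
      (∀ n, toL2 (v n) =ᵐ[volume.restrict Ω]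
        mollify (φs n) (τs n) (Ω.indicator (cutoff hχ hc u.1).fst)) ∧
      (∀ n i, grad (v n) i =ᵐ[volume.restrict Ω] fun x =>
        fderiv ℝ (mollify (φs n) (τs n) (Ω.indicator (cutoff hχ hc u.1).fst)) x
          (EuclideanSpace.single i 1)) ∧
      Tendsto (fun n => (v n).1) atTop (𝓝 (cutoff hχ hc u.1)) := by
  have hsm : ∀ n, ContDiff ℝ 1 (mollify (φs n) (τs n) (Ω.indicator (cutoff hχ hc u.1).fst)) :=
    fun n => (contDiff_mollify (locallyIntegrable_indicator hΩ _)).of_le (by simp)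
  choose v hv1 hv2 using fun n => exists_H1_of_contDiff hb (hsm n)
  refine ⟨v, hv1, hv2, tendsto_ambient (tendsto_L2_of_mollify hΩ hφ hτ hv1) fun i => ?_⟩
  refine tendsto_L2_of_mollify hΩ hφ hτ fun n => ?_
  filter_upwards [hv2 n i, ae_restrict_mem hΩ.measurableSet] with x h1 h2
  rw [← fderiv_mollify_cutoff hΩ hχ hc (φs n) (τs n) u (hgeo n x (subset_closure h2)) i, ← h1]
  rfl

end Cutoff

/-! ### Lipschitz graphs over a hyperplane. -/

section Graph

/-- The hyperplane orthogonal to `e`. -/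
abbrev hyperplane (e : E d) : Submodule ℝ (E d) := (Submodule.span ℝ {e})ᗮ

/-- The orthogonal projection onto the hyperplane orthogonal to `e`. -/
abbrev hproj (e : E d) : E d →L[ℝ] hyperplane e :=
  (Submodule.span ℝ {e})ᗮ.orthogonalProjectionOnto

variable {e : E d}

theorem inner_hyperplane (z : hyperplane e) : inner ℝ e (z : E d) = 0 :=
  (Submodule.mem_orthogonal_singleton_iff_inner_right).mp z.2

theorem hproj_smul (s : ℝ) : hproj e (s • e) = 0 := by
  rw [map_smul, Submodule.orthogonalProjectionOnto_orthogonalComplement_singleton_eq_zero,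
    smul_zero]

theorem hproj_coe (z : hyperplane e) : hproj e (z : E d) = z :=
  Submodule.orthogonalProjectionOnto_mem_subspace_eq_self z

theorem hproj_add_smul (z : E d) (s : ℝ) : hproj e (z + s • e) = hproj e z := by
  rw [map_add, hproj_smul, add_zero]

theorem hproj_add_inner (he : ‖e‖ = 1) (y : E d) :
    (hproj e y : E d) + (inner ℝ e y : ℝ) • e = y := by
  have hmem : y - (inner ℝ e y : ℝ) • e ∈ hyperplane e := by
    rw [Submodule.mem_orthogonal_singleton_iff_inner_right, inner_sub_right, inner_smul_right,
      real_inner_self_eq_norm_sq, he]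
    simp
  have h1 : hproj e y = ⟨y - (inner ℝ e y : ℝ) • e, hmem⟩ := by
    rw [← hproj_coe ⟨y - (inner ℝ e y : ℝ) • e, hmem⟩]
    simp only [map_sub, hproj_smul, sub_zero]
  rw [h1]
  simp

theorem norm_hproj_le (y : E d) : ‖hproj e y‖ ≤ ‖y‖ :=
  Submodule.norm_orthogonalProjectionOnto_apply_le _ _

theorem inner_add_smul (he : ‖e‖ = 1) (y : E d) (s : ℝ) :
    inner ℝ e (y + s • e) = (inner ℝ e y : ℝ) + s := by
  rw [inner_add_right, inner_smul_right, real_inner_self_eq_norm_sq, he]; simp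

/-- The splitting of space into a hyperplane and its normal direction. -/
def hyperplaneEquiv (he : ‖e‖ = 1) : (hyperplane e × ℝ) ≃L[ℝ] E d where
  toFun p := (p.1 : E d) + p.2 • e
  map_add' p q := by
    simp only [Prod.fst_add, Prod.snd_add, Submodule.coe_add, add_smul]; abel
  map_smul' c p := by
    simp [smul_add, mul_smul]
  invFun y := (hproj e y, inner ℝ e y)
  left_inv p := by
    ext1
    · simp only [hproj_add_smul, hproj_coe]
    · simp only [inner_add_smul he, inner_hyperplane, zero_add]
  right_inv y := hproj_add_inner he y
  continuous_toFun := by fun_prop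
  continuous_invFun := by fun_prop

/-- Fubini in the direction `e`, up to a constant. -/
theorem exists_lintegral_lintegral_le (he : ‖e‖ = 1) (ν : Measure (hyperplane e))
    [ν.IsAddHaarMeasure] :
    ∃ C : ℝ≥0, ∀ F : E d → ℝ≥0∞, Measurable F →
      ∫⁻ z, (∫⁻ s : ℝ, F ((z : E d) + s • e)) ∂ν ≤ C * ∫⁻ y, F y := by
  let T := hyperplaneEquiv he
  -- The image of the product measure is again a Haar measure, hence a multiple of Lebesgue measure;
  -- the factor is the constant C.
  have hm : (Measure.map T (ν.prod volume)).IsAddHaarMeasure :=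
    T.isAddHaarMeasure_map _
  refine ⟨Measure.addHaarScalarFactor (Measure.map T (ν.prod volume)) volume, fun F hF => ?_⟩
  have h1 : ∫⁻ z, (∫⁻ s : ℝ, F ((z : E d) + s • e)) ∂ν =
      ∫⁻ y, F y ∂(Measure.map T (ν.prod volume)) := by
    rw [lintegral_map hF T.continuous.measurable]
    exact (lintegral_prod (fun a => F (T a))
      (hF.comp T.continuous.measurable).aemeasurable).symm
  rw [h1]
  conv_lhs => rw [Measure.isAddLeftInvariant_eq_smul (Measure.map T (ν.prod volume)) volume]
  rw [lintegral_smul_measure]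
  rfl

theorem finrank_hyperplane (he : ‖e‖ = 1) : Module.finrank ℝ (hyperplane e) = d - 1 := by
  have h1 := Submodule.finrank_add_finrank_orthogonal (Submodule.span ℝ {e})
  have hne : e ≠ 0 := by rintro rfl; simp at he
  rw [finrank_span_singleton hne, finrank_euclideanSpace_fin] at h1
  change 1 + Module.finrank ℝ (hyperplane e) = d at h1
  omega

/-- Parametrization of the graph of `g`. -/
def graphMap (g : hyperplane e → ℝ) (z : hyperplane e) : E d := (z : E d) + g z • e

theorem lipschitzWith_graphMap (he : ‖e‖ = 1) {K : ℝ≥0} {g : hyperplane e → ℝ}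
    (hg : LipschitzWith K g) : LipschitzWith (1 + K) (graphMap g) := by
  have h1 : LipschitzWith 1 (fun z : hyperplane e => (z : E d)) := LipschitzWith.subtype_val _
  have h2 : LipschitzWith K fun z : hyperplane e => g z • e := by
    refine LipschitzWith.of_dist_le_mul fun z z' => ?_
    rw [dist_eq_norm, ← sub_smul, norm_smul, he, mul_one, ← dist_eq_norm]
    exact hg.dist_le_mul z z'
  exact h1.add h2

/-- The surface measure on a piece of a Lipschitz graph is controlled by the Haar measure of the
parameter space. -/
theorem hausdorff_restrict_graph_le (he : ‖e‖ = 1) {K : ℝ≥0} {g : hyperplane e → ℝ}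
    (hg : LipschitzWith K g) {A : Set (E d)}
    (hAg : ∀ x ∈ A, graphMap g (hproj e x) = x) :
    (Measure.euclideanHausdorffMeasure (d - 1) : Measure (E d)).restrict A ≤
      ((1 + K) ^ (d - 1) : ℝ≥0) • Measure.map (graphMap g)
        (Measure.euclideanHausdorffMeasure (d - 1) : Measure (hyperplane e)) := by
  have hL := lipschitzWith_graphMap he hg
  refine Measure.le_iff.mpr fun B hB => ?_
  rw [Measure.restrict_apply hB, Measure.smul_apply, Measure.map_apply hL.continuous.measurable hB]
  -- The piece of graph is contained in a Lipschitz image of its parameters, and a (1 + K)-Lipschitz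
  -- map increases (d - 1)-dimensional Hausdorff measure by at most (1 + K)^(d - 1).
  have h1 : B ∩ A ⊆ graphMap g '' (graphMap g ⁻¹' B) := by
    rintro x ⟨hxB, hxA⟩
    exact ⟨hproj e x, by rw [mem_preimage, hAg x hxA]; exact hxB, hAg x hxA⟩
  have h2 := (hL.lipschitzOnWith (s := graphMap g ⁻¹' B)).hausdorffMeasure_image_le
    (d := ((d - 1 : ℕ) : ℝ)) (Nat.cast_nonneg _)
  rw [Measure.euclideanHausdorffMeasure_def, Measure.euclideanHausdorffMeasure_def,
    Measure.smul_apply, Measure.smul_apply, smul_comm]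
  refine smul_le_smul_of_nonneg_left ?_ zero_le
  refine (measure_mono h1).trans (h2.trans (le_of_eq ?_))
  rw [ENNReal.rpow_natCast]
  simp [ENNReal.smul_def]

end Graph

/-! ### The trace inequality in one chart. -/

section Chart

/-- Integrate the derivative of |W|² along the ray, at whose far end W vanishes, and use 2|ab| ≤ a²
+ b². -/
theorem enorm_sq_le_lintegral_ray {W : E d → ℂ} (hW : ContDiff ℝ 1 W) {x e : E d} {R : ℝ}
    (hR : 0 ≤ R) (hend : W (x + R • e) = 0) :
    ‖W x‖ₑ ^ 2 ≤ ∫⁻ s in Ioc 0 R,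
      (‖W (x + s • e)‖ₑ ^ 2 + ‖fderiv ℝ W (x + s • e) e‖ₑ ^ 2) := by
  set γ : ℝ → E d := fun s => x + s • e with hγ
  have hγd : ∀ s, HasDerivAt γ e s := fun s => by
    have := ((hasDerivAt_id s).smul_const e).const_add x
    rw [one_smul] at this
    exact this
  have hγc : Continuous γ := by fun_prop
  have hWd : ∀ s, HasDerivAt (fun s => W (γ s)) (fderiv ℝ W (γ s) e) s := fun s =>
    ((hW.differentiable one_ne_zero) (γ s)).hasFDerivAt.comp_hasDerivAt s (hγd s)
  have hd : ∀ s, HasDerivAt (fun s => ‖W (γ s)‖ ^ 2)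
      (2 * inner ℝ (W (γ s)) (fderiv ℝ W (γ s) e)) s := fun s => (hWd s).norm_sq
  have hc1 : Continuous fun s => W (γ s) := hW.continuous.comp hγc
  have hc2 : Continuous fun s => fderiv ℝ W (γ s) e :=
    ((hW.continuous_fderiv one_ne_zero).comp hγc).clm_apply continuous_const
  have hcd : Continuous fun s => 2 * inner ℝ (W (γ s)) (fderiv ℝ W (γ s) e) :=
    continuous_const.mul (hc1.inner hc2)
  have hftc := intervalIntegral.integral_eq_sub_of_hasDerivAt (a := 0) (b := R)
    (fun s _ => hd s) (hcd.intervalIntegrable 0 R)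
  have h0 : γ 0 = x := by simp [hγ]
  rw [h0, show W (γ R) = 0 from hend] at hftc
  have hle : ‖W x‖ ^ 2 ≤ ∫ s in Ioc 0 R, (‖W (γ s)‖ ^ 2 + ‖fderiv ℝ W (γ s) e‖ ^ 2) := by
    have e1 : ‖W x‖ ^ 2 = ∫ s in (0 : ℝ)..R, -(2 * inner ℝ (W (γ s)) (fderiv ℝ W (γ s) e)) := by
      rw [intervalIntegral.integral_neg, hftc]; simp
    rw [e1, ← intervalIntegral.integral_of_le hR]
    refine intervalIntegral.integral_mono_on hR (hcd.neg.intervalIntegrable 0 R)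
      (((hc1.norm.pow 2).add (hc2.norm.pow 2)).intervalIntegrable 0 R) fun s _ => ?_
    have h1 := abs_real_inner_le_norm (W (γ s)) (fderiv ℝ W (γ s) e)
    have h2 := neg_abs_le (inner ℝ (W (γ s)) (fderiv ℝ W (γ s) e))
    nlinarith [sq_nonneg (‖W (γ s)‖ - ‖fderiv ℝ W (γ s) e‖)]
  have hint : IntegrableOn (fun s => ‖W (γ s)‖ ^ 2 + ‖fderiv ℝ W (γ s) e‖ ^ 2) (Ioc 0 R) :=
    (((hc1.norm.pow 2).add (hc2.norm.pow 2)).integrableOn_Icc (a := 0) (b := R)).mono_set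
      Ioc_subset_Icc_self
  have hen : ∀ a : ℂ, ‖a‖ₑ ^ 2 = ENNReal.ofReal (‖a‖ ^ 2) := fun a => by
    rw [ENNReal.ofReal_pow (norm_nonneg a), ofReal_norm]
  rw [hen]
  refine (ENNReal.ofReal_le_ofReal hle).trans ?_
  rw [ofReal_integral_eq_lintegral_ofReal hint (Eventually.of_forall fun s => by positivity)]
  refine lintegral_mono fun s => ?_
  rw [hen, hen, ← ENNReal.ofReal_add (by positivity) (by positivity)]

variable {U : Set (E d)} {e : E d} {K : ℝ≥0} {g : hyperplane e → ℝ}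

theorem chart_le (hU : IsOpen U) (hg : LipschitzWith K g)
    (hΩU : Ω ∩ U = {y ∈ U | g (hproj e y) < inner ℝ e y}) {y : E d} (hy : y ∈ closure Ω)
    (hyU : y ∈ U) : g (hproj e y) ≤ inner ℝ e y := by
  have h1 : y ∈ closure (Ω ∩ U) := by
    rw [inter_comm]
    exact hU.inter_closure ⟨hyU, hy⟩
  have hcl : IsClosed {y : E d | g (hproj e y) ≤ inner ℝ e y} :=
    isClosed_le (hg.continuous.comp (hproj e).continuous) (by fun_prop)
  refine closure_minimal ?_ hcl h1
  rw [hΩU]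
  intro z hz
  exact le_of_lt (show g (hproj e z) < inner ℝ e z from hz.2)

theorem chart_eq (hΩ : IsOpen Ω) (hU : IsOpen U) (hg : LipschitzWith K g)
    (hΩU : Ω ∩ U = {y ∈ U | g (hproj e y) < inner ℝ e y}) {y : E d} (hy : y ∈ frontier Ω)
    (hyU : y ∈ U) : g (hproj e y) = inner ℝ e y := by
  refine le_antisymm (chart_le hU hg hΩU hy.1 hyU) ?_
  by_contra hlt
  have : y ∈ Ω ∩ U := by
    rw [hΩU]; exact ⟨hyU, not_le.mp hlt⟩
  rw [hΩ.frontier_eq] at hy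
  exact hy.2 this.1

/-- The shift by t e raises the height over the hyperplane by t, while an error ε lowers the height
by at most ε and raises g by at most Kε. -/
theorem chart_shift (hU : IsOpen U) (he : ‖e‖ = 1) (hg : LipschitzWith K g)
    (hΩU : Ω ∩ U = {y ∈ U | g (hproj e y) < inner ℝ e y}) {x y : E d} {t ε : ℝ}
    (hε : (1 + K) * ε < t) (hx : x ∈ closure Ω) (hxU : x ∈ U) (hyU : y ∈ U)
    (hxy : y ∈ Metric.closedBall (x + t • e) ε) : y ∈ Ω := by
  have hle := chart_le hU hg hΩU hx hxU
  rw [mem_closedBall_iff_norm] at hxy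
  have h1 : g (hproj e y) ≤ g (hproj e x) + K * ε := by
    have h2 := hg.dist_le_mul (hproj e y) (hproj e x)
    have h3 : dist (hproj e y) (hproj e x) ≤ ε := by
      rw [← hproj_add_smul x t, dist_eq_norm, ← map_sub]
      exact (norm_hproj_le _).trans hxy
    rw [Real.dist_eq] at h2
    have h4 := le_abs_self (g (hproj e y) - g (hproj e x))
    have h5 : (K : ℝ) * dist (hproj e y) (hproj e x) ≤ K * ε := by gcongr
    linarith
  have h2 : inner ℝ e x + t - ε ≤ inner ℝ e y := by
    have h3 : (inner ℝ e y : ℝ) = inner ℝ e (x + t • e) + inner ℝ e (y - (x + t • e)) := by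
      rw [← inner_add_right]; congr 1; abel
    rw [h3, inner_add_smul he]
    have h4 := abs_real_inner_le_norm e (y - (x + t • e))
    rw [he, one_mul] at h4
    have := neg_abs_le (inner ℝ e (y - (x + t • e)))
    linarith
  have : y ∈ Ω ∩ U := by
    rw [hΩU]
    refine ⟨hyU, ?_⟩
    linarith
  exact this.1

theorem sum_enorm_sq_le {W : E d → ℂ} {x : E d} (he : ‖e‖ = 1) :
    ‖fderiv ℝ W x e‖ₑ ^ 2 ≤ d * ∑ i, ‖fderiv ℝ W x (EuclideanSpace.single i 1)‖ₑ ^ 2 := by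
  have h1 : ‖fderiv ℝ W x e‖ₑ ≤ ∑ i, ‖fderiv ℝ W x (EuclideanSpace.single i 1)‖ₑ := by
    have h2 : e = ∑ i, e i • EuclideanSpace.single i (1 : ℝ) := by
      ext j
      simp [Finset.sum_apply, Pi.single_apply]
    conv_lhs => rw [h2, map_sum]
    refine (enorm_sum_le _ _).trans (Finset.sum_le_sum fun i _ => ?_)
    rw [map_smul, enorm_smul]
    refine mul_le_of_le_one_left zero_le ?_
    rw [← enorm_norm, ← ofReal_norm, norm_norm]
    refine ENNReal.ofReal_le_one.mpr ?_
    exact (PiLp.norm_apply_le e i).trans he.le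
  calc _ ≤ (∑ i, ‖fderiv ℝ W x (EuclideanSpace.single i 1)‖ₑ) ^ 2 := by gcongr
    _ ≤ _ := by
      have := sq_sum_le_card_mul_sum_sq (s := Finset.univ)
        (f := fun i : Fin d => ‖fderiv ℝ W x (EuclideanSpace.single i 1)‖)
      have h3 : (∑ i, ‖fderiv ℝ W x (EuclideanSpace.single i 1)‖₊) ^ 2 ≤
          d * ∑ i, ‖fderiv ℝ W x (EuclideanSpace.single i 1)‖₊ ^ 2 := by
        rw [← NNReal.coe_le_coe]
        push_cast
        simpa using this
      simp only [enorm_eq_nnnorm]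
      exact_mod_cast h3

/-- The trace inequality for smooth functions supported in a chart. -/
theorem exists_chart_trace_le (hΩ : IsOpen Ω) (hU : IsOpen U) (he : ‖e‖ = 1)
    (hg : LipschitzWith K g) (hΩU : Ω ∩ U = {y ∈ U | g (hproj e y) < inner ℝ e y}) {x₀ : E d}
    {R : ℝ} (hR : 0 < R) (hRU : Metric.ball x₀ (4 * R) ⊆ U) :
    surfaceMeasure Ω (Metric.ball x₀ R) < ⊤ ∧
    ∃ C : ℝ≥0, ∀ W : E d → ℂ, ContDiff ℝ 1 W → (∀ x ∉ Metric.ball x₀ R, W x = 0) →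
      ∫⁻ x, ‖W x‖ₑ ^ 2 ∂(surfaceMeasure Ω) ≤
        C * ∫⁻ x in Ω, (‖W x‖ₑ ^ 2 + ∑ i, ‖fderiv ℝ W x (EuclideanSpace.single i 1)‖ₑ ^ 2) := by
  set A := frontier Ω ∩ Metric.ball x₀ R with hA
  have hAm : MeasurableSet A :=
    isClosed_frontier.measurableSet.inter Metric.isOpen_ball.measurableSet
  have hRR : Metric.ball x₀ R ⊆ U := (Metric.ball_subset_ball (by linarith)).trans hRU
  have hAg : ∀ x ∈ A, graphMap g (hproj e x) = x := by
    intro x hx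
    rw [graphMap, chart_eq hΩ hU hg hΩU hx.1 (hRR hx.2)]
    exact hproj_add_inner he x
  set ν : Measure (hyperplane e) := Measure.euclideanHausdorffMeasure (d - 1) with hν
  have hνh : ν.IsAddHaarMeasure := by
    rw [hν, ← finrank_hyperplane he]; infer_instance
  have hσ := hausdorff_restrict_graph_le he hg hAg
  have hrestr : (surfaceMeasure Ω).restrict (Metric.ball x₀ R) =
      (Measure.euclideanHausdorffMeasure (d - 1)).restrict A := by
    rw [surfaceMeasure, Measure.restrict_restrict Metric.isOpen_ball.measurableSet, inter_comm]
  have hΦm : Measurable (graphMap g) := (lipschitzWith_graphMap he hg).continuous.measurable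
  obtain ⟨C, hC⟩ := exists_lintegral_lintegral_le he ν
  refine ⟨?_, (1 + K) ^ (d - 1) * C * (1 + d), fun W hW hW0 => ?_⟩
  · rw [← Measure.restrict_apply_univ, hrestr]
    have hbd : ν (graphMap g ⁻¹' A) < ⊤ := by
      have hsub : graphMap g ⁻¹' A ⊆ Metric.closedBall 0 (‖x₀‖ + R) := by
        intro z hz
        have h1 : z = hproj e (graphMap g z) := by
          rw [graphMap, hproj_add_smul, hproj_coe]
        rw [mem_closedBall_zero_iff, h1]
        refine (norm_hproj_le _).trans ?_
        have h2 := hz.2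
        rw [mem_ball_iff_norm] at h2
        have h3 := norm_add_le x₀ (graphMap g z - x₀)
        rw [add_sub_cancel] at h3
        linarith
      exact (measure_mono hsub).trans_lt measure_closedBall_lt_top
    have h2 := hσ A
    rw [Measure.restrict_apply_self, Measure.smul_apply, Measure.map_apply hΦm hAm] at h2
    rw [Measure.restrict_apply_univ]
    refine h2.trans_lt ?_
    exact ENNReal.mul_lt_top ENNReal.coe_lt_top hbd
  · set F : E d → ℝ≥0∞ := Ω.indicator fun y => ‖W y‖ₑ ^ 2 + ‖fderiv ℝ W y e‖ₑ ^ 2 with hF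
    have hFm : Measurable F := by
      refine Measurable.indicator ?_ hΩ.measurableSet
      have c1 : Continuous fun y => fderiv ℝ W y e :=
        (hW.continuous_fderiv one_ne_zero).clm_apply continuous_const
      exact (hW.continuous.measurable.enorm.pow_const 2).add (c1.measurable.enorm.pow_const 2)
    have hWm : Measurable fun x => ‖W x‖ₑ ^ 2 := hW.continuous.measurable.enorm.pow_const 2
    have hpt : ∀ x ∈ A, ‖W x‖ₑ ^ 2 ≤ ∫⁻ s : ℝ, F ((hproj e x : E d) + s • e) := by
      intro x hx
      have hxB := hx.2
      rw [mem_ball_iff_norm] at hxB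
      -- A ray of length 2R starting in the ball of radius R has left that ball. All its points stay
      -- within 3R of x₀, hence inside the chart.
      have hend : W (x + (2 * R) • e) = 0 := by
        refine hW0 _ fun hmem => ?_
        rw [mem_ball_iff_norm] at hmem
        have h1 : ‖(2 * R) • e‖ ≤ ‖x + (2 * R) • e - x₀‖ + ‖x - x₀‖ := by
          have := norm_sub_le (x + (2 * R) • e - x₀) (x - x₀)
          refine le_trans (le_of_eq ?_) this
          congr 1; abel
        rw [norm_smul, he, mul_one, Real.norm_of_nonneg (by linarith)] at h1
        linarith
      refine (enorm_sq_le_lintegral_ray hW (by linarith) hend).trans ?_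
      have hshift : ∫⁻ s : ℝ, F ((hproj e x : E d) + s • e) = ∫⁻ s : ℝ, F (x + s • e) := by
        rw [← lintegral_add_left_eq_self (fun s : ℝ => F ((hproj e x : E d) + s • e))
          (inner ℝ e x : ℝ)]
        congr 1; ext s
        rw [add_smul, ← add_assoc, hproj_add_inner he]
      rw [hshift]
      refine le_trans ?_ (setLIntegral_le_lintegral (Ioc 0 (2 * R)) _)
      refine setLIntegral_mono' measurableSet_Ioc fun s hs => ?_
      have hmem : x + s • e ∈ Ω := by
        have hb : x + s • e ∈ U := by
          refine hRU ?_
          rw [mem_ball_iff_norm, add_sub_right_comm]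
          refine (norm_add_le _ _).trans_lt ?_
          rw [norm_smul, he, mul_one, Real.norm_of_nonneg hs.1.le]
          linarith [hs.2]
        refine chart_shift hU he hg hΩU (t := s) (ε := 0) (by simpa using hs.1) hx.1.1
          (hRR hx.2) hb ?_
        simp
      rw [hF, indicator_of_mem hmem]
    have hstep : ∫⁻ x, ‖W x‖ₑ ^ 2 ∂(surfaceMeasure Ω) ≤
        ((1 + K) ^ (d - 1) : ℝ≥0) * ∫⁻ z, (∫⁻ s : ℝ, F ((z : E d) + s • e)) ∂ν := by
      have e1 : ∫⁻ x, ‖W x‖ₑ ^ 2 ∂(surfaceMeasure Ω) =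
          ∫⁻ x, A.indicator (fun x => ‖W x‖ₑ ^ 2) x
            ∂((Measure.euclideanHausdorffMeasure (d - 1) : Measure (E d)).restrict A) := by
        rw [← hrestr, ← lintegral_indicator Metric.isOpen_ball.measurableSet]
        refine lintegral_congr_ae ?_
        have hfr : ∀ᵐ x ∂(surfaceMeasure Ω), x ∈ frontier Ω :=
          ae_restrict_mem isClosed_frontier.measurableSet
        filter_upwards [hfr] with x hx
        by_cases hxb : x ∈ Metric.ball x₀ R
        · rw [indicator_of_mem hxb, indicator_of_mem (show x ∈ A from ⟨hx, hxb⟩)]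
        · rw [indicator_of_notMem hxb, hW0 x hxb]; simp
      rw [e1]
      refine (lintegral_mono' hσ le_rfl).trans ?_
      rw [lintegral_smul_measure, lintegral_map (hWm.indicator hAm) hΦm, ENNReal.smul_def,
        smul_eq_mul]
      gcongr with z
      by_cases hz : graphMap g z ∈ A
      · rw [indicator_of_mem hz]
        have := hpt _ hz
        rwa [graphMap, hproj_add_smul, hproj_coe] at this
      · rw [indicator_of_notMem hz]; exact zero_le
    refine hstep.trans ?_
    calc _ ≤ ((1 + K) ^ (d - 1) : ℝ≥0) * (C * ∫⁻ y, F y) := by gcongr; exact hC F hFm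
      _ = ((1 + K) ^ (d - 1) * C : ℝ≥0) * ∫⁻ y in Ω, (‖W y‖ₑ ^ 2 + ‖fderiv ℝ W y e‖ₑ ^ 2) := by
          rw [hF, lintegral_indicator hΩ.measurableSet]; push_cast; ring
      _ ≤ ((1 + K) ^ (d - 1) * C : ℝ≥0) * ∫⁻ y in Ω, (1 + d : ℝ≥0) * (‖W y‖ₑ ^ 2 +
          ∑ i, ‖fderiv ℝ W y (EuclideanSpace.single i 1)‖ₑ ^ 2) := by
          gcongr with y
          have h1 := sum_enorm_sq_le (W := W) (x := y) he
          push_cast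
          calc _ ≤ _ := add_le_add_right h1 _
            _ ≤ _ := by
              rw [mul_add, add_mul, add_mul, one_mul, one_mul]
              exact add_le_add le_self_add (le_add_self)
      _ = _ := by
          rw [lintegral_const_mul' _ _ ENNReal.coe_ne_top, ← mul_assoc]
          push_cast; rfl

end Chart

/-! ### Mollifiers adapted to Ω near a point of Ω̄. -/

section LocalData

/-- The squared `H¹(Ω)`-norm of a differentiable function. -/
def energy (Ω : Set (E d)) (W : E d → ℂ) : ℝ≥0∞ :=
  ∫⁻ x in Ω, (‖W x‖ₑ ^ 2 + ∑ i, ‖fderiv ℝ W x (EuclideanSpace.single i 1)‖ₑ ^ 2)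

/-- Translated mollifiers adapted to the support of a cutoff function `χ`: they only see values
inside `Ω`, and a trace inequality holds for the mollified functions. -/
structure IsAdapted (Ω : Set (E d)) (χ : E d → ℝ) (φs : ℕ → ContDiffBump (0 : E d))
    (τs : ℕ → E d) (C : ℝ≥0) : Prop where
  tendsto_rOut : Tendsto (fun n => (φs n).rOut) atTop (𝓝 0)
  tendsto_shift : Tendsto τs atTop (𝓝 0)
  mem_of_mem_ball : ∀ n, ∀ x ∈ closure Ω, ∀ y ∈ tsupport χ,
    y ∈ Metric.closedBall (x + τs n) (φs n).rOut → y ∈ Ω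
  -- The constant is independent of n, so the inequality survives n → ∞.
  trace_le : ∀ n (f : E d → ℂ), LocallyIntegrable f volume → (∀ᵐ y, y ∉ tsupport χ → f y = 0) →
    ∫⁻ x, ‖mollify (φs n) (τs n) f x‖ₑ ^ 2 ∂(surfaceMeasure Ω) ≤
      C * energy Ω (mollify (φs n) (τs n) f)

theorem mollify_eq_zero_of_dist {χ : E d → ℝ} {x₀ : E d} {r R : ℝ}
    (hχ : tsupport χ ⊆ Metric.ball x₀ r) {φ : ContDiffBump (0 : E d)} {τ : E d}
    (hR : r + φ.rOut + ‖τ‖ ≤ R) {f : E d → ℂ} (hf : ∀ᵐ y, y ∉ tsupport χ → f y = 0) {x : E d}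
    (hx : x ∉ Metric.ball x₀ R) : mollify φ τ f x = 0 := by
  rw [mollify_congr (g := 0) x]
  · simp [mollify]
  filter_upwards [hf] with y hy hyb
  refine hy fun hmem => hx ?_
  have h1 := hχ hmem
  rw [mem_ball_iff_norm] at h1 hyb ⊢
  have e : x - x₀ = (y - x₀) - (y - (x + τ)) - τ := by abel
  rw [e]
  have a1 := norm_sub_le ((y - x₀) - (y - (x + τ))) τ
  have a2 := norm_sub_le (y - x₀) (y - (x + τ))
  linarith

theorem exists_bumps {ε : ℕ → ℝ} (hε : ∀ n, 0 < ε n) :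
    ∃ φs : ℕ → ContDiffBump (0 : E d), ∀ n, (φs n).rOut = ε n :=
  ⟨fun n => ⟨ε n / 2, ε n, half_pos (hε n), half_lt_self (hε n)⟩, fun _ => rfl⟩

/-- Around every point of `Ω̄`, cutoff functions with small support admit adapted mollifiers. -/
theorem exists_adapted (hΩ : IsOpen Ω) (hL : HasLipschitzBoundary Ω) {x₀ : E d}
    (hx₀ : x₀ ∈ closure Ω) :
    ∃ r > 0, surfaceMeasure Ω (Metric.ball x₀ r) < ⊤ ∧
      ∀ χ : E d → ℝ, tsupport χ ⊆ Metric.ball x₀ r → ∃ φs τs C, IsAdapted Ω χ φs τs C := by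
  have hone : Tendsto (fun n : ℕ => 1 / ((n : ℝ) + 1)) atTop (𝓝 0) :=
    tendsto_one_div_add_atTop_nhds_zero_nat
  have hle : ∀ n : ℕ, 1 / ((n : ℝ) + 1) ≤ 1 := fun n => by
    rw [div_le_one (by positivity)]; linarith [(Nat.cast_nonneg n : (0 : ℝ) ≤ n)]
  have hpos : ∀ n : ℕ, 0 < 1 / ((n : ℝ) + 1) := fun n => by positivity
  by_cases hx : x₀ ∈ Ω
  · obtain ⟨ρ, hρ, hρΩ⟩ := Metric.isOpen_iff.mp hΩ x₀ hx
    have hdisj : ∀ x ∈ frontier Ω, x ∉ Metric.ball x₀ ρ := by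
      intro x hxf hxb
      rw [hΩ.frontier_eq] at hxf
      exact hxf.2 (hρΩ hxb)
    refine ⟨ρ / 2, by positivity, ?_, fun χ hχ => ?_⟩
    · have : surfaceMeasure Ω (Metric.ball x₀ (ρ / 2)) = 0 := by
        rw [surfaceMeasure, Measure.restrict_apply Metric.isOpen_ball.measurableSet]
        have : Metric.ball x₀ (ρ / 2) ∩ frontier Ω = ∅ := by
          ext x
          simp only [mem_inter_iff, mem_empty_iff_false, iff_false, not_and]
          exact fun h1 h2 => hdisj x h2 (Metric.ball_subset_ball (by linarith) h1)
        rw [this, measure_empty]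
      rw [this]; exact ENNReal.zero_lt_top
    · obtain ⟨φs, hφs⟩ := exists_bumps (d := d) (ε := fun n : ℕ => ρ / 2 * (1 / ((n : ℝ) + 1)))
        (fun n => mul_pos (by positivity) (hpos n))
      -- At an interior point no shift is needed: the mollified functions vanish on Γ, so the
      -- constant 0 serves.
      refine ⟨φs, fun _ => 0, 0, ⟨?_, tendsto_const_nhds, ?_, ?_⟩⟩
      · simp only [hφs]
        simpa using hone.const_mul (ρ / 2)
      · intro n x _ y hy _
        exact hρΩ (Metric.ball_subset_ball (by linarith) (hχ hy))
      · intro n f _ hf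
        have h0 : ∀ᵐ x ∂(surfaceMeasure Ω), ‖mollify (φs n) 0 f x‖ₑ ^ 2 = 0 := by
          have hfr : ∀ᵐ x ∂(surfaceMeasure Ω), x ∈ frontier Ω :=
            ae_restrict_mem isClosed_frontier.measurableSet
          filter_upwards [hfr] with x hxf
          rw [mollify_eq_zero_of_dist hχ (R := ρ) ?_ hf (hdisj x hxf)]
          · simp
          · rw [hφs, norm_zero]
            have := mul_le_mul_of_nonneg_left (hle n) (by positivity : 0 ≤ ρ / 2)
            linarith
        rw [lintegral_congr_ae h0]
        simp
  · have hfr : x₀ ∈ frontier Ω := by rw [hΩ.frontier_eq]; exact ⟨hx₀, hx⟩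
    obtain ⟨U, e, K, g, hU, hxU, he, hg, hΩU⟩ := hL x₀ hfr
    obtain ⟨ρ, hρ, hρU⟩ := Metric.isOpen_iff.mp hU x₀ hxU
    -- The chart inequality is used with R = 2r, so that 4R = ρ. The cutoff lives in the ball of
    -- radius r; the other half of R is room for shift and mollification.
    set r := ρ / 8 with hr
    have hr0 : 0 < r := by positivity
    obtain ⟨hfin, C, hC⟩ := exists_chart_trace_le hΩ hU he hg hΩU (x₀ := x₀) (R := 2 * r)
      (by positivity) (by rw [hr]; convert hρU using 2; ring)
    refine ⟨r, hr0, (measure_mono (Metric.ball_subset_ball (by linarith))).trans_lt hfin,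
      fun χ hχ => ?_⟩
    set t : ℕ → ℝ := fun n => r / 2 * (1 / ((n : ℝ) + 1)) with ht
    have ht0 : ∀ n, 0 < t n := fun n => mul_pos (by positivity) (hpos n)
    have htr : ∀ n, t n ≤ r / 2 := fun n => by
      have := mul_le_mul_of_nonneg_left (hle n) (by positivity : 0 ≤ r / 2)
      rwa [mul_one] at this
    have hK : (0 : ℝ) < 2 * (1 + K) := by positivity
    -- Half of the bound t/(1 + K) below which `chart_shift` applies.
    obtain ⟨φs, hφs⟩ := exists_bumps (d := d) (ε := fun n => t n / (2 * (1 + K)))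
      (fun n => div_pos (ht0 n) hK)
    have hεt : ∀ n, t n / (2 * (1 + K)) ≤ t n / 2 := fun n => by
      have : (0 : ℝ) ≤ K := K.2
      have := (ht0 n).le
      gcongr
      linarith
    have htt : Tendsto t atTop (𝓝 0) := by simpa [ht] using hone.const_mul (r / 2)
    refine ⟨φs, fun n => t n • e, C, ⟨?_, ?_, ?_, ?_⟩⟩
    · simp only [hφs]
      simpa using htt.div_const (2 * (1 + (K : ℝ)))
    · simpa using htt.smul_const e
    · intro n x hxc y hy hyb
      have h1 := hχ hy
      have hballU : ∀ z, ‖z - x₀‖ < 2 * r → z ∈ U := fun z hz =>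
        hρU (by rw [mem_ball_iff_norm]; linarith)
      rw [mem_ball_iff_norm] at h1
      refine chart_shift hU he hg hΩU (t := t n) (ε := (φs n).rOut) ?_ hxc (hballU x ?_)
        (hballU y (by linarith)) hyb
      · rw [hφs]
        have := ht0 n
        have : (1 + (K : ℝ)) * (t n / (2 * (1 + K))) = t n / 2 := by field_simp
        linarith
      · rw [mem_closedBall_iff_norm, hφs] at hyb
        have e1 : x - x₀ = (y - x₀) - (y - (x + t n • e)) - t n • e := by abel
        rw [e1]
        have a1 := norm_sub_le ((y - x₀) - (y - (x + t n • e))) (t n • e)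
        have a2 := norm_sub_le (y - x₀) (y - (x + t n • e))
        have a3 : ‖t n • e‖ = t n := by
          rw [norm_smul, he, mul_one, Real.norm_of_nonneg (ht0 n).le]
        linarith [hεt n, htr n]
    · intro n f hfl hf
      refine hC _ ((contDiff_mollify hfl).of_le (by simp)) fun x hxb => ?_
      refine mollify_eq_zero_of_dist hχ ?_ hf hxb
      rw [hφs, norm_smul, he, mul_one, Real.norm_of_nonneg (ht0 n).le]
      linarith [hεt n, htr n]

end LocalData

/-! ### A finite adapted partition of unity. -/

section Partition

/-- A finite smooth partition of unity on `Ω̄` by cutoff functions with adapted mollifiers. -/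
theorem exists_adapted_partition (hΩ : IsOpen Ω) (hb : Bornology.IsBounded Ω)
    (hL : HasLipschitzBoundary Ω) :
    surfaceMeasure Ω univ < ⊤ ∧
    ∃ (ι : Type) (_ : Fintype ι) (χ : ι → E d → ℝ), (∀ i, ContDiff ℝ ∞ (χ i)) ∧
      (∀ i, HasCompactSupport (χ i)) ∧ (∀ x ∈ closure Ω, ∑ i, χ i x = 1) ∧
      ∀ i, ∃ φs τs C, IsAdapted Ω (χ i) φs τs C := by
  have hcpt : IsCompact (closure Ω) := hb.isCompact_closure
  have hex : ∀ x : E d, ∃ r > 0, x ∈ closure Ω → surfaceMeasure Ω (Metric.ball x r) < ⊤ ∧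
      ∀ χ : E d → ℝ, tsupport χ ⊆ Metric.ball x r → ∃ φs τs C, IsAdapted Ω χ φs τs C := by
    intro x
    by_cases hx : x ∈ closure Ω
    · obtain ⟨r, hr, h⟩ := exists_adapted hΩ hL hx
      exact ⟨r, hr, fun _ => h⟩
    · exact ⟨1, one_pos, fun h => absurd h hx⟩
  choose r hr hr' using hex
  obtain ⟨t, htc, hcov⟩ := hcpt.elim_nhds_subcover (fun x => Metric.ball x (r x))
    fun x _ => Metric.ball_mem_nhds x (hr x)
  refine ⟨?_, ?_⟩
  · have h1 : surfaceMeasure Ω univ = surfaceMeasure Ω (frontier Ω) := by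
      rw [surfaceMeasure, Measure.restrict_apply_univ, Measure.restrict_apply_self]
    rw [h1]
    refine (measure_mono ((frontier_subset_closure).trans hcov)).trans_lt ?_
    refine (measure_biUnion_finset_le t _).trans_lt ?_
    exact ENNReal.sum_lt_top.mpr fun x hx => (hr' x (htc x hx)).1
  · obtain ⟨f, hf⟩ := SmoothPartitionOfUnity.exists_isSubordinate (modelWithCornersSelf ℝ (E d))
      (isClosed_closure (s := Ω)) (fun i : {x // x ∈ t} => Metric.ball i.1 (r i.1))
      (fun _ => Metric.isOpen_ball) (by
        intro x hx
        obtain ⟨y, hy, hxy⟩ := mem_iUnion₂.mp (hcov hx)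
        exact mem_iUnion.mpr ⟨⟨y, hy⟩, hxy⟩)
    let eq := Fintype.equivFin {x // x ∈ t}
    refine ⟨Fin (Fintype.card {x // x ∈ t}), inferInstance, fun i => f (eq.symm i), fun i => ?_,
      fun i => ?_, fun x hx => ?_, fun i => ?_⟩
    · exact contMDiff_iff_contDiff.mp (f (eq.symm i)).contMDiff
    · exact HasCompactSupport.of_support_subset_isCompact
        (isCompact_closedBall (eq.symm i).1 (r (eq.symm i).1))
        ((subset_tsupport _).trans ((hf (eq.symm i)).trans Metric.ball_subset_closedBall))
    · have := f.sum_eq_one hx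
      rw [finsum_eq_sum_of_fintype] at this
      rw [← this]
      exact Equiv.sum_comp eq.symm fun i => f i x
    · exact (hr' _ (htc _ (eq.symm i).2)).2 _ (hf (eq.symm i))

end Partition

/-! ### The global trace inequality and density of C(Ω̄) ∩ H¹(Ω). -/

section TraceInequality

theorem enorm_H1_sq (v : H1 Ω) {W : E d → ℂ} (hW : toL2 v =ᵐ[volume.restrict Ω] W)
    (hW' : ∀ i, grad v i =ᵐ[volume.restrict Ω] fun x =>
      fderiv ℝ W x (EuclideanSpace.single i 1)) : energy Ω W = ‖v‖ₑ ^ 2 := by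
  have hL : ∀ f : L2 Ω, ‖f‖ₑ ^ 2 = ∫⁻ x in Ω, ‖f x‖ₑ ^ 2 := fun f => by
    rw [Lp.enorm_def, eLpNorm_two_sq]
  have h1 : ‖v‖ ^ 2 = ‖toL2 v‖ ^ 2 + ∑ i, ‖grad v i‖ ^ 2 := by
    change ‖v.1‖ ^ 2 = _
    rw [WithLp.prod_norm_sq_eq_of_L2, PiLp.norm_sq_eq_of_L2]
    rfl
  have h2 : ‖v‖ₑ ^ 2 = ‖toL2 v‖ₑ ^ 2 + ∑ i, ‖grad v i‖ₑ ^ 2 := by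
    have h3 : ‖v‖₊ ^ 2 = ‖toL2 v‖₊ ^ 2 + ∑ i, ‖grad v i‖₊ ^ 2 := by
      rw [← NNReal.coe_inj]
      push_cast
      exact h1
    simp only [enorm_eq_nnnorm]
    exact_mod_cast h3
  have hae : ∀ i, AEMeasurable (fun x => ‖grad v i x‖ₑ ^ 2) (volume.restrict Ω) := fun i =>
    (Lp.aestronglyMeasurable (grad v i)).enorm.pow_const 2
  have hae0 : AEMeasurable (fun x => ‖toL2 v x‖ₑ ^ 2) (volume.restrict Ω) :=
    (Lp.aestronglyMeasurable (toL2 v)).enorm.pow_const 2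
  rw [h2, hL]
  simp only [hL]
  rw [← lintegral_finsetSum' _ fun i _ => hae i, ← lintegral_add_left' hae0, energy]
  refine lintegral_congr_ae ?_
  filter_upwards [hW, eventually_countable_forall.mpr hW'] with x h3 h4
  rw [h3]
  congr 1
  refine Finset.sum_congr rfl fun i _ => ?_
  rw [h4 i]

variable {χ : E d → ℝ} {φs : ℕ → ContDiffBump (0 : E d)} {τs : ℕ → E d} {C : ℝ≥0}

theorem ae_indicator_cutoff_eq_zero (hΩ : IsOpen Ω) (hχ : ContDiff ℝ ∞ χ)
    (hc : HasCompactSupport χ) (p : H1Ambient Ω) :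
    ∀ᵐ y, y ∉ tsupport χ → Ω.indicator (cutoff hχ hc p).fst y = 0 := by
  have h := (ae_restrict_iff' hΩ.measurableSet).mp (coeFn_mulL2 hχ.continuous hc p.fst)
  filter_upwards [h] with y hy hyχ
  by_cases hyΩ : y ∈ Ω
  · rw [indicator_of_mem hyΩ, cutoff_fst, hy hyΩ, image_eq_zero_of_notMem_tsupport hyχ, zero_smul]
  · exact indicator_of_notMem hyΩ _

/-- The localized trace inequality for functions continuous up to the boundary. -/
theorem IsAdapted.eLpNorm_cutoff_le (hA : IsAdapted Ω χ φs τs C) (hΩ : IsOpen Ω)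
    (hb : Bornology.IsBounded Ω) (hχ : ContDiff ℝ ∞ χ) (hc : HasCompactSupport χ) {u : H1 Ω}
    {w : E d → ℂ} (hw : IsContRep u w) :
    eLpNorm (fun x => χ x • w x) 2 (surfaceMeasure Ω) ≤
      NNReal.sqrt C * ‖(cutoff hχ hc : H1Ambient Ω →L[ℂ] H1Ambient Ω)‖ₑ * ‖u‖ₑ := by
  obtain ⟨v, hv1, hv2, hv3⟩ := exists_local_approx hΩ hb hχ hc hA.tendsto_rOut hA.tendsto_shift
    hA.mem_of_mem_ball u
  set f : E d → ℂ := Ω.indicator (cutoff hχ hc u.1).fst with hf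
  set W : ℕ → E d → ℂ := fun n => mollify (φs n) (τs n) f with hW
  have hfl : LocallyIntegrable f volume := locallyIntegrable_indicator hΩ _
  -- Tietze extension: w is continuous only on Ω̄, whereas uniform convergence of mollifications
  -- needs a continuous function on the whole space.
  obtain ⟨w', hw'⟩ := ContinuousMap.exists_restrict_eq (isClosed_closure (s := Ω))
    ⟨(closure Ω).domRestrict w, hw.1.domRestrict⟩
  have hww' : ∀ x ∈ closure Ω, w' x = w x := fun x hx =>
    congrArg (fun h : C(closure Ω, ℂ) => h ⟨x, hx⟩) hw'
  set k : E d → ℂ := fun x => χ x • w' x with hk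
  have hkc : Continuous k := hχ.continuous.smul w'.continuous
  have hks : HasCompactSupport k := hc.smul_right
  have hunif := tendstoUniformly_mollify hA.tendsto_rOut hA.tendsto_shift hkc hks
  -- Over Ω̄ the shifted kernel meets the support of χ only inside Ω, where u and the extension of w
  -- agree almost everywhere.
  have hWk : ∀ n, ∀ x ∈ closure Ω, W n x = mollify (φs n) (τs n) k x := by
    intro n x hx
    refine mollify_congr x ?_
    have h1 := (ae_restrict_iff' hΩ.measurableSet).mp (coeFn_mulL2 hχ.continuous hc u.1.fst)
    have h2 := (ae_restrict_iff' hΩ.measurableSet).mp hw.2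
    filter_upwards [h1, h2] with y h3 h4 hyb
    by_cases hyΩ : y ∈ Ω
    · rw [hf, indicator_of_mem hyΩ, cutoff_fst, h3 hyΩ, hk]
      have h5 : u.1.fst y = w y := h4 hyΩ
      rw [h5]
      simp only [hww' y (subset_closure hyΩ)]
    · have hyχ : y ∉ tsupport χ := fun hmem =>
        hyΩ (hA.mem_of_mem_ball n x hx y hmem (Metric.ball_subset_closedBall hyb))
      rw [hf, indicator_of_notMem hyΩ, hk]
      simp [image_eq_zero_of_notMem_tsupport hyχ]
  have hlim : ∀ᵐ x ∂(surfaceMeasure Ω), Tendsto (fun n => W n x) atTop (𝓝 (χ x • w x)) := by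
    have hfr : ∀ᵐ x ∂(surfaceMeasure Ω), x ∈ frontier Ω :=
      ae_restrict_mem isClosed_frontier.measurableSet
    filter_upwards [hfr] with x hx
    have hxc := frontier_subset_closure hx
    rw [← hww' x hxc]
    refine (hunif.tendsto_at x).congr fun n => (hWk n x hxc).symm
  have hle : ∀ n, eLpNorm (W n) 2 (surfaceMeasure Ω) ≤ NNReal.sqrt C * ‖v n‖ₑ := by
    intro n
    have h1 := hA.trace_le n f hfl (ae_indicator_cutoff_eq_zero hΩ hχ hc u.1)
    rw [enorm_H1_sq (v n) (hv1 n) (hv2 n), ← eLpNorm_two_sq] at h1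
    refine (ENNReal.pow_le_pow_left_iff two_ne_zero).mp (h1.trans (le_of_eq ?_))
    rw [mul_pow, ← ENNReal.coe_pow, NNReal.sq_sqrt]
  -- Fatou's lemma transfers the inequality from the mollified functions to χ w, their pointwise
  -- limit on Γ.
  have hFatou := Lp.eLpNorm_lim_le_liminf_eLpNorm (p := 2)
    (fun n => (contDiff_mollify (φ := φs n) (τ := τs n) hfl).continuous.aestronglyMeasurable
      (μ := surfaceMeasure Ω)) _ hlim
  refine hFatou.trans ?_
  have hten : Tendsto (fun n => (NNReal.sqrt C : ℝ≥0∞) * ‖v n‖ₑ) atTop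
      (𝓝 (NNReal.sqrt C * ‖cutoff hχ hc u.1‖ₑ)) :=
    ENNReal.Tendsto.const_mul hv3.enorm (Or.inr ENNReal.coe_ne_top)
  calc _ ≤ liminf (fun n => (NNReal.sqrt C : ℝ≥0∞) * ‖v n‖ₑ) atTop :=
        liminf_le_liminf (Eventually.of_forall hle)
    _ = NNReal.sqrt C * ‖cutoff hχ hc u.1‖ₑ := hten.liminf_eq
    _ ≤ _ := by
        rw [mul_assoc]
        gcongr
        exact ContinuousLinearMap.le_opENorm _ _

/-- The trace inequality for `C(Ω̄) ∩ H¹(Ω)`. -/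
theorem exists_trace_le (hΩ : IsOpen Ω) (hb : Bornology.IsBounded Ω)
    (hL : HasLipschitzBoundary Ω) :
    ∃ C : ℝ≥0, ∀ (u : H1 Ω) (w : E d → ℂ), IsContRep u w →
      eLpNorm w 2 (surfaceMeasure Ω) ≤ C * ‖u‖ₑ := by
  obtain ⟨hfin, ι, _, χ, hχ, hc, hsum, hA⟩ := exists_adapted_partition hΩ hb hL
  choose φs τs C hA using hA
  refine ⟨∑ i, NNReal.sqrt (C i) *
    ‖(cutoff (hχ i) (hc i) : H1Ambient Ω →L[ℂ] H1Ambient Ω)‖₊, fun u w hw => ?_⟩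
  have hm : AEStronglyMeasurable w (surfaceMeasure Ω) :=
    (hw.1.mono frontier_subset_closure).aestronglyMeasurable isClosed_frontier.measurableSet
  have e1 : eLpNorm w 2 (surfaceMeasure Ω) =
      eLpNorm (∑ i, fun x => χ i x • w x) 2 (surfaceMeasure Ω) := by
    refine eLpNorm_congr_ae ?_
    have hfr : ∀ᵐ x ∂(surfaceMeasure Ω), x ∈ frontier Ω :=
      ae_restrict_mem isClosed_frontier.measurableSet
    filter_upwards [hfr] with x hx
    rw [Finset.sum_apply, ← Finset.sum_smul, hsum x (frontier_subset_closure hx), one_smul]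
  rw [e1]
  refine (eLpNorm_sum_le (fun i _ => (hχ i).continuous.aestronglyMeasurable.smul hm)
    (by norm_num)).trans ?_
  push_cast
  rw [Finset.sum_mul]
  exact Finset.sum_le_sum fun i _ => (hA i).eLpNorm_cutoff_le hΩ hb (hχ i) (hc i) hw

/-- Since the cutoffs sum to 1 on the open set Ω, their derivatives sum to 0 there, and the
product-rule terms cancel. -/
theorem sum_cutoff (hΩ : IsOpen Ω) {ι : Type} [Fintype ι] {χ : ι → E d → ℝ}
    (hχ : ∀ i, ContDiff ℝ ∞ (χ i)) (hc : ∀ i, HasCompactSupport (χ i))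
    (hsum : ∀ x ∈ closure Ω, ∑ i, χ i x = 1) (p : H1Ambient Ω) :
    ∑ i, cutoff (hχ i) (hc i) p = p := by
  have hmul : ∀ {η : ι → E d → ℝ} (h1 : ∀ i, Continuous (η i)) (h2 : ∀ i, HasCompactSupport (η i))
      (f : L2 Ω), ∀ᵐ x ∂(volume.restrict Ω), (∑ i, mulL2 (h1 i) (h2 i) f : L2 Ω) x =
        (∑ i, η i x) • f x := by
    intro η h1 h2 f
    have h3 := Lp.coeFn_finsetSum Finset.univ (fun i => mulL2 (h1 i) (h2 i) f)
    filter_upwards [h3, eventually_countable_forall.mpr fun i => coeFn_mulL2 (h1 i) (h2 i) f]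
      with x h4 h5
    rw [h4, Finset.sum_apply, Finset.sum_smul]
    exact Finset.sum_congr rfl fun i _ => h5 i
  have hχ1 : ∀ f : L2 Ω, ∑ i, mulL2 (hχ i).continuous (hc i) f = f := by
    intro f
    refine Lp.ext ?_
    filter_upwards [hmul (fun i => (hχ i).continuous) hc f, ae_restrict_mem hΩ.measurableSet]
      with x h1 h2
    rw [h1, hsum x (subset_closure h2), one_smul]
  have hχ0 : ∀ (f : L2 Ω) (j : Fin d), ∑ i, mulL2 (continuous_partialDeriv (hχ i) j)
      (hasCompactSupport_partialDeriv (hc i) j) f = 0 := by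
    intro f j
    refine Lp.ext ?_
    filter_upwards [hmul (fun i => continuous_partialDeriv (hχ i) j)
      (fun i => hasCompactSupport_partialDeriv (hc i) j) f, ae_restrict_mem hΩ.measurableSet,
      Lp.coeFn_zero ℂ 2 (volume.restrict Ω)] with x h1 h2 h3
    have h4 : ∑ i, partialDeriv j (χ i) x = 0 := by
      have h5 : fderiv ℝ (fun x => ∑ i, χ i x) x = 0 := by
        have : (fun x => ∑ i, χ i x) =ᶠ[𝓝 x] fun _ => (1 : ℝ) := by
          filter_upwards [hΩ.mem_nhds h2] with y hy using hsum y (subset_closure hy)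
        rw [this.fderiv_eq]; simp
      rw [fderiv_fun_sum fun i _ => (hχ i).differentiable (by simp) x] at h5
      have := congrArg (fun L : E d →L[ℝ] ℝ => L (EuclideanSpace.single j 1)) h5
      simpa [partialDeriv] using this
    rw [h1, h4, zero_smul, h3]; rfl
  have hfst : (∑ i, cutoff (hχ i) (hc i) p).fst = p.fst := by
    have : (∑ i, cutoff (hχ i) (hc i) p).fst = ∑ i, (cutoff (hχ i) (hc i) p).fst :=
      map_sum (WithLp.fstL 2 ℂ (L2 Ω) (PiLp 2 (fun _ : Fin d => L2 Ω))) _ _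
    rw [this]
    exact hχ1 p.fst
  have hsnd : (∑ i, cutoff (hχ i) (hc i) p).snd = p.snd := by
    refine PiLp.ext fun j => ?_
    have : (∑ i, cutoff (hχ i) (hc i) p).snd j = ∑ i, (cutoff (hχ i) (hc i) p).snd j :=
      map_sum (PiLp.proj 2 (fun _ : Fin d => L2 Ω) j ∘L
        WithLp.sndL 2 ℂ (L2 Ω) (PiLp 2 (fun _ : Fin d => L2 Ω))) _ _
    rw [this]
    simp only [cutoff_snd]
    rw [Finset.sum_add_distrib, hχ0, add_zero]
    exact hχ1 (p.snd j)
  exact WithLp.ofLp_injective 2 (Prod.ext hfst hsnd)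

theorem toL2_sum {ι : Type} (s : Finset ι) (v : ι → H1 Ω) :
    toL2 (∑ i ∈ s, v i) = ∑ i ∈ s, toL2 (v i) := by
  have h := map_sum (WithLp.fstL 2 ℂ (L2 Ω) (PiLp 2 (fun _ : Fin d => L2 Ω)) ∘L (H1 Ω).subtypeL) v s
  exact h

/-- `C(Ω̄) ∩ H¹(Ω)` is dense in `H¹(Ω)`. -/
theorem exists_contRep_approx (hΩ : IsOpen Ω) (hb : Bornology.IsBounded Ω)
    (hL : HasLipschitzBoundary Ω) (u : H1 Ω) :
    ∃ (v : ℕ → H1 Ω) (w : ℕ → E d → ℂ), (∀ n, IsContRep (v n) (w n)) ∧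
      Tendsto v atTop (𝓝 u) := by
  obtain ⟨-, ι, _, χ, hχ, hc, hsum, hA⟩ := exists_adapted_partition hΩ hb hL
  choose φs τs C hA using hA
  choose v hv1 hv2 hv3 using fun i => exists_local_approx hΩ hb (hχ i) (hc i)
    (hA i).tendsto_rOut (hA i).tendsto_shift (hA i).mem_of_mem_ball u
  refine ⟨fun n => ∑ i, v i n, fun n => ∑ i, mollify (φs i n) (τs i n)
    (Ω.indicator (cutoff (hχ i) (hc i) u.1).fst), fun n => ⟨?_, ?_⟩, ?_⟩
  · refine Continuous.continuousOn ?_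
    simp only [Finset.sum_fn]
    exact continuous_finsetSum _ fun i _ =>
      (contDiff_mollify (locallyIntegrable_indicator hΩ _)).continuous
  · rw [toL2_sum]
    filter_upwards [Lp.coeFn_finsetSum Finset.univ (fun i => toL2 (v i n)),
      eventually_countable_forall.mpr fun i => hv1 i n] with x h1 h2
    rw [h1, Finset.sum_apply, Finset.sum_apply]
    exact Finset.sum_congr rfl fun i _ => h2 i
  · rw [tendsto_subtype_rng]
    have h := tendsto_finsetSum Finset.univ fun i _ => hv3 i
    rw [sum_cutoff hΩ hχ hc hsum] at h
    refine h.congr fun n => ?_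
    simp

end TraceInequality

/-! ### The trace operator. -/

section Trace

theorem toL2_add (u v : H1 Ω) : toL2 (u + v) = toL2 u + toL2 v := rfl

theorem toL2_smul (c : ℂ) (u : H1 Ω) : toL2 (c • u) = c • toL2 u := rfl

theorem IsContRep.add {u v : H1 Ω} {w k : E d → ℂ} (hu : IsContRep u w) (hv : IsContRep v k) :
    IsContRep (u + v) (w + k) := by
  refine ⟨hu.1.add hv.1, ?_⟩
  rw [toL2_add]
  filter_upwards [Lp.coeFn_add (toL2 u) (toL2 v), hu.2, hv.2] with x h1 h2 h3
  rw [h1, Pi.add_apply, h2, h3]; rfl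

theorem IsContRep.smul (c : ℂ) {u : H1 Ω} {w : E d → ℂ} (hu : IsContRep u w) :
    IsContRep (c • u) (c • w) := by
  refine ⟨hu.1.const_smul c, ?_⟩
  rw [toL2_smul]
  filter_upwards [Lp.coeFn_smul c (toL2 u), hu.2] with x h1 h2
  rw [h1, Pi.smul_apply, h2]; rfl

theorem IsContRep.sub {u v : H1 Ω} {w k : E d → ℂ} (hu : IsContRep u w) (hv : IsContRep v k) :
    IsContRep (u - v) (w - k) := by
  have := hu.add (hv.smul (-1))
  simpa [sub_eq_add_neg] using this

theorem IsContRep.aestronglyMeasurable {u : H1 Ω} {w : E d → ℂ} (hu : IsContRep u w) :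
    AEStronglyMeasurable w (surfaceMeasure Ω) :=
  (hu.1.mono frontier_subset_closure).aestronglyMeasurable isClosed_frontier.measurableSet

theorem IsTrace.add {u v : H1 Ω} {φ ψ : L2Bdry Ω} (hu : IsTrace u φ) (hv : IsTrace v ψ) :
    IsTrace (u + v) (φ + ψ) := by
  obtain ⟨a, w, h1, h2, h3⟩ := hu
  obtain ⟨b, k, h1', h2', h3'⟩ := hv
  refine ⟨fun n => a n + b n, fun n => w n + k n, fun n => (h1 n).add (h1' n), h2.add h2', ?_⟩
  have h4 := h3.add h3'
  rw [add_zero] at h4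
  refine tendsto_of_tendsto_of_tendsto_of_le_of_le tendsto_const_nhds h4 (fun _ => zero_le)
    fun n => ?_
  have m1 : AEStronglyMeasurable (fun x => w n x - φ x) (surfaceMeasure Ω) :=
    (h1 n).aestronglyMeasurable.sub (Lp.aestronglyMeasurable φ)
  have m2 : AEStronglyMeasurable (fun x => k n x - ψ x) (surfaceMeasure Ω) :=
    (h1' n).aestronglyMeasurable.sub (Lp.aestronglyMeasurable ψ)
  refine le_trans (le_of_eq ?_) (eLpNorm_add_le m1 m2 (by norm_num))
  refine eLpNorm_congr_ae ?_
  filter_upwards [Lp.coeFn_add φ ψ] with x hx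
  rw [hx]
  simp only [Pi.add_apply]; ring

theorem IsTrace.smul (c : ℂ) {u : H1 Ω} {φ : L2Bdry Ω} (hu : IsTrace u φ) :
    IsTrace (c • u) (c • φ) := by
  obtain ⟨a, w, h1, h2, h3⟩ := hu
  refine ⟨fun n => c • a n, fun n => c • w n, fun n => (h1 n).smul c, h2.const_smul c, ?_⟩
  have h4 : Tendsto (fun n => ‖c‖ₑ * eLpNorm (fun x => w n x - φ x) 2 (surfaceMeasure Ω)) atTop
      (𝓝 (‖c‖ₑ * 0)) := ENNReal.Tendsto.const_mul h3 (Or.inr enorm_ne_top)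
  rw [mul_zero] at h4
  refine h4.congr fun n => ?_
  rw [← eLpNorm_const_smul]
  refine eLpNorm_congr_ae ?_
  filter_upwards [Lp.coeFn_smul c φ] with x hx
  rw [hx]
  simp only [Pi.smul_apply, smul_sub]

theorem IsTrace.sub {u v : H1 Ω} {φ ψ : L2Bdry Ω} (hu : IsTrace u φ) (hv : IsTrace v ψ) :
    IsTrace (u - v) (φ - ψ) := by
  have := hu.add (hv.smul (-1))
  simpa [sub_eq_add_neg] using this

variable {C : ℝ≥0}

/-- The trace inequality passes to limits of approximating sequences. Applied to a difference of two
traces of the same u, it gives uniqueness. -/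
theorem IsTrace.enorm_le
    (hC : ∀ (u : H1 Ω) (w : E d → ℂ), IsContRep u w →
      eLpNorm w 2 (surfaceMeasure Ω) ≤ C * ‖u‖ₑ) {u : H1 Ω} {φ : L2Bdry Ω}
    (hu : IsTrace u φ) : ‖φ‖ₑ ≤ C * ‖u‖ₑ := by
  obtain ⟨a, w, h1, h2, h3⟩ := hu
  have h4 : Tendsto (fun n => eLpNorm (fun x => w n x - φ x) 2 (surfaceMeasure Ω) + C * ‖a n‖ₑ)
      atTop (𝓝 (0 + C * ‖u‖ₑ)) :=
    h3.add (ENNReal.Tendsto.const_mul h2.enorm (Or.inr ENNReal.coe_ne_top))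
  rw [zero_add] at h4
  refine ge_of_tendsto h4 (Eventually.of_forall fun n => ?_)
  have m1 : AEStronglyMeasurable (fun x => w n x - φ x) (surfaceMeasure Ω) :=
    (h1 n).aestronglyMeasurable.sub (Lp.aestronglyMeasurable φ)
  calc ‖φ‖ₑ = eLpNorm (w n - fun x => w n x - φ x) 2 (surfaceMeasure Ω) := by
        rw [Lp.enorm_def]; congr 1; ext x; simp
    _ ≤ eLpNorm (w n) 2 (surfaceMeasure Ω) + eLpNorm (fun x => w n x - φ x) 2 (surfaceMeasure Ω) :=
        eLpNorm_sub_le (h1 n).aestronglyMeasurable m1 (by norm_num)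
    _ ≤ _ := by rw [add_comm]; gcongr; exact hC _ _ (h1 n)

theorem IsContRep.isTrace {u : H1 Ω} {w : E d → ℂ} (hu : IsContRep u w)
    (hm : MemLp w 2 (surfaceMeasure Ω)) : IsTrace u (hm.toLp w) := by
  refine ⟨fun _ => u, fun _ => w, fun _ => hu, tendsto_const_nhds, ?_⟩
  have : eLpNorm (fun x => w x - hm.toLp w x) 2 (surfaceMeasure Ω) = 0 := by
    rw [← eLpNorm_zero (μ := surfaceMeasure Ω) (p := 2) (α := E d) (ε := ℂ)]
    refine eLpNorm_congr_ae ?_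
    filter_upwards [hm.coeFn_toLp] with x hx
    rw [hx]; simp
  simp only [this]
  exact tendsto_const_nhds

/-- By the trace inequality, the boundary values of an H¹-convergent sequence in C(Ω̄) ∩ H¹(Ω) form
a Cauchy sequence in L²(Γ). -/
theorem exists_isTrace (hΩ : IsOpen Ω) (hb : Bornology.IsBounded Ω) (hL : HasLipschitzBoundary Ω)
    (hC : ∀ (u : H1 Ω) (w : E d → ℂ), IsContRep u w →
      eLpNorm w 2 (surfaceMeasure Ω) ≤ C * ‖u‖ₑ) (u : H1 Ω) : ∃ φ : L2Bdry Ω, IsTrace u φ := by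
  obtain ⟨v, w, hvw, hv⟩ := exists_contRep_approx hΩ hb hL u
  have hm : ∀ n, MemLp (w n) 2 (surfaceMeasure Ω) := fun n =>
    ⟨(hvw n).aestronglyMeasurable, (hC _ _ (hvw n)).trans_lt
      (ENNReal.mul_lt_top ENNReal.coe_lt_top enorm_lt_top)⟩
  have hcau : CauchySeq fun n => (hm n).toLp (w n) := by
    rw [EMetric.cauchySeq_iff]
    intro ε hε
    have hvc := EMetric.cauchySeq_iff.mp hv.cauchySeq
    obtain ⟨δ, hδ, hδε⟩ : ∃ δ > 0, (C : ℝ≥0∞) * δ < ε := by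
      have h1 : Tendsto (fun δ : ℝ≥0∞ => (C : ℝ≥0∞) * δ) (𝓝[>] 0) (𝓝 (C * 0)) :=
        (ENNReal.Tendsto.const_mul tendsto_id (Or.inr ENNReal.coe_ne_top)).mono_left
          nhdsWithin_le_nhds
      rw [mul_zero] at h1
      obtain ⟨δ, h2, h3⟩ := ((h1.eventually_lt_const hε).and self_mem_nhdsWithin).exists
      exact ⟨δ, h3, h2⟩
    obtain ⟨N, hN⟩ := hvc δ hδ
    refine ⟨N, fun m hm' n hn => ?_⟩
    refine lt_of_le_of_lt ?_ hδε
    rw [Lp.edist_toLp_toLp]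
    refine (hC _ _ ((hvw m).sub (hvw n))).trans ?_
    gcongr
    rw [← edist_eq_enorm_sub]
    exact (hN m hm' n hn).le
  obtain ⟨φ, hφ⟩ := cauchySeq_tendsto_of_complete hcau
  refine ⟨φ, v, w, hvw, hv, ?_⟩
  rw [Lp.tendsto_Lp_iff_tendsto_eLpNorm'] at hφ
  refine hφ.congr fun n => ?_
  refine eLpNorm_congr_ae ?_
  filter_upwards [(hm n).coeFn_toLp] with x hx
  rw [Pi.sub_apply, hx]

/-- The trace operator `H¹(Ω) → L²(Γ)`. -/
theorem exists_trace_operator (hΩ : IsOpen Ω) (hb : Bornology.IsBounded Ω)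
    (hL : HasLipschitzBoundary Ω) :
    ∃ tr : H1 Ω →L[ℂ] L2Bdry Ω, (∀ u φ, IsTrace u φ ↔ φ = tr u) ∧
      ∀ u w, IsContRep u w → tr u =ᵐ[surfaceMeasure Ω] w := by
  obtain ⟨C, hC⟩ := exists_trace_le hΩ hb hL
  choose t ht using exists_isTrace hΩ hb hL hC
  have huniq : ∀ {u φ ψ}, IsTrace (Ω := Ω) u φ → IsTrace u ψ → φ = ψ := by
    intro u φ ψ h1 h2
    have := (h1.sub h2).enorm_le hC
    have h0 : ‖(0 : H1 Ω)‖ₑ = 0 := enorm_eq_zero.mpr rfl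
    rw [sub_self, h0, mul_zero, nonpos_iff_eq_zero, enorm_eq_zero, sub_eq_zero] at this
    exact this
  let l : H1 Ω →ₗ[ℂ] L2Bdry Ω :=
    { toFun := t
      map_add' := fun u v => huniq (ht _) ((ht u).add (ht v))
      map_smul' := fun c u => huniq (ht _) ((ht u).smul c) }
  let tr : H1 Ω →L[ℂ] L2Bdry Ω := l.mkContinuous C fun u => by
    have h := (ht u).enorm_le hC
    simp only [enorm_eq_nnnorm] at h
    exact_mod_cast h
  have htr : ∀ u φ, IsTrace u φ ↔ φ = tr u := fun u φ =>
    ⟨fun h => huniq h (ht u), fun h => h ▸ ht u⟩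
  refine ⟨tr, htr, fun u w hw => ?_⟩
  have hm : MemLp w 2 (surfaceMeasure Ω) :=
    ⟨hw.aestronglyMeasurable, (hC _ _ hw).trans_lt
      (ENNReal.mul_lt_top ENNReal.coe_lt_top enorm_lt_top)⟩
  rw [← (htr u _).mp (hw.isTrace hm)]
  exact hm.coeFn_toLp

end Trace

/-! ### The Wentzell Laplacian as the operator of the form. -/

section Identification

theorem IsTestFunction.partialDeriv {φ : E d → ℝ} (hφ : IsTestFunction Ω φ) (i : Fin d) :
    IsTestFunction Ω (partialDeriv i φ) where
  contDiff := (hφ.contDiff.fderiv_right (m := ∞) (by simp)).clm_apply contDiff_const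
  hasCompactSupport := hasCompactSupport_partialDeriv hφ.hasCompactSupport i
  tsupport_subset := (tsupport_fderiv_apply_subset ℝ _).trans hφ.tsupport_subset

theorem laplacian_eq_sum_partialDeriv {φ : E d → ℝ} (hφ : ContDiff ℝ ∞ φ) (x : E d) :
    Laplacian.laplacian φ x = ∑ i, partialDeriv i (partialDeriv i φ) x := by
  rw [InnerProductSpace.laplacian_eq_iteratedFDeriv_orthonormalBasis φ
    (EuclideanSpace.basisFun (Fin d) ℝ)]
  refine Finset.sum_congr rfl fun i _ => ?_
  have hd : DifferentiableAt ℝ (fderiv ℝ φ) x :=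
    ((hφ.fderiv_right (m := ∞) (by simp)).differentiable (by simp)) x
  rw [iteratedFDeriv_two_apply]
  simp only [partialDeriv, EuclideanSpace.basisFun_apply, Matrix.cons_val_zero, Matrix.cons_val_one]
  have e : partialDeriv i φ = fun y => fderiv ℝ φ y (EuclideanSpace.single i 1) := rfl
  rw [e, fderiv_clm_apply hd (differentiableAt_const _)]
  simp

theorem grad_spec (u : H1 Ω) (i : Fin d) : IsWeakPartialDeriv Ω i (toL2 u) (grad u i) := u.2 i

theorem integral_laplacian_smul {φ : E d → ℝ} (hφ : IsTestFunction Ω φ) (u : H1 Ω) :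
    ∫ x in Ω, Laplacian.laplacian φ x • toL2 u x =
      -∑ i, ∫ x in Ω, partialDeriv i φ x • grad u i x := by
  simp only [laplacian_eq_sum_partialDeriv hφ.contDiff, Finset.sum_smul]
  rw [integral_finsetSum _ fun i _ => (hφ.partialDeriv i).integrable_partialDeriv_smul i _,
    ← Finset.sum_neg_distrib]
  exact Finset.sum_congr rfl fun i _ => grad_spec u i _ (hφ.partialDeriv i)

theorem inner_H1 (u v : H1 Ω) :
    inner ℂ v u = inner ℂ (toL2 v) (toL2 u) + ∑ i, inner ℂ (grad v i) (grad u i) := by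
  change inner ℂ (v : H1Ambient Ω) (u : H1Ambient Ω) = _
  rw [WithLp.prod_inner_apply, PiLp.inner_apply]
  rfl

/-- Multiplication by a bounded function on `L²(Γ)`. -/
def mulBdry (β : LInfBdry Ω) : L2Bdry Ω →L[ℂ] L2Bdry Ω :=
  (ContinuousLinearMap.mul ℂ ℂ).holderL (surfaceMeasure Ω) ⊤ 2 2 β

theorem coeFn_mulBdry (β : LInfBdry Ω) (φ : L2Bdry Ω) :
    mulBdry β φ =ᵐ[surfaceMeasure Ω] fun x => β x * φ x :=
  (ContinuousLinearMap.mul ℂ ℂ).coeFn_holder (r := 2) β φ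

/-- The embedding `u ↦ (u, u_Γ)` of `H¹(Ω)` into `L²(Ω) × L²(Γ)`. -/
def traceEmbedding (tr : H1 Ω →L[ℂ] L2Bdry Ω) : H1 Ω →L[ℂ] WithLp 2 (L2 Ω × L2Bdry Ω) :=
  (WithLp.prodContinuousLinearEquiv 2 ℂ _ _).symm.toContinuousLinearMap ∘L
    ((WithLp.fstL 2 ℂ _ _ ∘L (H1 Ω).subtypeL).prod tr)

/-- The bounded operator `(f, φ) ↦ (-f, βφ)` on `L²(Ω) × L²(Γ)`. -/
def robinPerturbation (β : LInfBdry Ω) :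
    WithLp 2 (L2 Ω × L2Bdry Ω) →L[ℂ] WithLp 2 (L2 Ω × L2Bdry Ω) :=
  (WithLp.prodContinuousLinearEquiv 2 ℂ _ _).symm.toContinuousLinearMap ∘L
    ((-WithLp.fstL 2 ℂ _ _).prod (mulBdry β ∘L WithLp.sndL 2 ℂ _ _))

theorem traceEmbedding_apply (tr : H1 Ω →L[ℂ] L2Bdry Ω) (u : H1 Ω) :
    traceEmbedding tr u = WithLp.toLp 2 (toL2 u, tr u) := rfl

theorem robinPerturbation_apply (β : LInfBdry Ω) (f : L2 Ω) (φ : L2Bdry Ω) :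
    robinPerturbation β (WithLp.toLp 2 (f, φ)) = WithLp.toLp 2 (-f, mulBdry β φ) := rfl

theorem traceEmbedding_injective (hΩ : IsOpen Ω) (tr : H1 Ω →L[ℂ] L2Bdry Ω) :
    Function.Injective (traceEmbedding tr) := by
  intro u v h
  rw [traceEmbedding_apply, traceEmbedding_apply] at h
  exact H1_ext hΩ (Prod.ext_iff.mp (WithLp.toLp_injective 2 h)).1

/-- Green's identity `∫ f v̄ + ∫ ∇u · ∇v̄ = ∫ h v̄_Γ` for all `v ∈ H¹(Ω)`, where `v_Γ = tr v`. -/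
def GreenIdentity (tr : H1 Ω →L[ℂ] L2Bdry Ω) (u : H1 Ω) (f : L2 Ω) (h : L2Bdry Ω) : Prop :=
  ∀ v : H1 Ω, inner ℂ (toL2 v) f + ∑ i, inner ℂ (grad v i) (grad u i) = inner ℂ (tr v) h

/-- The component -f of S cancels the L² part of the H¹ inner product and leaves ∫ ∇u·∇v̄. The
remaining boundary terms are Green's right-hand side with h = -β u_Γ - f_Γ. -/
theorem formRel_iff_greenIdentity (tr : H1 Ω →L[ℂ] L2Bdry Ω) (β : LInfBdry Ω) (u f : H1 Ω) :
    formRel (traceEmbedding tr) (robinPerturbation β) u f ↔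
      GreenIdentity tr u (toL2 f) (-mulBdry β (tr u) - tr f) := by
  refine forall_congr' fun v => ?_
  simp only [traceEmbedding_apply, robinPerturbation_apply, WithLp.prod_inner_apply, inner_H1,
    inner_neg_right, inner_sub_right]
  constructor <;> intro h <;> linear_combination h

theorem integral_mul_star {μ : Measure (E d)} (f g : Lp ℂ 2 μ) :
    ∫ x, f x * star (g x) ∂μ = inner ℂ g f := by
  rw [L2.inner_def]
  simp [RCLike.inner_apply]

theorem integral_sum_grad (u v : H1 Ω) :
    ∫ x in Ω, ∑ i, grad u i x * star (grad v i x) = ∑ i, inner ℂ (grad v i) (grad u i) := by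
  rw [integral_finsetSum]
  · exact Finset.sum_congr rfl fun i _ => integral_mul_star _ _
  · intro i _
    simpa [RCLike.inner_apply] using L2.integrable_inner (𝕜 := ℂ) (grad v i) (grad u i)

theorem continuous_toL2 : Continuous (toL2 : H1 Ω → L2 Ω) :=
  continuous_fst_ambient.comp continuous_subtype_val

theorem continuous_grad (i : Fin d) : Continuous fun u : H1 Ω => grad u i :=
  (continuous_snd_ambient i).comp continuous_subtype_val

variable {tr : H1 Ω →L[ℂ] L2Bdry Ω}

/-- Both sides are continuous in v for the H¹ norm, so it suffices to test on the dense subspace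
C(Ω̄) ∩ H¹(Ω). -/
theorem greenIdentity_iff (hΩ : IsOpen Ω) (hb : Bornology.IsBounded Ω)
    (hL : HasLipschitzBoundary Ω)
    (htr : ∀ (v : H1 Ω) (w : E d → ℂ), IsContRep v w → tr v =ᵐ[surfaceMeasure Ω] w)
    (u : H1 Ω) (f : L2 Ω) (h : L2Bdry Ω) :
    GreenIdentity tr u f h ↔ ∀ (v : H1 Ω) (w : E d → ℂ), IsContRep v w →
      (∫ x in Ω, f x * star (toL2 v x)) + (∫ x in Ω, ∑ i, grad u i x * star (grad v i x)) =
        ∫ x, h x * star (w x) ∂(surfaceMeasure Ω) := by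
  have key : ∀ (v : H1 Ω) (w : E d → ℂ), IsContRep v w →
      ∫ x, h x * star (w x) ∂(surfaceMeasure Ω) = inner ℂ (tr v) h := by
    intro v w hw
    rw [← integral_mul_star]
    refine integral_congr_ae ?_
    filter_upwards [htr v w hw] with x hx
    rw [hx]
  constructor
  · intro H v w hw
    rw [key v w hw, integral_mul_star, integral_sum_grad]
    exact H v
  · intro H v
    obtain ⟨a, w, ha, hlim⟩ := exists_contRep_approx hΩ hb hL v
    have hc : IsClosed {v : H1 Ω | inner ℂ (toL2 v) f + ∑ i, inner ℂ (grad v i) (grad u i) =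
        inner ℂ (tr v) h} := by
      refine isClosed_eq ((continuous_toL2.inner continuous_const).add ?_)
        (tr.continuous.inner continuous_const)
      exact continuous_finsetSum _ fun i _ => (continuous_grad i).inner continuous_const
    refine hc.mem_of_tendsto hlim (Eventually.of_forall fun n => ?_)
    have := H (a n) (w n) (ha n)
    rwa [key _ _ (ha n), integral_mul_star, integral_sum_grad] at this

/-- Functions in C_c^∞(Ω) have zero trace, so for them the boundary term disappears. -/
theorem GreenIdentity.isLaplacian (hΩ : IsOpen Ω) (hb : Bornology.IsBounded Ω)
    (htr : ∀ (v : H1 Ω) (w : E d → ℂ), IsContRep v w → tr v =ᵐ[surfaceMeasure Ω] w)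
    {u : H1 Ω} {f : L2 Ω} {h : L2Bdry Ω} (H : GreenIdentity tr u f h) : IsLaplacian u f := by
  intro φ hφ
  obtain ⟨v, hv, hg⟩ := exists_H1_of_contDiff (Ω := Ω) hb (w := fun x => (φ x : ℂ))
    (Complex.ofRealCLM.contDiff.comp (hφ.contDiff.of_le (by simp)))
  have hrep : IsContRep v fun x => (φ x : ℂ) :=
    ⟨(Complex.continuous_ofReal.comp hφ.contDiff.continuous).continuousOn, hv⟩
  have h0 : tr v = 0 := by
    refine Lp.ext ?_
    filter_upwards [htr v _ hrep, Lp.coeFn_zero ℂ 2 (surfaceMeasure Ω),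
      ae_restrict_mem isClosed_frontier.measurableSet] with x h1 h2 h3
    rw [h1, h2, image_eq_zero_of_notMem_tsupport (f := φ)]
    · simp
    · intro hx
      rw [hΩ.frontier_eq] at h3
      exact h3.2 (hφ.tsupport_subset hx)
  have e1 : inner ℂ (toL2 v) f = ∫ x in Ω, φ x • f x := by
    rw [← integral_mul_star]
    refine integral_congr_ae ?_
    filter_upwards [hv] with x hx
    rw [hx]
    simp [mul_comm]
  have e2 : ∀ i, inner ℂ (grad v i) (grad u i) = ∫ x in Ω, partialDeriv i φ x • grad u i x := by
    intro i
    rw [← integral_mul_star]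
    refine integral_congr_ae ?_
    filter_upwards [hg i] with x hx
    have hdx : HasFDerivAt (fun x => (φ x : ℂ)) (Complex.ofRealCLM ∘L fderiv ℝ φ x) x :=
      Complex.ofRealCLM.hasFDerivAt.comp x (hφ.contDiff.differentiable (by simp) x).hasFDerivAt
    rw [hx, hdx.fderiv]
    simp [mul_comm, partialDeriv]
  have := H v
  rw [h0, inner_zero_left, e1] at this
  simp only [e2] at this
  rw [integral_laplacian_smul hφ]
  linear_combination -this

/-- The Wentzell Laplacian is the operator associated with the form
`⟨u, v⟩ + ⟨S (u, u_Γ), (v, v_Γ)⟩` where `S (f, φ) = (-f, βφ)`. -/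
theorem isWentzellLaplacian_iff_formRel (hΩ : IsOpen Ω) (hb : Bornology.IsBounded Ω)
    (hL : HasLipschitzBoundary Ω) (htrace : ∀ u φ, IsTrace u φ ↔ φ = tr u)
    (htr : ∀ (v : H1 Ω) (w : E d → ℂ), IsContRep v w → tr v =ᵐ[surfaceMeasure Ω] w)
    (β : LInfBdry Ω) (u f : H1 Ω) :
    IsWentzellLaplacian β u f ↔ formRel (traceEmbedding tr) (robinPerturbation β) u f := by
  rw [formRel_iff_greenIdentity]
  constructor
  · rintro ⟨hlap, h, uΓ, fΓ, ⟨f', hlap', hgreen⟩, hu, hf, hbc⟩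
    rw [htrace] at hu hf
    subst hu hf
    -- The Laplacian hidden in `IsNormalDeriv` is the given one, because a distributional Laplacian
    -- in L²(Ω) is unique.
    have e : f' = toL2 f :=
      L2_ext_of_test hΩ fun φ hφ => (hlap' φ hφ).symm.trans (hlap φ hφ)
    have eh : h = -mulBdry β (tr u) - tr f := by
      refine Lp.ext ?_
      filter_upwards [hbc, coeFn_mulBdry β (tr u), Lp.coeFn_sub (-mulBdry β (tr u)) (tr f),
        Lp.coeFn_neg (mulBdry β (tr u))] with x h1 h2 h3 h4
      rw [h3, Pi.sub_apply, h4, Pi.neg_apply, h2]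
      linear_combination h1
    rw [← e, ← eh]
    exact (greenIdentity_iff hΩ hb hL htr u f' h).mpr hgreen
  · intro H
    have hlap := H.isLaplacian hΩ hb htr
    refine ⟨hlap, _, tr u, tr f, ⟨toL2 f, hlap, (greenIdentity_iff hΩ hb hL htr _ _ _).mp H⟩,
      (htrace _ _).mpr rfl, (htrace _ _).mpr rfl, ?_⟩
    filter_upwards [coeFn_mulBdry β (tr u), Lp.coeFn_sub (-mulBdry β (tr u)) (tr f),
      Lp.coeFn_neg (mulBdry β (tr u))] with x h2 h3 h4
    rw [h3, Pi.sub_apply, h4, Pi.neg_apply, h2]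
    ring

end Identification

end Wentzell

end

theorem corollary5p2 (d : ℕ) (hd : 1 ≤ d) (Ω : Set (Wentzell.E d)) (hΩ : IsOpen Ω)
    (hb : Bornology.IsBounded Ω) (hL : Wentzell.HasLipschitzBoundary Ω)
    (β : Wentzell.LInfBdry Ω) :
    (∀ u : Wentzell.H1 Ω, ∃! φ : Wentzell.L2Bdry Ω, Wentzell.IsTrace u φ) ∧
      ∃ T : ℝ → Wentzell.H1 Ω →L[ℂ] Wentzell.H1 Ω,
        Wentzell.IsHolomorphicC0Semigroup T ∧
          Wentzell.IsGeneratorOf (Wentzell.IsWentzellLaplacian β) T := by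
  obtain ⟨tr, htrace, htr⟩ := Wentzell.exists_trace_operator hΩ hb hL
  refine ⟨fun u => ⟨tr u, (htrace u _).mpr rfl, fun φ hφ => (htrace u φ).mp hφ⟩, ?_⟩
  refine Wentzell.exists_semigroup_formRel (V := Wentzell.H1 Ω)
    (H := WithLp 2 (Wentzell.L2 Ω × Wentzell.L2Bdry Ω)) (Wentzell.traceEmbedding tr)
    ?_ (Wentzell.robinPerturbation β) _ ?_
  · exact Wentzell.traceEmbedding_injective hΩ tr
  · exact Wentzell.isWentzellLaplacian_iff_formRel hΩ hb hL htrace htr β
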